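/- **Nets.** Formulas are built from literals $A, A^\perp$ with $\otimes$ and $\parr$, and $(F\otimes G)^\perp=G^\perp\parr F^\perp$, $(F\parr G)^\perp=G^\perp\otimes F^\perp$; $\mathsf{MLL}_{\mathbf J}$ has one more pair of dual literals $\mathbf J,\mathbf J^\perp$. An $\mathsf{MLL}$ proof-structure is a finite graph of typed edges made of axiom links (conclusions $A$, $A^\perp$, a literal and its dual), $\otimes$-, $\parr$- and cut links; each edge is the conclusion of exactly one link and the premise of at most one. Nets of $\mathsf{MLL}_{\mathbf J}$ have in addition the axioms $\mathbf J(n)$ (conclusions $\mathbf J$ and $n\ge 0$ edges $\mathbf J^\perp$) and contractions $\mathbf J^\perp(m)$ ($m$ premises $\mathbf J^\perp$, conclusion $\mathbf J^\perp$). Cut elimination has the usual axiom and $\otimes/\parr$ steps, and: (a) a cut between the $\mathbf J$ of $\mathbf J(n)$ and the conclusion of $\mathbf J^\perp(m)$ becomes $m$ copies of $\mathbf J(n)$, the $i$-th one cut with the $i$-th premise of the contraction, and $n$ contractions $\mathbf J^\perp(m)$, the $o$-th one gathering the $o$-th $\mathbf J^\perp$ of all copies and having as conclusion the $o$-th former $\mathbf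 J^\perp$ edge of $\mathbf J(n)$; (b) $\mathbf J(n)$ with one of its $\mathbf J^\perp$ cut with the $\mathbf J$ of another axiom $\mathbf J(m)$ becomes $\mathbf J(n+m-1)$; (c) $\mathbf J^\perp(m)$ whose conclusion is a premise of $\mathbf J^\perp(n)$ is fused with it into $\mathbf J^\perp(n+m-1)$. **Encoding.** Let $R$ be an $\mathsf{MLL}$ proof-structure and $\mathcal L$ a list (order irrelevant, multiplicities counted) of jumps, i.e. of pairs of edges of $R$. The net $\mathbf J_{\mathcal L}(R)$ is obtained from $R$ by replacing each edge $F$ by a gadget with conclusion of type $\mathbf J(F)$, where, for positive $F$ (a literal $A$, or $F=A\otimes B$), $$\mathbf J(A)=((A\otimes\mathbf J)\parr\mathbf J^\perp)\otimes\mathbf J,\qquad \mathbf J(A\otimes B)=(((((\mathbf J(A)\otimes\mathbf J(B))\otimes\mathbf J)\parr\mathbf J^\perp)\otimes\mathbf J)\parr\mathbf J^\perp)\otimes\mathbf J,$$ and $\mathbf J(F^\perp)=\mathbf J(F)^\perp$. The occurrences of $\mathbf J$ and $\mathbf J^\perp$ shown are, from the inside outwards: for a positive literal: out-synchronisation, in-synchronisation,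 absorption; for a negative literal: propagation, absorption, in-synchronisation; for a tensor: green propagation, blue propagation, out-synchronisation, in-synchronisation, absorption; for a par: blue propagation, out-synchronisation, green propagation, absorption, in-synchronisation. Each $\mathbf J$ is the conclusion of its own $\mathbf J$-axiom and each $\mathbf J^\perp$ the conclusion of its own contraction, except that a negative literal has no out-synchronisation point of its own and uses that of the positive conclusion of its axiom link. These are connected by the following $\mathbf J^\perp$-edges from axioms to contractions, and by no others: absorption axioms are $\mathbf J(0)$; out-synchronisation of $F$ to in-synchronisation of $F$, for every edge $F$; for every par and every negative literal, its out-synchronisation to its (green) propagation point; for a tensor, its green axiom to its blue contraction; for every premise $F$ of a $\otimes$- or $\parr$-link, out-synchronisation of $F$ to the blue point of that link; for each jump $(F,F')$ in $\mathcal L$, one edge from out-synchronisation of $F$ to in-synchronisation of $F'$ and, if $F'$ is a premise of a $\otimes$- or $\parr$-link, one more to the blue point of that link. Cuts of $R$ become cuts between the conclusions of the gadgets. **Jumps after a step.** Let $\mathcal L_F$ be the list $\{(F_1,F),(F_2,F)\}$ if $F$ is the conclusion of a $\otimes$- or $\parr$-link with premises $F_1,F_2$, and $\{(A,A^\perp)\}$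 if $F$ is one of the conclusions $A,A^\perp$ of an axiom link. Put $I_F=\mathcal L_F\cup\{(G,F)\mid (G,F_i)\in\mathcal L,\ i=1,2\}$ in the first case, and $I_F=\mathcal L_F$ for a literal. With unions, compositions and products counted with multiplicity, let $$C_{F,F^\perp}=\pi_1(I_F\cup I_{F^\perp})\times\pi_2\big(\{(S,T)\in\mathcal L\mid S\in\{F,F^\perp\}\}\big)$$ and let $\mathcal L\!\downarrow\!\{F,F^\perp\}$ consist of the pairs of $\mathcal L\cup C_{F,F^\perp}$ neither end of which is $F$ or $F^\perp$. **Theorem (bisimulation).** Let $R$ be an $\mathsf{MLL}$ proof-structure, $\mathcal L$ a list of pairs of edges of $R$, and $F,F^\perp$ the premises of a cut in $R$ whose reduction is a step $R\to R'$ (i.e. $F,F^\perp$ are not the two conclusions of one axiom link; when the cut joins the conclusion $A^\perp$ of one axiom link to the conclusion $A$ of another, the new axiom link of $R'$ has as conclusions the two other edges). Assume that $\mathcal L$ contains no jump from $F$ or $F^\perp$ to a premise of the link introducing $F$ or of the link introducing $F^\perp$. Eliminate in $\mathbf J_{\mathcal L}(R)$ all the cuts between the gadgets of $F$ and $F^\perp$: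 perform steps of cut elimination (including (c)), other than reductions of the remaining cuts between conclusions of gadgets of edges of $R$, until none is possible. Then this elimination can be carried out to its end by some sequence of steps, and every net obtained at the end of such a sequence is, up to the names of internal edges (the conclusions of the gadgets of the edges of $R'$ being kept), $$\mathbf J_{\mathcal L\downarrow\{F,F^\perp\}}(R').$$ -/

import Mathlib

namespace JumpNet

universe u v

/-- Formulas of `MLL_J`: literals over the atoms `α`, the special atom `J` and its dual, and the two
multiplicative connectives. -/
inductive Formula (α : Type u) : Type u
  | atom (A : α)
  | natom (A : α)
  | jpos
  | jneg
  | tensor (F G : Formula α)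
  | par (F G : Formula α)

/-- Linear negation; it reverses the order of the components. -/
def Formula.neg {α : Type u} : Formula α → Formula α
  | .atom A => .natom A
  | .natom A => .atom A
  | .jpos => .jneg
  | .jneg => .jpos
  | .tensor F G => .par G.neg F.neg
  | .par F G => .tensor G.neg F.neg

/-- Links between edges named in `ν`.
* `ax A p n`: axiom with conclusions `p : A` (positive) and `n : A⊥`;
* `tensor x y z`, `par x y z`: premises `x`, `y` (in this order), conclusion `z`;
* `cut e`: cut between the two edges of the unordered pair `e`;
* `jax j outs`: the axiom `J(n)`, with conclusions `j : J` and `n` conclusions `J⊥`;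
* `jctr ins c`: the contraction of the premises `ins`, all of type `J⊥`, into `c : J⊥`. -/
inductive Link (α : Type u) (ν : Type v) : Type (max u v)
  | ax (A : α) (p n : ν)
  | tensor (x y z : ν)
  | par (x y z : ν)
  | cut (e : Sym2 ν)
  | jax (j : ν) (outs : Multiset ν)
  | jctr (ins : Multiset ν) (c : ν)

namespace Link

variable {α : Type u} {ν : Type v}

def premises : Link α ν → Multiset ν
  | ax _ _ _ => 0
  | tensor x y _ => {x, y}
  | par x y _ => {x, y}
  | cut e => e.toMultiset
  | jax _ _ => 0
  | jctr ins _ => ins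

def conclusions : Link α ν → Multiset ν
  | ax _ p n => {p, n}
  | tensor _ _ z => {z}
  | par _ _ z => {z}
  | cut _ => 0
  | jax j outs => j ::ₘ outs
  | jctr _ c => {c}

/-- Premises of the link if it is a `⊗`- or a `⅋`-link. -/
def logicalPremises : Link α ν → Multiset ν
  | tensor x y _ => {x, y}
  | par x y _ => {x, y}
  | _ => 0

/-- The typing constraint of a link, for a labelling `ty` of the edges. -/
def Typed (ty : ν → Formula α) : Link α ν → Prop
  | ax A p n => ty p = .atom A ∧ ty n = .natom A
  | tensor x y z => ty z = .tensor (ty x) (ty y)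
  | par x y z => ty z = .par (ty x) (ty y)
  | cut e => ∀ x y, e = s(x, y) → ty y = (ty x).neg
  | jax j outs => ty j = .jpos ∧ ∀ o ∈ outs, ty o = .jneg
  | jctr ins c => (∀ i ∈ ins, ty i = .jneg) ∧ ty c = .jneg

/-- Links of plain `MLL`. -/
def IsMLL : Link α ν → Prop
  | jax _ _ => False
  | jctr _ _ => False
  | _ => True

/-- Renaming of the edges. -/
def rename {μ : Type*} (σ : ν → μ) : Link α ν → Link α μ
  | ax A p n => ax A (σ p) (σ n)
  | tensor x y z => tensor (σ x) (σ y) (σ z)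
  | par x y z => par (σ x) (σ y) (σ z)
  | cut e => cut (e.map σ)
  | jax j outs => jax (σ j) (outs.map σ)
  | jctr ins c => jctr (ins.map σ) (σ c)

end Link

/-- A net is a finite multiset of links on named edges. -/
abbrev Net (α : Type u) (ν : Type v) := Multiset (Link α ν)

namespace Net

variable {α : Type u} {ν : Type v}

/-- The edges of a net; in a proof-structure each edge is the conclusion of exactly one link. -/
def edges (R : Net α ν) : Multiset ν := R.bind Link.conclusions

/-- The edges that are premises of a `⊗`- or a `⅋`-link. -/
def logicalPremises (R : Net α ν) : Multiset ν := R.bind Link.logicalPremises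

/-- `MLL_J`-proof-structures: every edge is the conclusion of exactly one link and the premise of at
most one link, and the edges can be labelled by formulas according to the typing constraints (the
labels are determined by the links). -/
structure IsProofStructure (R : Net α ν) : Prop where
  edges_nodup : R.edges.Nodup
  premises_nodup : (R.bind Link.premises).Nodup
  premises_mem : ∀ x ∈ R.bind Link.premises, x ∈ R.edges
  typed : ∃ ty : ν → Formula α, ∀ l ∈ R, l.Typed ty

/-- `MLL`-proof-structures. -/
structure IsMLLProofStructure (R : Net α ν) : Prop extends IsProofStructure R where
  isMLL : ∀ l ∈ R, l.IsMLL

/-- `S` and `T` are the same net up to the names of their edges, where edges in `X` keep their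
names. -/
def SameUpTo (X : Set ν) (S T : Net α ν) : Prop :=
  ∃ σ : ν → ν, Set.InjOn σ {x | x ∈ S.edges} ∧ (∀ x ∈ X, σ x = x) ∧ S.map (Link.rename σ) = T

end Net

open Link in
/-- One step of cut elimination in `MLL_J`. The label is the cut that is reduced; it is `none` for
the fusion of two contractions, which reduces no cut.
Axioms are atomic, so both premises of a cut between literals are conclusions of axioms.
In `commute`, the axiom `J(n)` is copied once for each premise `i` of the contraction, the copy having
conclusions `f i : J` and `g i o : J⊥` for `o ∈ O`; these names are new and distinct. -/
inductive Step {α : Type u} {ν : Type v} : Option (Sym2 ν) → Net α ν → Net α ν → Prop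
  | axiom_cut (A : α) (p n p' n' : ν) (Q : Net α ν) :
      Step (some s(n, p'))
        (ax A p n ::ₘ ax A p' n' ::ₘ cut s(n, p') ::ₘ Q)
        (ax A p n' ::ₘ Q)
  | tensor_par (x y z x' y' z' : ν) (Q : Net α ν) :
      Step (some s(z, z'))
        (tensor x y z ::ₘ par y' x' z' ::ₘ cut s(z, z') ::ₘ Q)
        (cut s(x, x') ::ₘ cut s(y, y') ::ₘ Q)
  | commute (j c : ν) (O I : Multiset ν) (f : ν → ν) (g : ν → ν → ν) (Q : Net α ν)
      (distinct : (I.map f + (I ×ˢ O).map (fun q => g q.1 q.2)).Nodup)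
      (fresh : ∀ x ∈ I.map f + (I ×ˢ O).map (fun q => g q.1 q.2),
        x ∉ Net.edges (jax j O ::ₘ jctr I c ::ₘ cut s(j, c) ::ₘ Q)) :
      Step (some s(j, c))
        (jax j O ::ₘ jctr I c ::ₘ cut s(j, c) ::ₘ Q)
        (I.map (fun i => jax (f i) (O.map (g i))) + I.map (fun i => cut s(f i, i)) +
          O.map (fun o => jctr (I.map (fun i => g i o)) o) + Q)
  | fuse_axioms (j x j' : ν) (O O' : Multiset ν) (Q : Net α ν) :
      Step (some s(x, j'))
        (jax j (x ::ₘ O) ::ₘ jax j' O' ::ₘ cut s(x, j') ::ₘ Q)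
        (jax j (O + O') ::ₘ Q)
  | fuse_contractions (x c : ν) (I I' : Multiset ν) (Q : Net α ν) :
      Step none
        (jctr I' x ::ₘ jctr (x ::ₘ I) c ::ₘ Q)
        (jctr (I' + I) c ::ₘ Q)

/-! ### The encoding of jumps -/

/-- The places of the edges of the gadget `J(e)` of an edge `e`. -/
inductive Port
  /-- the literal itself, or `J(A) □ J(B)` with `□` the connective of `e` -/
  | raw
  /-- conclusion `J` of the axiom of the green (propagation) point of a tensor -/
  | greenJ
  /-- a `J⊥`-edge into the green point -/
  | greenEdge
  /-- conclusion of the contraction of the green point -/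
  | greenCtr
  /-- conclusion of the green link -/
  | green
  /-- conclusion of the contraction of the blue (propagation) point -/
  | blueCtr
  /-- conclusion of the blue link -/
  | blue
  /-- the `J⊥`-edge from the out-synchronisation point of `e` to the blue point of the link of which
  `e` is a premise -/
  | toBlue
  /-- conclusion `J` of the axiom of the out-synchronisation point -/
  | outJ
  /-- conclusion of the link of the out-synchronisation point -/
  | out
  /-- the `J⊥`-edge from the out-synchronisation point of `e` to its own in-synchronisation point -/
  | inEdge
  /-- conclusion of the contraction of the in-synchronisation point -/
  | inCtr
  /-- conclusion of the link of the in-synchronisation point, below which there is a red link -/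
  | sync
  /-- conclusion `J` of the axiom `J(0)` of the red (absorption) point -/
  | redJ
  /-- conclusion of the red link, below which there is an in-synchronisation point -/
  | red
  /-- the conclusion of the gadget, of type `J(F)` for `e` of type `F` -/
  | root

/-- Names for the edges of `J_L(R)`. The `k`-th copy of a jump `(s, t)` has an edge
`jumpSync ((s, t), k)` to the in-synchronisation point of `t` and possibly an edge
`jumpBlue ((s, t), k)` to the blue point of the link of which `t` is a premise. -/
inductive JName (ν : Type v) : Type v
  | port (e : ν) (p : Port)
  | jumpSync (q : (ν × ν) × ℕ)
  | jumpBlue (q : (ν × ν) × ℕ)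

section encoding

variable {α : Type u} {ν : Type v} [DecidableEq ν]

open Link JName Port

/-- The `J⊥`-edges that leave the out-synchronisation point of `s`, except those that stay in its
gadget. -/
def outEdges (R : Net α ν) (L : Multiset (ν × ν)) (s : ν) : Multiset (JName ν) :=
  (if s ∈ R.logicalPremises then {port s toBlue} else 0) +
    (L.toEnumFinset.val.filter (fun q => q.1.1 = s)).map jumpSync +
    (L.toEnumFinset.val.filter (fun q => q.1.1 = s ∧ q.1.2 ∈ R.logicalPremises)).map jumpBlue

/-- The `J⊥`-edges that arrive at the in-synchronisation point of `t`. -/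
def syncEdges (L : Multiset (ν × ν)) (t : ν) : Multiset (JName ν) :=
  port t inEdge ::ₘ (L.toEnumFinset.val.filter (fun q => q.1.2 = t)).map jumpSync

/-- The `J⊥`-edges that arrive at the blue point of a link with premises `x` and `y` from the
out-synchronisation points of `x` and `y` and from the jumps to `x` and to `y`. -/
def blueEdges (L : Multiset (ν × ν)) (x y : ν) : Multiset (JName ν) :=
  port x toBlue ::ₘ port y toBlue ::ₘ
    (L.toEnumFinset.val.filter (fun q => q.1.2 = x ∨ q.1.2 = y)).map jumpBlue

/-- Lower part of the gadget of a positive edge `e`: below the edge `b` there are, from top to bottom,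
the out-synchronisation, the in-synchronisation and the absorption point. The axiom of the
out-synchronisation point is given apart. The formula is `((b ⊗ J) ⅋ J⊥) ⊗ J`. -/
def posShell (L : Multiset (ν × ν)) (e : ν) (b : JName ν) : Net α (JName ν) :=
  {tensor b (port e outJ) (port e out),
   jctr (syncEdges L e) (port e inCtr),
   par (port e out) (port e inCtr) (port e sync),
   jax (port e redJ) 0,
   tensor (port e sync) (port e redJ) (port e root)}

/-- Lower part of the gadget of a negative edge `e`: below the edge `b` there are, from top to bottom,
the green propagation point, the absorption and the in-synchronisation point. The formula is
`J⊥ ⅋ (J ⊗ (J⊥ ⅋ b))`. -/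
def negShell (L : Multiset (ν × ν)) (e : ν) (b : JName ν) : Net α (JName ν) :=
  {jctr {port e greenEdge} (port e greenCtr),
   par (port e greenCtr) b (port e green),
   jax (port e redJ) 0,
   tensor (port e redJ) (port e green) (port e red),
   jctr (syncEdges L e) (port e inCtr),
   par (port e inCtr) (port e red) (port e root)}

/-- The links of `J_L(R)` that replace a link of `R`. -/
def encodeLink (R : Net α ν) (L : Multiset (ν × ν)) : Link α ν → Net α (JName ν)
  | ax A p n =>
      {ax A (port p raw) (port n raw),
       jax (port p outJ)
        ({port p inEdge, port n inEdge, port n greenEdge} + outEdges R L p + outEdges R L n)} +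
      posShell L p (port p raw) + negShell L n (port n raw)
  | tensor x y e =>
      {tensor (port x root) (port y root) (port e raw),
       jax (port e greenJ) {port e greenEdge},
       tensor (port e raw) (port e greenJ) (port e green),
       jctr (port e greenEdge ::ₘ blueEdges L x y) (port e blueCtr),
       par (port e green) (port e blueCtr) (port e blue),
       jax (port e outJ) (port e inEdge ::ₘ outEdges R L e)} +
      posShell L e (port e blue)
  | par x y e =>
      {par (port x root) (port y root) (port e raw),
       jctr (blueEdges L x y) (port e blueCtr),
       par (port e blueCtr) (port e raw) (port e blue),
       jax (port e outJ) (port e greenEdge ::ₘ port e inEdge ::ₘ outEdges R L e),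
       tensor (port e outJ) (port e blue) (port e out)} +
      negShell L e (port e out)
  | cut c => {cut (c.map (fun e => port e root))}
  | jax _ _ => 0
  | jctr _ _ => 0

/-- The net `J_L(R)` of an `MLL`-proof-structure `R` with jumps `L`. -/
def encode (R : Net α ν) (L : Multiset (ν × ν)) : Net α (JName ν) := R.bind (encodeLink R L)

/-! ### Jumps after a cut step -/

/-- Composition of jumps, `{(G, K) | (G, H) ∈ L₁, (H, K) ∈ L₂}` with multiplicities. -/
def compJumps (L₁ L₂ : Multiset (ν × ν)) : Multiset (ν × ν) :=
  ((L₁ ×ˢ L₂).filter (fun q => q.1.2 = q.2.1)).map (fun q => (q.1.1, q.2.2))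

/-- `L₁ * L₂ = π₁(L₁) × π₂(L₂)`. -/
def expJumps (L₁ L₂ : Multiset (ν × ν)) : Multiset (ν × ν) :=
  L₁.map Prod.fst ×ˢ L₂.map Prod.snd

/-- The jumps `(F₁, F)` and `(F₂, F)` if `F` is the conclusion of a `⊗`- or `⅋`-link with premises
`F₁` and `F₂`. -/
def premiseJumps (R : Net α ν) (F : ν) : Multiset (ν × ν) :=
  R.bind fun l => match l with
    | tensor x y z => if z = F then {(x, F), (y, F)} else 0
    | par x y z => if z = F then {(x, F), (y, F)} else 0
    | _ => 0

/-- The jump `(p, n)` if `F` is one of the conclusions `p : A`, `n : A⊥` of an axiom. -/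
def axiomJumps (R : Net α ν) (F : ν) : Multiset (ν × ν) :=
  R.bind fun l => match l with
    | ax _ p n => if F = p ∨ F = n then {(p, n)} else 0
    | _ => 0

/-- The rule introducing `F` as jumps. -/
def ruleJumps (R : Net α ν) (F : ν) : Multiset (ν × ν) := premiseJumps R F + axiomJumps R F

/-- The jumps toward the propagation point of the gadget of `F`: the rule introducing `F`, and the
jumps into the premises of that rule. -/
def propJumps (R : Net α ν) (L : Multiset (ν × ν)) (F : ν) : Multiset (ν × ν) :=
  ruleJumps R F + compJumps L (premiseJumps R F)

/-- The jumps created by the elimination of the cut between `F` and `G`. -/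
def createdJumps (R : Net α ν) (L : Multiset (ν × ν)) (F G : ν) : Multiset (ν × ν) :=
  expJumps (propJumps R L F + propJumps R L G)
    (L.filter (fun q => q.1 = F) + L.filter (fun q => q.1 = G))

/-- The jumps with no end in `{F, G}`. -/
def excludeJumps (L : Multiset (ν × ν)) (F G : ν) : Multiset (ν × ν) :=
  L.filter (fun q => q.1 ≠ F ∧ q.1 ≠ G ∧ q.2 ≠ F ∧ q.2 ≠ G)

/-- `L ↓ {F, G}`. The created jumps are restricted as well, because `F` and `G` are no longer
edges after the step. -/
def downJumps (R : Net α ν) (L : Multiset (ν × ν)) (F G : ν) : Multiset (ν × ν) :=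
  excludeJumps L F G + excludeJumps (createdJumps R L F G) F G

end encoding

/-! ### Elimination of the cuts between two gadgets -/

section elimination

variable {α : Type u} {ν : Type v}

open JName Port

/-- A step that is part of the elimination of the cuts between the gadgets of `F` and `G`: any step
except the reduction of a cut between the conclusions of the gadgets of two edges of `R` other than
the cut between `F` and `G`. -/
def GadgetStep (R : Net α ν) (F G : ν) (S S' : Net α (JName ν)) : Prop :=
  ∃ l, Step l S S' ∧ ∀ x ∈ R.edges, ∀ y ∈ R.edges,
    l = some s(port x root, port y root) → s(x, y) = s(F, G)

/-- `S` is obtained from `T` by eliminating all the cuts between the gadgets of `F` and `G`. -/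
def IsGadgetElimination (R : Net α ν) (F G : ν) (T S : Net α (JName ν)) : Prop :=
  Relation.ReflTransGen (GadgetStep R F G) T S ∧ ∀ S', ¬ GadgetStep R F G S S'

end elimination

end JumpNet

/-!
The elimination of the cuts between the gadgets of `F` and `G` mixes a few logical steps, between
`MLL`-links, with many steps on the `J`-links. The logical steps are forced: there is at most one at
each stage, and together they turn the frame of the encoding of `R` (its links other than axioms
`J(n)` and contractions) into the frame of the encoding of `R'` (`Chain`, `chain_tensor_par`,
`chain_axiom_cut`). The `J`-steps create copies with arbitrary names in an arbitrary order, and the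
proof follows an invariant of them rather than the nets themselves.

*The invariant.* The `J`-links, read as a directed graph in which an axiom points to its `J⊥`-edges,
a contraction to its conclusion, and a cut from its `J⊥`-premise to its `J`-premise, describe which
contractions are reached from which axioms and in how many ways. Each edge carries a tag (`Tag`):
the polarity of its type, the multiset of the contractions that it reaches, and a rank increasing
along the paths. Tags that are correct at each link (`Tagged`) survive every step, and copies
inherit the tags of what they copy (`State.step`).

*Termination.* A commutation replaces one cut by cuts whose ranks are smaller, a fusion of axioms
removes a cut, and a fusion of contractions removes a contraction. So the number of logical steps to
be made, the multiset of the ranks of the `J`-cuts under the Dershowitz–Manna order, and the number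
of contractions decrease lexicographically (`State.exists_normal`).

*Normal forms.* When no step is possible, no `J`-cut is left and no contraction lies above another
one; ranks exclude the loops, which would be stuck (`State.flat_of_normal`). Then each `J⊥`-edge of
an axiom is a premise of the contraction that it reaches, so that the net is determined by its frame
and by the weights of the axioms, up to the names of the `J⊥`-edges (`State.flat_form`,
`State.sameUpTo`). In particular all normal forms agree with any flat net that has the same frame
and the same weights.

*The weights.* Hence it is enough to find weights for which the tags are correct both in the
encoding of `R` and in that of `R'` (`gadget_elimination`). Suppose that `F` is positive and `G`
negative. The logical steps join the points of the two gadgets, so the weights of `R` are as follows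
(`cutWeights`). What enters the in-synchronisation points of `F` and `G` meets the absorption axioms
`J(0)` and gets weight `0`. What enters their blue points leaves from the out-synchronisation points
of `F` and `G`, and gets the weight `V` of all the jumps from `F` and `G`; the assumption that no
such jump goes to a premise of the links introducing `F` and `G` says that these paths do not
return, and provides the ranks. Every edge or jump into a premise of these links thus composes with
every jump from `F` or `G`, and this is the definition of the created jumps: the weights leaving the
other edges are the same for `R` and the jumps `L` as for `R'` and the jumps `downJumps R L F G`
(`leave_downJumps`). For a cut between axioms, the green point of `G` moreover connects the
out-synchronisation point of the first axiom to that of the second one, which accounts for the jumps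
of the remaining axiom link.
-/

namespace JumpNet

universe u v

open Link

/-! ### Edges and premises of nets -/

/-- The premises of the links of a net. -/
def Net.premises {α : Type u} {μ : Type v} (S : Net α μ) : Multiset μ := S.bind Link.premises

section flow

variable {α : Type u} {μ : Type v}

@[simp] theorem Net.edges_zero : Net.edges (0 : Net α μ) = 0 := rfl

@[simp] theorem Net.edges_cons (l : Link α μ) (S : Net α μ) :
    Net.edges (l ::ₘ S) = l.conclusions + S.edges := Multiset.cons_bind _ _ _

@[simp] theorem Net.edges_add (S T : Net α μ) : Net.edges (S + T) = S.edges + T.edges :=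
  Multiset.add_bind _ _ _

@[simp] theorem Net.premises_zero : Net.premises (0 : Net α μ) = 0 := rfl

@[simp] theorem Net.premises_cons (l : Link α μ) (S : Net α μ) :
    Net.premises (l ::ₘ S) = l.premises + S.premises := Multiset.cons_bind _ _ _

@[simp] theorem Net.premises_add (S T : Net α μ) :
    Net.premises (S + T) = S.premises + T.premises := Multiset.add_bind _ _ _

@[simp] theorem Net.edges_map {ι : Type*} (I : Multiset ι) (h : ι → Link α μ) :
    Net.edges (I.map h) = I.bind fun i => (h i).conclusions := Multiset.bind_map _ _ _

@[simp] theorem Net.premises_map {ι : Type*} (I : Multiset ι) (h : ι → Link α μ) :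
    Net.premises (I.map h) = I.bind fun i => (h i).premises := Multiset.bind_map _ _ _

@[simp] theorem Net.edges_singleton (l : Link α μ) : Net.edges {l} = l.conclusions :=
  Multiset.singleton_bind _ _

@[simp] theorem Net.premises_singleton (l : Link α μ) : Net.premises {l} = l.premises :=
  Multiset.singleton_bind _ _

theorem _root_.Multiset.bind_singleton_self {β : Type*} (s : Multiset β) :
    (s.bind fun x => {x}) = s := by
  rw [Multiset.bind_singleton, Multiset.map_id']

theorem Net.edges_bind {ι : Type*} (I : Multiset ι) (h : ι → Net α μ) :
    Net.edges (I.bind h) = I.bind fun i => (h i).edges := Multiset.bind_assoc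

theorem Net.premises_bind {ι : Type*} (I : Multiset ι) (h : ι → Net α μ) :
    Net.premises (I.bind h) = I.bind fun i => (h i).premises := Multiset.bind_assoc

theorem Net.mem_edges {S : Net α μ} {x : μ} : x ∈ S.edges ↔ ∃ l ∈ S, x ∈ l.conclusions :=
  Multiset.mem_bind

theorem Net.mem_premises {S : Net α μ} {x : μ} : x ∈ S.premises ↔ ∃ l ∈ S, x ∈ l.premises :=
  Multiset.mem_bind

theorem _root_.Sym2.toMultiset_mk' {β : Type*} (a b : β) :
    (Sym2.toMultiset s(a, b) : Multiset β) = {a, b} := rfl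

/-- A link of a net is determined by any of its conclusions. -/
theorem eq_of_mem_conclusions {S : Net α μ} (h : S.edges.Nodup) {l l' : Link α μ} (hl : l ∈ S)
    (hl' : l' ∈ S) {x : μ} (hx : x ∈ l.conclusions) (hx' : x ∈ l'.conclusions) : l = l' := by
  obtain ⟨Q, rfl⟩ := Multiset.exists_cons_of_mem hl
  rcases Multiset.mem_cons.1 hl' with rfl | hl'
  · rfl
  · rw [Net.edges_cons, Multiset.nodup_add] at h
    exact (Multiset.disjoint_left.1 h.2.2 hx (Net.mem_edges.2 ⟨l', hl', hx'⟩)).elim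

/-- A link of a net is determined by any of its premises. -/
theorem eq_of_mem_premises {S : Net α μ} (h : S.premises.Nodup) {l l' : Link α μ} (hl : l ∈ S)
    (hl' : l' ∈ S) {x : μ} (hx : x ∈ l.premises) (hx' : x ∈ l'.premises) : l = l' := by
  obtain ⟨Q, rfl⟩ := Multiset.exists_cons_of_mem hl
  rcases Multiset.mem_cons.1 hl' with rfl | hl'
  · rfl
  · rw [Net.premises_cons, Multiset.nodup_add] at h
    exact (Multiset.disjoint_left.1 h.2.2 hx (Net.mem_premises.2 ⟨l', hl', hx'⟩)).elim

/-- Every step removes from the edges of a net exactly what it removes from its premises. -/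
theorem Step.edges_add_premises {l : Option (Sym2 μ)} {S S' : Net α μ} (h : Step l S S') :
    S.edges + S'.premises = S'.edges + S.premises := by
  cases h with
  | axiom_cut A p n p' n' Q =>
    simp only [Net.edges_add, Net.premises_add, Net.edges_singleton, Net.premises_singleton,
      conclusions, premises, Sym2.toMultiset_mk',
      Multiset.insert_eq_cons, ← Multiset.singleton_add]
    abel
  | tensor_par x y z x' y' z' Q =>
    simp only [Net.edges_add, Net.premises_add, Net.edges_singleton, Net.premises_singleton,
      conclusions, premises, Sym2.toMultiset_mk',
      Multiset.insert_eq_cons, ← Multiset.singleton_add]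
    abel
  | commute j c O I f g Q _ _ =>
    have h1 : (I.bind fun i => O.map (g i)) = O.bind fun o => I.map fun i => g i o :=
      Multiset.bind_map_comm _ _
    simp only [Net.edges_add, Net.premises_add, Net.edges_singleton, Net.premises_singleton,
      Net.edges_map,
      Net.premises_map, conclusions, premises, Sym2.toMultiset_mk',
      Multiset.insert_eq_cons, ← Multiset.singleton_add, Multiset.bind_add, h1,
      Multiset.bind_singleton, Multiset.bind_zero, Multiset.bind_singleton_self]
    abel
  | fuse_axioms j x j' O O' Q =>
    simp only [Net.edges_add, Net.premises_add, Net.edges_singleton, Net.premises_singleton,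
      conclusions, premises, Sym2.toMultiset_mk',
      Multiset.insert_eq_cons, ← Multiset.singleton_add]
    abel
  | fuse_contractions x c I I' Q =>
    simp only [Net.edges_add, Net.premises_add, Net.edges_singleton, Net.premises_singleton,
      conclusions, premises,
      ← Multiset.singleton_add]
    abel

theorem Step.edges_eq {l : Option (Sym2 μ)} {S S' : Net α μ} {D : Multiset μ} (h : Step l S S')
    (hS : S.edges = S.premises + D) : S'.edges = S'.premises + D := by
  have := h.edges_add_premises
  rw [hS] at this
  have h2 : S.premises + S'.edges = S.premises + (S'.premises + D) := by
    rw [add_comm S.premises S'.edges, ← this]; abel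
  exact add_left_cancel h2

theorem Step.nodup_edges {l : Option (Sym2 μ)} {S S' : Net α μ} (h : Step l S S')
    (hS : S.edges.Nodup) : S'.edges.Nodup := by
  cases h with
  | axiom_cut A p n p' n' Q =>
    refine Multiset.nodup_of_le (Multiset.le_iff_exists_add.2 ⟨{n, p'}, ?_⟩) hS
    simp only [Net.edges_add, Net.edges_singleton, conclusions, Multiset.insert_eq_cons,
      ← Multiset.singleton_add]
    abel
  | tensor_par x y z x' y' z' Q =>
    refine Multiset.nodup_of_le (Multiset.le_iff_exists_add.2 ⟨{z, z'}, ?_⟩) hS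
    simp only [Net.edges_add, Net.edges_singleton, conclusions, Multiset.insert_eq_cons,
      ← Multiset.singleton_add]
    abel
  | commute j c O I f g Q hd hf =>
    have h1 : Net.edges (I.map (fun i => (jax (f i) (O.map (g i)) : Link α μ)) +
        I.map (fun i => cut s(f i, i)) + O.map (fun o => jctr (I.map (fun i => g i o)) o) + Q) =
        (I.map f + (I ×ˢ O).map (fun q => g q.1 q.2)) + (O + Q.edges) := by
      have h2 : (I ×ˢ O).map (fun q => g q.1 q.2) = I.bind fun i => O.map (g i) := by
        change (I.bind fun a => O.map (Prod.mk a)).map _ = _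
        rw [Multiset.map_bind]
        simp only [Multiset.map_map, Function.comp_def]
      rw [h2]
      simp only [Net.edges_add, Net.edges_map, conclusions, Multiset.bind_zero,
        ← Multiset.singleton_add, Multiset.bind_add, Multiset.bind_singleton,
        Multiset.bind_singleton_self]
      abel
    have h2 : (O + Q.edges) ≤ Net.edges (jax j O ::ₘ jctr I c ::ₘ cut s(j, c) ::ₘ Q) := by
      refine Multiset.le_iff_exists_add.2 ⟨{j, c}, ?_⟩
      simp only [Net.edges_add, Net.edges_singleton, conclusions, Multiset.insert_eq_cons,
        ← Multiset.singleton_add]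
      abel
    rw [h1, Multiset.nodup_add]
    exact ⟨hd, Multiset.nodup_of_le h2 hS,
      Multiset.disjoint_left.2 fun hx hx' => hf _ hx (Multiset.mem_of_le h2 hx')⟩
  | fuse_axioms j x j' O O' Q =>
    refine Multiset.nodup_of_le (Multiset.le_iff_exists_add.2 ⟨{x, j'}, ?_⟩) hS
    simp only [Net.edges_add, Net.edges_singleton, conclusions, Multiset.insert_eq_cons,
      ← Multiset.singleton_add]
    abel
  | fuse_contractions x c I I' Q =>
    refine Multiset.nodup_of_le (Multiset.le_iff_exists_add.2 ⟨{x}, ?_⟩) hS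
    simp only [Net.edges_add, Net.edges_singleton, conclusions, ← Multiset.singleton_add]
    abel

/-- If the part `A` of `A + Q = Fr + P` is disjoint from `Fr`, it is a part of `P`. -/
theorem exists_add_of_disjoint {β : Type*} {A Q Fr P : Multiset β} (h : A + Q = Fr + P)
    (hA : ∀ l ∈ A, l ∉ Fr) : ∃ P', P = A + P' ∧ Q = Fr + P' := by
  classical
  have hle : A ≤ P := by
    rw [Multiset.le_iff_count]
    intro a
    by_cases ha : a ∈ A
    · have h1 : A.count a ≤ (Fr + P).count a := by
        rw [← h, Multiset.count_add]; omega
      rwa [Multiset.count_add, Multiset.count_eq_zero_of_notMem (hA a ha), zero_add] at h1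
    · simp [ha]
  obtain ⟨P', rfl⟩ := Multiset.le_iff_exists_add.1 hle
  refine ⟨P', rfl, ?_⟩
  have : A + Q = A + (Fr + P') := by rw [h]; abel
  exact add_left_cancel this

/-- Prescribing new values on the image of an injective family. -/
theorem exists_override {ι τ : Type*} (A : Multiset ι) (h : ι → μ) (hd : (A.map h).Nodup)
    (val : ι → τ) (lab : μ → τ) :
    ∃ lab' : μ → τ, (∀ i ∈ A, lab' (h i) = val i) ∧ ∀ x, x ∉ A.map h → lab' x = lab x := by
  classical
  refine ⟨fun x => if hx : ∃ i ∈ A, h i = x then val hx.choose else lab x, ?_, ?_⟩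
  · intro i hi
    have hx : ∃ k ∈ A, h k = h i := ⟨i, hi, rfl⟩
    simp only [dif_pos hx]
    congr 1
    exact Multiset.inj_on_of_nodup_map hd _ hx.choose_spec.1 _ hi hx.choose_spec.2
  · intro x hx
    have hx' : ¬ ∃ i ∈ A, h i = x := by simpa using hx
    simp only [dif_neg hx']

end flow

/-! ### Tagged nets -/

/-- Static information on an edge: its `sign` is `1` for the type `J`, `-1` for `J⊥` and `0` for the
other types; `wt` is the multiset of the contractions reached from the edge along the directed paths
of the `J`-links, and `rk` is a rank that increases along these paths. -/
structure Tag (μ : Type v) where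
  sign : SignType
  wt : Multiset μ
  rk : ℕ

section tagged

variable {α : Type u} {μ : Type v}

/-- The tags `lab` are correct at a link. A path goes from the conclusion `J` of an axiom to its
conclusions `J⊥`, from the premises of a contraction to its conclusion, and from the premise `J⊥` of
a cut to its premise `J`. Links of plain `MLL` other than cuts are not allowed. -/
def Tagged (lab : μ → Tag μ) : Link α μ → Prop
  | jax j O => (lab j).sign = 1 ∧ (lab j).wt = O.bind (fun o => (lab o).wt) ∧
      ∀ o ∈ O, (lab o).sign = -1 ∧ (lab j).rk < (lab o).rk
  | jctr I c => (lab c).sign = -1 ∧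
      ∀ i ∈ I, (lab i).sign = -1 ∧ (lab i).wt = (lab c).wt ∧ (lab i).rk < (lab c).rk
  | cut e => ∃ j c, e = s(j, c) ∧ (lab j).sign = 1 ∧ (lab c).sign = -1 ∧
      (lab c).wt = (lab j).wt ∧ (lab c).rk < (lab j).rk
  | _ => False

theorem Tagged.congr {lab lab' : μ → Tag μ} {l : Link α μ} (h : Tagged lab l)
    (hc : ∀ x ∈ l.conclusions, lab' x = lab x) (hp : ∀ x ∈ l.premises, lab' x = lab x) :
    Tagged lab' l := by
  cases l with
  | ax A p n => exact h
  | tensor x y z => exact h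
  | par x y z => exact h
  | cut e =>
    obtain ⟨j, c, rfl, h⟩ := h
    have h1 : lab' j = lab j := hp j (by simp [premises, Sym2.toMultiset_mk'])
    have h2 : lab' c = lab c := hp c (by simp [premises, Sym2.toMultiset_mk'])
    exact ⟨j, c, rfl, by rwa [h1, h2]⟩
  | jax j O =>
    have h1 : lab' j = lab j := hc j (by simp [conclusions])
    have h2 : ∀ o ∈ O, lab' o = lab o := fun o ho => hc o (by simp [conclusions, ho])
    refine ⟨by rw [h1]; exact h.1, ?_, fun o ho => by rw [h1, h2 o ho]; exact h.2.2 o ho⟩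
    rw [h1, h.2.1]
    exact Multiset.bind_congr fun o ho => by rw [h2 o ho]
  | jctr I c =>
    have h1 : lab' c = lab c := hc c (by simp [conclusions])
    have h2 : ∀ i ∈ I, lab' i = lab i := fun i hi => hp i (by simp [premises, hi])
    exact ⟨by rw [h1]; exact h.1, fun i hi => by rw [h1, h2 i hi]; exact h.2 i hi⟩

theorem Tagged.cut_left {lab : μ → Tag μ} {j c : μ} (h : Tagged lab (cut s(j, c) : Link α μ))
    (hj : (lab j).sign = 1) :
    (lab c).sign = -1 ∧ (lab c).wt = (lab j).wt ∧ (lab c).rk < (lab j).rk := by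
  obtain ⟨j', c', he, h1, h2, h3⟩ := h
  rcases Sym2.eq_iff.1 he with ⟨rfl, rfl⟩ | ⟨rfl, rfl⟩
  · exact ⟨h2, h3⟩
  · rw [hj] at h2; exact absurd h2 (by decide)

theorem Tagged.sign_ne_zero_of_mem_cut {lab : μ → Tag μ} {e : Sym2 μ}
    (h : Tagged lab (cut e : Link α μ)) {x : μ} (hx : x ∈ e) : (lab x).sign ≠ 0 := by
  obtain ⟨j, c, rfl, h1, h2, -⟩ := h
  rcases Sym2.mem_iff.1 hx with rfl | rfl
  · rw [h1]; decide
  · rw [h2]; decide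

/-- For each cut of `P`, the sum of the ranks of its premises. -/
def cutRanks (lab : μ → Tag μ) (P : Net α μ) : Multiset ℕ :=
  P.bind fun l => match l with
    | cut e => {(e.toMultiset.map fun x => (lab x).rk).sum}
    | _ => 0

/-- The number of contractions of `P`. -/
def ctrCount (P : Net α μ) : ℕ :=
  (P.map fun l => match l with
    | jctr _ _ => 1
    | _ => 0).sum

theorem cutRanks_congr {lab lab' : μ → Tag μ} {P : Net α μ}
    (h : ∀ x ∈ P.premises, lab' x = lab x) : cutRanks lab' P = cutRanks lab P := by
  refine Multiset.bind_congr fun l hl => ?_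
  cases l with
  | cut e =>
    simp only
    congr 2
    refine Multiset.map_congr rfl fun x hx => ?_
    rw [h x (Net.mem_premises.2 ⟨_, hl, hx⟩)]
  | _ => rfl

/-- The lexicographic order that decreases in the elimination: the number of remaining logical
cuts, the ranks of the cuts of type `J`, and the number of contractions. -/
def MeasureLT : ℕ × Multiset ℕ × ℕ → ℕ × Multiset ℕ × ℕ → Prop :=
  Prod.Lex (· < ·) (Prod.Lex Multiset.IsDershowitzMannaLT (· < ·))

theorem wellFounded_measureLT : WellFounded MeasureLT :=
  WellFounded.prod_lex wellFounded_lt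
    (WellFounded.prod_lex Multiset.wellFounded_isDershowitzMannaLT wellFounded_lt)

/-! ### The logical part of the elimination -/

/-- `Chain B lab₀ T n Fr`: by `n` logical steps of cut elimination the net `Fr` of `MLL`-links
becomes `T` and a number of cuts of type `J`, which are correct for the tags `lab₀`. At each stage
there is one cut to be reduced; the other ones are blocked, i.e. satisfy `B`. -/
inductive Chain (B : Sym2 μ → Prop) (lab₀ : μ → Tag μ) (T : Net α μ) : ℕ → Net α μ → Prop
  | nil : Chain B lab₀ T 0 T
  | tensor_par {n : ℕ} {Fr Fr' C Q : Net α μ} (x y z x' y' z' : μ) (h : Chain B lab₀ T n Fr')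
      (hFr : Fr = tensor x y z ::ₘ par y' x' z' ::ₘ cut s(z, z') ::ₘ Q)
      (hQ : cut s(x, x') ::ₘ cut s(y, y') ::ₘ Q = Fr' + C)
      (hC : ∀ l ∈ C, ∃ e, l = cut e ∧ Tagged lab₀ l)
      (hB : ¬ B s(z, z')) (hBQ : ∀ l ∈ Q, l.IsMLL ∧ ∀ e, l = cut e → B e) :
      Chain B lab₀ T (n + 1) Fr
  | axiom_cut {n : ℕ} {Fr Fr' Q : Net α μ} (A : α) (p m p' m' : μ) (h : Chain B lab₀ T n Fr')
      (hFr : Fr = ax A p m ::ₘ ax A p' m' ::ₘ cut s(m, p') ::ₘ Q)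
      (hQ : ax A p m' ::ₘ Q = Fr')
      (hB : ¬ B s(m, p')) (hBQ : ∀ l ∈ Q, l.IsMLL ∧ ∀ e, l = cut e → B e) :
      Chain B lab₀ T (n + 1) Fr

variable {B : Sym2 μ → Prop} {lab₀ : μ → Tag μ} {T : Net α μ} {D : Multiset μ}

theorem Chain.isMLL (hT : ∀ l ∈ T, l.IsMLL ∧ ∀ e, l = cut e → B e) {n : ℕ} {Fr : Net α μ}
    (h : Chain B lab₀ T n Fr) : ∀ l ∈ Fr, l.IsMLL := by
  cases h with
  | nil => exact fun l hl => (hT l hl).1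
  | tensor_par x y z x' y' z' h hFr hQ hC hB hBQ =>
    subst hFr
    intro l hl
    simp only [Multiset.mem_cons] at hl
    rcases hl with rfl | rfl | rfl | hl
    · trivial
    · trivial
    · trivial
    · exact (hBQ l hl).1
  | axiom_cut A p m p' m' h hFr hQ hB hBQ =>
    subst hFr
    intro l hl
    simp only [Multiset.mem_cons] at hl
    rcases hl with rfl | rfl | rfl | hl
    · trivial
    · trivial
    · trivial
    · exact (hBQ l hl).1

theorem Chain.mem_edges_of_cut (hT : ∀ l ∈ T, l.IsMLL ∧ ∀ e, l = cut e → B e) {n : ℕ}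
    {Fr : Net α μ} (h : Chain B lab₀ T n Fr) {e : Sym2 μ} (he : cut e ∈ Fr) (hBe : ¬ B e) :
    ∀ x ∈ e, x ∈ Fr.edges := by
  cases h with
  | nil => exact (hBe ((hT _ he).2 e rfl)).elim
  | tensor_par x y z x' y' z' h hFr hQ hC hB hBQ =>
    subst hFr
    simp only [Multiset.mem_cons, reduceCtorEq, false_or, cut.injEq] at he
    rcases he with rfl | he
    · intro a ha
      rcases Sym2.mem_iff.1 ha with rfl | rfl <;> simp [conclusions]
    · exact (hBe ((hBQ _ he).2 e rfl)).elim
  | axiom_cut A p m p' m' h hFr hQ hB hBQ =>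
    subst hFr
    simp only [Multiset.mem_cons, reduceCtorEq, false_or, cut.injEq] at he
    rcases he with rfl | he
    · intro a ha
      rcases Sym2.mem_iff.1 ha with rfl | rfl <;> simp [conclusions]
    · exact (hBe ((hBQ _ he).2 e rfl)).elim

/-! ### The invariant of the elimination -/

/-- The states of the elimination: the net `S` consists of the `MLL`-links `Fr`, at `n` logical
steps from `T`, and of a part `P` with correct tags; the tags at the interface of the two parts are
the initial ones, and each edge `J⊥` of the interface is the conclusion of a contraction. The edges
of `D` are the conclusions of the net. -/
structure State (B : Sym2 μ → Prop) (lab₀ : μ → Tag μ) (T : Net α μ) (D : Multiset μ) (n : ℕ)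
    (Fr P : Net α μ) (lab : μ → Tag μ) (S : Net α μ) : Prop where
  eq : S = Fr + P
  nodup : S.edges.Nodup
  flow : S.edges = S.premises + D
  chain : Chain B lab₀ T n Fr
  sign_edges : ∀ x ∈ Fr.edges, (lab x).sign = 0
  lab_premises : ∀ x ∈ Fr.premises, lab x = lab₀ x
  tagged : ∀ l ∈ P, Tagged lab l
  ctr : ∀ x ∈ Fr.premises, (lab₀ x).sign = -1 → ∃ I, jctr I x ∈ P

/-- Cut elimination that does not reduce the cuts in `B`. -/
def AllowedStep (B : Sym2 μ → Prop) (S S' : Net α μ) : Prop :=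
  ∃ l, Step l S S' ∧ ∀ e, l = some e → ¬ B e

section state

variable {n : ℕ} {Fr P S S' : Net α μ} {lab : μ → Tag μ}

theorem State.nodup_premises (h : State B lab₀ T D n Fr P lab S) : S.premises.Nodup := by
  have := h.nodup
  rw [h.flow] at this
  exact (Multiset.nodup_add.1 this).1

theorem State.mem_edges_of_premises (h : State B lab₀ T D n Fr P lab S) {x : μ}
    (hx : x ∈ S.premises) : x ∈ S.edges := by
  rw [h.flow]
  exact Multiset.mem_add.2 (Or.inl hx)

theorem State.not_mem_premises (h : State B lab₀ T D n Fr P lab S) {x : μ} {l : Link α μ}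
    (hl : l ∈ P) (hx : x ∈ l.premises) : x ∉ Fr.premises := by
  intro hx'
  have := h.nodup_premises
  rw [h.eq, Net.premises_add, Multiset.nodup_add] at this
  exact Multiset.disjoint_left.1 this.2.2 hx' (Net.mem_premises.2 ⟨l, hl, hx⟩)

theorem State.mem_tagged (hT : ∀ l ∈ T, l.IsMLL ∧ ∀ e, l = cut e → B e)
    (h : State B lab₀ T D n Fr P lab S) {l : Link α μ} (hl : l ∈ S) (hJ : ¬ l.IsMLL) : l ∈ P := by
  rw [h.eq, Multiset.mem_add] at hl
  exact hl.resolve_left fun h' => hJ (h.chain.isMLL hT l h')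

theorem State.mem_frame (h : State B lab₀ T D n Fr P lab S) {l : Link α μ} (hl : l ∈ S)
    (hJ : l.IsMLL) (hc : ∀ e, l ≠ cut e) : l ∈ Fr := by
  rw [h.eq, Multiset.mem_add] at hl
  refine hl.resolve_right fun h' => ?_
  have := h.tagged l h'
  cases l with
  | cut e => exact hc e rfl
  | jax j O => exact hJ
  | jctr I c => exact hJ
  | _ => exact this

theorem State.cut_mem_tagged (hT : ∀ l ∈ T, l.IsMLL ∧ ∀ e, l = cut e → B e)
    (h : State B lab₀ T D n Fr P lab S) {e : Sym2 μ} (he : cut e ∈ S) (hB : ¬ B e) {x : μ}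
    (hx : x ∈ e) (hs : (lab x).sign ≠ 0) : cut e ∈ P := by
  rw [h.eq, Multiset.mem_add] at he
  refine he.resolve_left fun h' => hs (h.sign_edges x ?_)
  exact h.chain.mem_edges_of_cut hT h' hB x hx

theorem State.cut_mem_frame (h : State B lab₀ T D n Fr P lab S) {e : Sym2 μ} (he : cut e ∈ S)
    {x : μ} (hx : x ∈ e) (hs : x ∈ Fr.edges) : cut e ∈ Fr := by
  rw [h.eq, Multiset.mem_add] at he
  exact he.resolve_right fun h' =>
    (h.tagged _ h').sign_ne_zero_of_mem_cut hx (h.sign_edges x hs)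

theorem State.fuse_axioms {j x j' : μ} {O O' : Multiset μ} {Q : Net α μ}
    (h : State B lab₀ T D n Fr (jax j (x ::ₘ O) ::ₘ jax j' O' ::ₘ cut s(x, j') ::ₘ Q) lab S)
    (hstep : Step (some s(x, j')) S (Fr + jax j (O + O') ::ₘ Q)) :
    State B lab₀ T D n Fr (jax j (O + O') ::ₘ Q) lab (Fr + jax j (O + O') ::ₘ Q) ∧
      MeasureLT (n, cutRanks lab (jax j (O + O') ::ₘ Q), ctrCount (jax j (O + O') ::ₘ Q))
        (n, cutRanks lab (jax j (x ::ₘ O) ::ₘ jax j' O' ::ₘ cut s(x, j') ::ₘ Q),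
          ctrCount (jax j (x ::ₘ O) ::ₘ jax j' O' ::ₘ cut s(x, j') ::ₘ Q)) := by
  have t1 : Tagged lab (jax j (x ::ₘ O) : Link α μ) := h.tagged _ (by simp)
  have t2 : Tagged lab (jax j' O' : Link α μ) := h.tagged _ (by simp)
  have t3 : Tagged lab (cut s(x, j') : Link α μ) := h.tagged _ (by simp)
  rw [Sym2.eq_swap] at t3
  have t4 := t3.cut_left t2.1
  refine ⟨⟨rfl, hstep.nodup_edges h.nodup, hstep.edges_eq h.flow, h.chain, h.sign_edges,
    h.lab_premises, ?_, ?_⟩, ?_⟩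
  · intro l hl
    rcases Multiset.mem_cons.1 hl with rfl | hl
    · refine ⟨t1.1, ?_, ?_⟩
      · rw [t1.2.1, Multiset.cons_bind, Multiset.add_bind, t4.2.1, t2.2.1, add_comm]
      · intro o ho
        rcases Multiset.mem_add.1 ho with ho | ho
        · exact t1.2.2 o (Multiset.mem_cons_of_mem ho)
        · have h1 := (t1.2.2 x (Multiset.mem_cons_self _ _)).2
          have h2 := (t2.2.2 o ho).2
          exact ⟨(t2.2.2 o ho).1, by omega⟩
    · exact h.tagged l (by simp [hl])
  · intro y hy hs
    obtain ⟨I, hI⟩ := h.ctr y hy hs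
    exact ⟨I, by simpa using hI⟩
  · refine Prod.Lex.right _ (Prod.Lex.left _ _ ?_)
    refine ⟨cutRanks lab Q, 0, {(Multiset.map (fun y => (lab y).rk)
      (Sym2.toMultiset s(x, j'))).sum}, by simp, ?_, ?_, by simp⟩
    · simp [cutRanks]
    · simp only [cutRanks, Multiset.cons_bind, zero_add, add_comm]

theorem State.fuse_contractions {x c : μ} {I I' : Multiset μ} {Q : Net α μ}
    (h : State B lab₀ T D n Fr (jctr I' x ::ₘ jctr (x ::ₘ I) c ::ₘ Q) lab S)
    (hstep : Step none S (Fr + jctr (I' + I) c ::ₘ Q)) :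
    State B lab₀ T D n Fr (jctr (I' + I) c ::ₘ Q) lab (Fr + jctr (I' + I) c ::ₘ Q) ∧
      MeasureLT (n, cutRanks lab (jctr (I' + I) c ::ₘ Q), ctrCount (jctr (I' + I) c ::ₘ Q))
        (n, cutRanks lab (jctr I' x ::ₘ jctr (x ::ₘ I) c ::ₘ Q),
          ctrCount (jctr I' x ::ₘ jctr (x ::ₘ I) c ::ₘ Q)) := by
  have t1 : Tagged lab (jctr I' x : Link α μ) := h.tagged _ (by simp)
  have t2 : Tagged lab (jctr (x ::ₘ I) c : Link α μ) := h.tagged _ (by simp)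
  have t3 := t2.2 x (Multiset.mem_cons_self _ _)
  refine ⟨⟨rfl, hstep.nodup_edges h.nodup, hstep.edges_eq h.flow, h.chain, h.sign_edges,
    h.lab_premises, ?_, ?_⟩, ?_⟩
  · intro l hl
    rcases Multiset.mem_cons.1 hl with rfl | hl
    · refine ⟨t2.1, ?_⟩
      intro i hi
      rcases Multiset.mem_add.1 hi with hi | hi
      · have t4 := t1.2 i hi
        exact ⟨t4.1, t4.2.1.trans t3.2.1, t4.2.2.trans t3.2.2⟩
      · exact t2.2 i (Multiset.mem_cons_of_mem hi)
    · exact h.tagged l (by simp [hl])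
  · intro y hy hs
    obtain ⟨K, hK⟩ := h.ctr y hy hs
    simp only [Multiset.mem_cons, jctr.injEq] at hK
    rcases hK with ⟨-, rfl⟩ | ⟨-, rfl⟩ | hK
    · refine absurd hy (h.not_mem_premises (l := jctr (y ::ₘ I) c) (by simp) ?_)
      simp [premises]
    · exact ⟨I' + I, by simp⟩
    · exact ⟨K, by simp [hK]⟩
  · have h1 : cutRanks lab (jctr (I' + I) c ::ₘ Q) =
        cutRanks lab (jctr I' x ::ₘ jctr (x ::ₘ I) c ::ₘ Q) := by simp [cutRanks]
    rw [h1]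
    refine Prod.Lex.right _ (Prod.Lex.right _ ?_)
    simp [ctrCount]

theorem State.commute {j c : μ} {O I : Multiset μ} {f : μ → μ} {g : μ → μ → μ} {Q N : Net α μ}
    (h : State B lab₀ T D n Fr (jax j O ::ₘ jctr I c ::ₘ cut s(j, c) ::ₘ Q) lab S)
    (hd : (I.map f + (I ×ˢ O).map (fun q => g q.1 q.2)).Nodup)
    (hf : ∀ x ∈ I.map f + (I ×ˢ O).map (fun q => g q.1 q.2), x ∉ S.edges)
    (hN : N = I.map (fun i => jax (f i) (O.map (g i))) + I.map (fun i => cut s(f i, i)) +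
      O.map (fun o => jctr (I.map (fun i => g i o)) o) + Q)
    (hstep : Step (some s(j, c)) S (Fr + N)) :
    ∃ lab', State B lab₀ T D n Fr N lab' (Fr + N) ∧
      MeasureLT (n, cutRanks lab' N, ctrCount N)
        (n, cutRanks lab (jax j O ::ₘ jctr I c ::ₘ cut s(j, c) ::ₘ Q),
          ctrCount (jax j O ::ₘ jctr I c ::ₘ cut s(j, c) ::ₘ Q)) := by
  have t1 : Tagged lab (jax j O : Link α μ) := h.tagged _ (by simp)
  have t2 : Tagged lab (jctr I c : Link α μ) := h.tagged _ (by simp)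
  have t3 : Tagged lab (cut s(j, c) : Link α μ) := h.tagged _ (by simp)
  have t4 := t3.cut_left t1.1
  obtain ⟨lab₁, h1, h1'⟩ := exists_override I f (Multiset.nodup_add.1 hd).1
    (fun i => (⟨1, (lab i).wt, (lab i).rk + 1⟩ : Tag μ)) lab
  obtain ⟨lab₂, h2, h2'⟩ := exists_override (I ×ˢ O) (fun q => g q.1 q.2)
    (Multiset.nodup_add.1 hd).2.1 (fun q => (⟨-1, (lab q.2).wt, (lab q.1).rk + 2⟩ : Tag μ)) lab₁
  have hfi : ∀ i ∈ I, lab₂ (f i) = ⟨1, (lab i).wt, (lab i).rk + 1⟩ := by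
    intro i hi
    rw [h2' _ (Multiset.disjoint_left.1 (Multiset.nodup_add.1 hd).2.2
      (Multiset.mem_map_of_mem f hi)), h1 i hi]
  have hgi : ∀ i ∈ I, ∀ o ∈ O, lab₂ (g i o) = ⟨-1, (lab o).wt, (lab i).rk + 2⟩ :=
    fun i hi o ho => h2 (i, o) (Multiset.mem_product.2 ⟨hi, ho⟩)
  have hold : ∀ x ∈ S.edges, lab₂ x = lab x := by
    intro x hx
    rw [h2' x fun hx' => hf x (Multiset.mem_add.2 (Or.inr hx')) hx,
      h1' x fun hx' => hf x (Multiset.mem_add.2 (Or.inl hx')) hx]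
  have hold' : ∀ x ∈ S.premises, lab₂ x = lab x := fun x hx => hold x (h.mem_edges_of_premises hx)
  have hI : ∀ i ∈ I, lab₂ i = lab i := by
    intro i hi
    refine hold' i ?_
    rw [h.eq]
    simp [premises, hi]
  have hO : ∀ o ∈ O, lab₂ o = lab o := by
    intro o ho
    refine hold o ?_
    rw [h.eq]
    simp [conclusions, ho]
  refine ⟨lab₂, ⟨rfl, hstep.nodup_edges h.nodup, hstep.edges_eq h.flow, h.chain, ?_, ?_, ?_, ?_⟩,
    ?_⟩
  · intro x hx
    rw [hold x (by rw [h.eq]; simp [hx])]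
    exact h.sign_edges x hx
  · intro x hx
    rw [hold' x (by rw [h.eq]; simp [hx])]
    exact h.lab_premises x hx
  · intro l hl
    rw [hN] at hl
    simp only [Multiset.mem_add, Multiset.mem_map] at hl
    rcases hl with ((⟨i, hi, rfl⟩ | ⟨i, hi, rfl⟩) | ⟨o, ho, rfl⟩) | hl
    · refine ⟨by rw [hfi i hi], ?_, ?_⟩
      · rw [hfi i hi, Multiset.bind_map, (t2.2 i hi).2.1, t4.2.1, t1.2.1]
        exact Multiset.bind_congr fun o ho => by rw [hgi i hi o ho]
      · intro o' ho'
        obtain ⟨o, ho, rfl⟩ := Multiset.mem_map.1 ho'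
        rw [hgi i hi o ho, hfi i hi]
        exact ⟨rfl, Nat.lt_succ_self _⟩
    · refine ⟨f i, i, rfl, ?_⟩
      rw [hfi i hi, hI i hi]
      exact ⟨rfl, (t2.2 i hi).1, rfl, Nat.lt_succ_self _⟩
    · refine ⟨by rw [hO o ho]; exact (t1.2.2 o ho).1, ?_⟩
      intro i' hi'
      obtain ⟨i, hi, rfl⟩ := Multiset.mem_map.1 hi'
      rw [hgi i hi o ho, hO o ho]
      have a1 := (t1.2.2 o ho).2
      have a2 := (t2.2 i hi).2.2
      have a3 := t4.2.2
      exact ⟨rfl, rfl, by simp only; omega⟩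
    · refine (h.tagged l (by simp [hl])).congr (fun x hx => hold x ?_) fun x hx => hold' x ?_
      · exact Net.mem_edges.2 ⟨l, by rw [h.eq]; simp [hl], hx⟩
      · exact Net.mem_premises.2 ⟨l, by rw [h.eq]; simp [hl], hx⟩
  · intro y hy hs
    obtain ⟨K, hK⟩ := h.ctr y hy hs
    simp only [Multiset.mem_cons, jctr.injEq, reduceCtorEq, false_or] at hK
    rcases hK with ⟨-, rfl⟩ | hK
    · refine absurd hy (h.not_mem_premises (l := cut s(j, y)) (by simp) ?_)
      simp [premises]
    · exact ⟨K, by rw [hN]; simp [hK]⟩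
  · refine Prod.Lex.right _ (Prod.Lex.left _ _ ?_)
    have hQ : cutRanks lab₂ Q = cutRanks lab Q :=
      cutRanks_congr fun x hx => hold' x (by rw [h.eq]; simp [hx])
    refine ⟨cutRanks lab Q, I.map fun i => ((lab i).rk + 1) + (lab i).rk,
      {(lab j).rk + (lab c).rk}, by simp, ?_, ?_, ?_⟩
    · have hI' : (I.bind fun i => ({(lab₂ (f i)).rk + (lab₂ i).rk} : Multiset ℕ)) =
          I.map fun i => ((lab i).rk + 1) + (lab i).rk := by
        rw [Multiset.bind_singleton]
        exact Multiset.map_congr rfl fun i hi => by rw [hfi i hi, hI i hi]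
      rw [hN, ← hI', ← hQ]
      simp only [cutRanks, Multiset.add_bind, Multiset.bind_map, Multiset.bind_zero, zero_add,
        Sym2.toMultiset_mk', Multiset.insert_eq_cons, Multiset.map_cons, Multiset.map_singleton,
        Multiset.sum_cons, Multiset.sum_singleton, add_zero]
      rw [add_comm]
    · simp only [cutRanks, Multiset.cons_bind, zero_add,
        Sym2.toMultiset_mk', Multiset.insert_eq_cons, Multiset.map_cons, Multiset.map_singleton,
        Multiset.sum_cons, Multiset.sum_singleton]
      rw [add_comm]
    · intro r hr
      obtain ⟨i, hi, rfl⟩ := Multiset.mem_map.1 hr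
      refine ⟨_, Multiset.mem_singleton_self _, ?_⟩
      have a2 := (t2.2 i hi).2.2
      have a3 := t4.2.2
      omega

/-- After a logical step the new net is again a state: the two cuts it creates are either part of
the next stage of the chain or cuts of type `J` with correct tags. -/
theorem State.logical {Fr' C : Net α μ} (h : State B lab₀ T D (n + 1) Fr P lab S)
    {e : Option (Sym2 μ)} (hch : Chain B lab₀ T n Fr')
    (hC : ∀ l ∈ C, ∃ e, l = cut e ∧ Tagged lab₀ l) (hstep : Step e S (Fr' + (C + P)))
    (hedges : ∀ x ∈ Fr'.edges, x ∈ Fr.edges)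
    (hprem : ∀ x ∈ (Fr' + C).premises, x ∈ Fr.premises) :
    State B lab₀ T D n Fr' (C + P) lab (Fr' + (C + P)) := by
  refine ⟨rfl, hstep.nodup_edges h.nodup, hstep.edges_eq h.flow, hch,
    fun x hx => h.sign_edges x (hedges x hx),
    fun x hx => h.lab_premises x (hprem x (by simp [hx])), ?_, ?_⟩
  · intro l hl
    rcases Multiset.mem_add.1 hl with hl | hl
    · obtain ⟨e, rfl, ht⟩ := hC l hl
      refine ht.congr (by simp [conclusions]) fun x hx => h.lab_premises x (hprem x ?_)
      rw [Net.premises_add]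
      exact Multiset.mem_add.2 (Or.inr (Net.mem_premises.2 ⟨_, hl, hx⟩))
    · exact h.tagged l hl
  · intro x hx hs
    obtain ⟨I, hI⟩ := h.ctr x (hprem x (by simp [hx])) hs
    exact ⟨I, by simp [hI]⟩

end state

end tagged

/-! ### Steps of the elimination and termination -/

section elimination

variable {α : Type u} {μ : Type v} {B : Sym2 μ → Prop} {lab₀ : μ → Tag μ} {T : Net α μ}
  {D : Multiset μ} {n : ℕ} {Fr P S S' : Net α μ} {lab : μ → Tag μ}

theorem State.mem_edges (h : State B lab₀ T D n Fr P lab S) {l : Link α μ} (hl : l ∈ Fr) {x : μ}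
    (hx : x ∈ l.conclusions) : l ∈ S ∧ x ∈ Fr.edges :=
  ⟨by rw [h.eq]; simp [hl], Net.mem_edges.2 ⟨l, hl, hx⟩⟩

/-- A step reducing a logical cut is the one prescribed by the chain, because there is only one link
above each premise of the cut. -/
theorem State.step_tensor_par (hT : ∀ l ∈ T, l.IsMLL ∧ ∀ e, l = cut e → B e)
    {x y z x' y' z' : μ} {Q : Net α μ}
    (h : State B lab₀ T D n Fr P lab (tensor x y z ::ₘ par y' x' z' ::ₘ cut s(z, z') ::ₘ Q))
    (hB : ¬ B s(z, z'))
    (hstep : Step (some s(z, z')) (tensor x y z ::ₘ par y' x' z' ::ₘ cut s(z, z') ::ₘ Q)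
      (cut s(x, x') ::ₘ cut s(y, y') ::ₘ Q)) :
    ∃ n' Fr' P' lab',
      State B lab₀ T D n' Fr' P' lab' (cut s(x, x') ::ₘ cut s(y, y') ::ₘ Q) ∧
      MeasureLT (n', cutRanks lab' P', ctrCount P') (n, cutRanks lab P, ctrCount P) := by
  have ht : tensor x y z ∈ Fr := h.mem_frame (by simp) trivial (by simp)
  have hp : par y' x' z' ∈ Fr := h.mem_frame (by simp) trivial (by simp)
  obtain ⟨hzS, hz⟩ := h.mem_edges ht (x := z) (by simp [conclusions])
  have hzS' := (h.mem_edges hp (x := z') (by simp [conclusions])).1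
  have hc : cut s(z, z') ∈ Fr := h.cut_mem_frame (by simp) (Sym2.mem_mk_left _ _) hz
  have hch := h.chain
  cases hch with
  | nil => exact (hB ((hT _ hc).2 _ rfl)).elim
  | @tensor_par n' _ Fr' C Q' a b c a' b' c' hch' hFr hQ hC hB' hBQ =>
    have hta : tensor a b c ∈ Fr := by simp [hFr]
    have hpa : par b' a' c' ∈ Fr := by simp [hFr]
    have htS := (h.mem_edges hta (x := c) (by simp [conclusions])).1
    have hpS := (h.mem_edges hpa (x := c') (by simp [conclusions])).1
    rw [hFr] at hc
    simp only [Multiset.mem_cons, reduceCtorEq, false_or, cut.injEq] at hc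
    rcases hc with he | hc
    · rcases Sym2.eq_iff.1 he with ⟨rfl, rfl⟩ | ⟨rfl, rfl⟩
      · have e1 : tensor x y z = tensor a b z :=
          eq_of_mem_conclusions h.nodup hzS htS (x := z) (by simp [conclusions])
            (by simp [conclusions])
        have e2 : par y' x' z' = par b' a' z' :=
          eq_of_mem_conclusions h.nodup hzS' hpS (x := z') (by simp [conclusions])
            (by simp [conclusions])
        obtain ⟨rfl, rfl, -⟩ : x = a ∧ y = b ∧ z = z := by simpa using e1
        obtain ⟨rfl, rfl, -⟩ : y' = b' ∧ x' = a' ∧ z' = z' := by simpa using e2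
        have hQP : Q = Q' + P := by
          have := h.eq
          rw [hFr] at this
          simpa using this
        have hS' : cut s(x, x') ::ₘ cut s(y, y') ::ₘ Q = Fr' + (C + P) := by
          rw [← add_assoc, ← hQ, hQP, Multiset.cons_add, Multiset.cons_add]
        have hsub : ∀ w ∈ Fr'.edges, w ∈ Fr.edges := by
          intro w hw
          have h1 := congrArg Net.edges hQ
          simp only [Net.edges_cons, Net.edges_add, conclusions, zero_add] at h1
          have : w ∈ Q'.edges := by rw [h1]; simp [hw]
          simp [hFr, this]
        have hprem : ∀ w ∈ (Fr' + C).premises, w ∈ Fr.premises := by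
          intro w hw
          rw [← hQ] at hw
          simp only [hFr, Net.premises_cons, premises, Sym2.toMultiset_mk', Multiset.mem_add,
            Multiset.insert_eq_cons, Multiset.mem_cons, Multiset.mem_singleton] at hw ⊢
          tauto
        rw [hS'] at hstep ⊢
        exact ⟨n', Fr', C + P, lab, h.logical hch' hC hstep hsub hprem,
          Prod.Lex.left _ _ (Nat.lt_succ_self _)⟩
      · have e1 := eq_of_mem_conclusions h.nodup hzS hpS (x := z) (by simp [conclusions])
            (by simp [conclusions])
        simp at e1
    · exact (hB ((hBQ _ hc).2 _ rfl)).elim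
  | @axiom_cut n' _ Fr' Q' A p m p' m' hch' hFr hQ hB' hBQ =>
    have hta : ax A p m ∈ Fr := by simp [hFr]
    have hpa : ax A p' m' ∈ Fr := by simp [hFr]
    have htS := (h.mem_edges hta (x := m) (by simp [conclusions])).1
    have hpS := (h.mem_edges hpa (x := p') (by simp [conclusions])).1
    rw [hFr] at hc
    simp only [Multiset.mem_cons, reduceCtorEq, false_or, cut.injEq] at hc
    rcases hc with he | hc
    · rcases Sym2.eq_iff.1 he with ⟨rfl, rfl⟩ | ⟨rfl, rfl⟩
      · have e1 := eq_of_mem_conclusions h.nodup hzS htS (x := z) (by simp [conclusions])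
            (by simp [conclusions])
        simp at e1
      · have e1 := eq_of_mem_conclusions h.nodup hzS hpS (x := z) (by simp [conclusions])
            (by simp [conclusions])
        simp at e1
    · exact (hB ((hBQ _ hc).2 _ rfl)).elim

theorem State.step_axiom_cut (hT : ∀ l ∈ T, l.IsMLL ∧ ∀ e, l = cut e → B e)
    {A : α} {p m p' m' : μ} {Q : Net α μ}
    (h : State B lab₀ T D n Fr P lab (ax A p m ::ₘ ax A p' m' ::ₘ cut s(m, p') ::ₘ Q))
    (hB : ¬ B s(m, p'))
    (hstep : Step (some s(m, p')) (ax A p m ::ₘ ax A p' m' ::ₘ cut s(m, p') ::ₘ Q)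
      (ax A p m' ::ₘ Q)) :
    ∃ n' Fr' P' lab', State B lab₀ T D n' Fr' P' lab' (ax A p m' ::ₘ Q) ∧
      MeasureLT (n', cutRanks lab' P', ctrCount P') (n, cutRanks lab P, ctrCount P) := by
  have ht : ax A p m ∈ Fr := h.mem_frame (by simp) trivial (by simp)
  have hp : ax A p' m' ∈ Fr := h.mem_frame (by simp) trivial (by simp)
  obtain ⟨hzS, hz⟩ := h.mem_edges ht (x := m) (by simp [conclusions])
  have hzS' := (h.mem_edges hp (x := p') (by simp [conclusions])).1
  have hc : cut s(m, p') ∈ Fr := h.cut_mem_frame (by simp) (Sym2.mem_mk_left _ _) hz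
  have hch := h.chain
  cases hch with
  | nil => exact (hB ((hT _ hc).2 _ rfl)).elim
  | @tensor_par n' _ Fr' C Q' a b c a' b' c' hch' hFr hQ hC hB' hBQ =>
    have hta : tensor a b c ∈ Fr := by simp [hFr]
    have hpa : par b' a' c' ∈ Fr := by simp [hFr]
    have htS := (h.mem_edges hta (x := c) (by simp [conclusions])).1
    have hpS := (h.mem_edges hpa (x := c') (by simp [conclusions])).1
    rw [hFr] at hc
    simp only [Multiset.mem_cons, reduceCtorEq, false_or, cut.injEq] at hc
    rcases hc with he | hc
    · rcases Sym2.eq_iff.1 he with ⟨rfl, rfl⟩ | ⟨rfl, rfl⟩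
      · have e1 := eq_of_mem_conclusions h.nodup hzS htS (x := m) (by simp [conclusions])
            (by simp [conclusions])
        simp at e1
      · have e1 := eq_of_mem_conclusions h.nodup hzS hpS (x := m) (by simp [conclusions])
            (by simp [conclusions])
        simp at e1
    · exact (hB ((hBQ _ hc).2 _ rfl)).elim
  | @axiom_cut n' _ Fr' Q' A' q k q' k' hch' hFr hQ hB' hBQ =>
    have hta : ax A' q k ∈ Fr := by simp [hFr]
    have hpa : ax A' q' k' ∈ Fr := by simp [hFr]
    have htS := (h.mem_edges hta (x := k) (by simp [conclusions])).1
    have hpS := (h.mem_edges hpa (x := q') (by simp [conclusions])).1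
    rw [hFr] at hc
    simp only [Multiset.mem_cons, reduceCtorEq, false_or, cut.injEq] at hc
    rcases hc with he | hc
    · rcases Sym2.eq_iff.1 he with ⟨rfl, rfl⟩ | ⟨rfl, rfl⟩
      · have e1 : ax A p m = ax A' q m :=
          eq_of_mem_conclusions h.nodup hzS htS (x := m) (by simp [conclusions])
            (by simp [conclusions])
        have e2 : ax A p' m' = ax A' p' k' :=
          eq_of_mem_conclusions h.nodup hzS' hpS (x := p') (by simp [conclusions])
            (by simp [conclusions])
        obtain ⟨rfl, rfl, -⟩ : A = A' ∧ p = q ∧ m = m := by simpa using e1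
        obtain ⟨-, -, rfl⟩ : A = A ∧ p' = p' ∧ m' = k' := by simpa using e2
        have hQP : Q = Q' + P := by
          have := h.eq
          rw [hFr] at this
          simpa using this
        have hS' : ax A p m' ::ₘ Q = Fr' + (0 + P) := by
          rw [zero_add, ← hQ, hQP, Multiset.cons_add]
        have hsub : ∀ w ∈ Fr'.edges, w ∈ Fr.edges := by
          intro w hw
          rw [← hQ] at hw
          simp only [hFr, Net.edges_cons, conclusions, Multiset.mem_add,
            Multiset.insert_eq_cons, Multiset.mem_cons, Multiset.mem_singleton] at hw ⊢
          tauto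
        have hprem : ∀ w ∈ (Fr' + 0).premises, w ∈ Fr.premises := by
          intro w hw
          rw [add_zero, ← hQ] at hw
          simp only [hFr, Net.premises_cons, premises, Sym2.toMultiset_mk', Multiset.mem_add,
            Multiset.insert_eq_cons, Multiset.mem_cons, Multiset.mem_singleton] at hw ⊢
          tauto
        rw [hS'] at hstep ⊢
        exact ⟨n', Fr', 0 + P, lab, h.logical hch' (by simp) hstep hsub hprem,
          Prod.Lex.left _ _ (Nat.lt_succ_self _)⟩
      · -- the cut would join the two conclusions of a single axiom
        have e1 : ax A p m = ax A' m k' :=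
          eq_of_mem_conclusions h.nodup hzS hpS (x := m) (by simp [conclusions])
            (by simp [conclusions])
        obtain ⟨-, rfl, rfl⟩ : A = A' ∧ p = m ∧ m = k' := by simpa using e1
        have := h.nodup
        simp [conclusions] at this
    · exact (hB ((hBQ _ hc).2 _ rfl)).elim

/-- Every allowed step leads from a state to a state of smaller measure. -/
theorem State.step (hT : ∀ l ∈ T, l.IsMLL ∧ ∀ e, l = cut e → B e)
    (h : State B lab₀ T D n Fr P lab S) (hS : AllowedStep B S S') :
    ∃ n' Fr' P' lab', State B lab₀ T D n' Fr' P' lab' S' ∧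
      MeasureLT (n', cutRanks lab' P', ctrCount P') (n, cutRanks lab P, ctrCount P) := by
  obtain ⟨l, hstep, hl⟩ := hS
  have hstep' := hstep
  cases hstep with
  | axiom_cut A p m p' m' Q => exact h.step_axiom_cut hT (hl _ rfl) hstep'
  | tensor_par x y z x' y' z' Q => exact h.step_tensor_par hT (hl _ rfl) hstep'
  | commute j c O I f g Q hd hf =>
    have m1 : jax j O ∈ P := h.mem_tagged hT (by simp) id
    have m2 : jctr I c ∈ P := h.mem_tagged hT (by simp) id
    have m3 : cut s(j, c) ∈ P := by
      refine h.cut_mem_tagged hT (by simp) (hl _ rfl) (Sym2.mem_mk_left _ _) ?_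
      rw [(h.tagged _ m1).1]; decide
    have hn : ∀ l ∈ ({jax j O, jctr I c, cut s(j, c)} : Net α μ), l ∉ Fr := by
      intro l hl' hFr
      simp only [Multiset.insert_eq_cons, Multiset.mem_cons, Multiset.mem_singleton] at hl'
      rcases hl' with rfl | rfl | rfl
      · exact h.chain.isMLL hT _ hFr
      · exact h.chain.isMLL hT _ hFr
      · have := h.sign_edges j (h.chain.mem_edges_of_cut hT hFr (hl _ rfl) _ (Sym2.mem_mk_left _ _))
        rw [(h.tagged _ m1).1] at this
        exact absurd this (by decide)
    obtain ⟨P', rfl, rfl⟩ := exists_add_of_disjoint (Q := Q) (by rw [← h.eq]; simp) hn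
    simp only [Multiset.insert_eq_cons, Multiset.cons_add, Multiset.singleton_add] at h ⊢
    obtain ⟨N, hN⟩ : ∃ N : Net α μ, N = I.map (fun i => jax (f i) (O.map (g i))) +
      I.map (fun i => cut s(f i, i)) + O.map (fun o => jctr (I.map (fun i => g i o)) o) + P' :=
      ⟨_, rfl⟩
    have hS' : I.map (fun i => jax (f i) (O.map (g i))) +
      I.map (fun i => cut s(f i, i)) + O.map (fun o => jctr (I.map (fun i => g i o)) o) +
      (Fr + P') = Fr + N := by rw [hN]; abel
    rw [hS'] at hstep' ⊢
    obtain ⟨lab', h1, h2⟩ := h.commute hd hf hN hstep'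
    exact ⟨n, Fr, N, lab', h1, h2⟩
  | fuse_axioms j x j' O O' Q =>
    have m1 : jax j (x ::ₘ O) ∈ P := h.mem_tagged hT (by simp) id
    have m2 : jax j' O' ∈ P := h.mem_tagged hT (by simp) id
    have hn : ∀ l ∈ ({jax j (x ::ₘ O), jax j' O', cut s(x, j')} : Net α μ), l ∉ Fr := by
      intro l hl' hFr
      simp only [Multiset.insert_eq_cons, Multiset.mem_cons, Multiset.mem_singleton] at hl'
      rcases hl' with rfl | rfl | rfl
      · exact h.chain.isMLL hT _ hFr
      · exact h.chain.isMLL hT _ hFr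
      · have := h.sign_edges j'
          (h.chain.mem_edges_of_cut hT hFr (hl _ rfl) _ (Sym2.mem_mk_right _ _))
        rw [(h.tagged _ m2).1] at this
        exact absurd this (by decide)
    obtain ⟨P', rfl, rfl⟩ := exists_add_of_disjoint (Q := Q) (by rw [← h.eq]; simp) hn
    simp only [Multiset.insert_eq_cons, Multiset.cons_add, Multiset.singleton_add] at h ⊢
    have hS' : jax j (O + O') ::ₘ (Fr + P') = Fr + jax j (O + O') ::ₘ P' :=
      (Multiset.add_cons _ _ _).symm
    rw [hS'] at hstep' ⊢
    exact ⟨n, Fr, _, lab, h.fuse_axioms hstep'⟩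
  | fuse_contractions x c I I' Q =>
    have hn : ∀ l ∈ ({jctr I' x, jctr (x ::ₘ I) c} : Net α μ), l ∉ Fr := by
      intro l hl' hFr
      simp only [Multiset.insert_eq_cons, Multiset.mem_cons, Multiset.mem_singleton] at hl'
      rcases hl' with rfl | rfl
      · exact h.chain.isMLL hT _ hFr
      · exact h.chain.isMLL hT _ hFr
    obtain ⟨P', rfl, rfl⟩ := exists_add_of_disjoint (Q := Q) (by rw [← h.eq]; simp) hn
    simp only [Multiset.insert_eq_cons, Multiset.cons_add, Multiset.singleton_add] at h ⊢
    have hS' : jctr (I' + I) c ::ₘ (Fr + P') = Fr + jctr (I' + I) c ::ₘ P' :=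
      (Multiset.add_cons _ _ _).symm
    rw [hS'] at hstep' ⊢
    exact ⟨n, Fr, _, lab, h.fuse_contractions hstep'⟩

/-- The elimination terminates. -/
theorem State.exists_normal (hT : ∀ l ∈ T, l.IsMLL ∧ ∀ e, l = cut e → B e)
    (h : State B lab₀ T D n Fr P lab S) :
    ∃ N, Relation.ReflTransGen (AllowedStep B) S N ∧ ∀ S', ¬ AllowedStep B N S' := by
  obtain ⟨t, ht⟩ : ∃ t, t = (n, cutRanks lab P, ctrCount P) := ⟨_, rfl⟩
  induction t using wellFounded_measureLT.induction generalizing n Fr P lab S with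
  | _ t ih =>
    by_cases hN : ∃ S', AllowedStep B S S'
    · obtain ⟨S', hS'⟩ := hN
      obtain ⟨n', Fr', P', lab', h', hlt⟩ := h.step hT hS'
      obtain ⟨N, hN, hN'⟩ := ih _ (ht ▸ hlt) h' rfl
      exact ⟨N, hN.head hS', hN'⟩
    · exact ⟨S, .refl, fun S' hS' => hN ⟨S', hS'⟩⟩

theorem State.reachable (hT : ∀ l ∈ T, l.IsMLL ∧ ∀ e, l = cut e → B e)
    (h : State B lab₀ T D n Fr P lab S) (hS : Relation.ReflTransGen (AllowedStep B) S S') :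
    ∃ n' Fr' P' lab', State B lab₀ T D n' Fr' P' lab' S' := by
  induction hS with
  | refl => exact ⟨_, _, _, _, h⟩
  | tail _ hs ih =>
    obtain ⟨n', Fr', P', lab', h'⟩ := ih
    obtain ⟨n'', Fr'', P'', lab'', h'', -⟩ := h'.step hT hs
    exact ⟨_, _, _, _, h''⟩

/-- Fresh names for the copies made in a commutation. -/
theorem exists_fresh [Infinite μ] (I O : Multiset μ) (hI : I.Nodup) (hO : O.Nodup)
    (E : Multiset μ) : ∃ (f : μ → μ) (g : μ → μ → μ),
      (I.map f + (I ×ˢ O).map (fun q => g q.1 q.2)).Nodup ∧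
      ∀ x ∈ I.map f + (I ×ˢ O).map (fun q => g q.1 q.2), x ∉ E := by
  classical
  let M : Multiset (μ ⊕ μ × μ) := I.map Sum.inl + (I ×ˢ O).map Sum.inr
  have hM : M.Nodup := by
    rw [Multiset.nodup_add]
    refine ⟨hI.map Sum.inl_injective, (hI.product hO).map Sum.inr_injective, ?_⟩
    rw [Multiset.disjoint_left]
    simp
  have : Infinite {x // x ∉ E.toFinset} := E.toFinset.finite_toSet.infinite_compl.to_subtype
  let φ := Infinite.natEmbedding {x // x ∉ E.toFinset}
  let A := M.toFinset
  let h : μ ⊕ μ × μ → μ := fun a => if ha : a ∈ A then φ (A.equivFin ⟨a, ha⟩) else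
    (φ 0 : μ)
  have hval : ∀ a, h a ∉ E := by
    intro a
    have key : ∀ y : {x // x ∉ E.toFinset}, (y : μ) ∉ E := fun y hy =>
      y.2 (Multiset.mem_toFinset.2 hy)
    by_cases ha : a ∈ A
    · simpa only [h, dif_pos ha] using key _
    · simpa only [h, dif_neg ha] using key _
  have hinj : ∀ a ∈ M, ∀ b ∈ M, h a = h b → a = b := by
    intro a ha b hb hab
    have ha' : a ∈ A := Multiset.mem_toFinset.2 ha
    have hb' : b ∈ A := Multiset.mem_toFinset.2 hb
    simp only [h, dif_pos ha', dif_pos hb'] at hab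
    have h1 := φ.injective (Subtype.ext hab)
    have h2 := A.equivFin.injective (Fin.ext h1)
    exact congrArg Subtype.val h2
  refine ⟨fun i => h (Sum.inl i), fun i o => h (Sum.inr (i, o)), ?_⟩
  have hmap : I.map (fun i => h (Sum.inl i)) + (I ×ˢ O).map (fun q => h (Sum.inr (q.1, q.2))) =
      M.map h := by
    simp only [M, Multiset.map_add, Multiset.map_map, Function.comp_def]
  rw [hmap]
  refine ⟨(Multiset.nodup_map_iff_inj_on hM).2 hinj, fun x hx => ?_⟩
  obtain ⟨a, -, rfl⟩ := Multiset.mem_map.1 hx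
  exact hval a

/-! ### Normal forms -/

/-- There is no cut of type `J`, and no contraction is above another one. -/
structure IsFlat (P : Net α μ) : Prop where
  no_cut : ∀ e, cut e ∉ P
  no_ctr : ∀ I x J c, jctr I x ∈ P → jctr J c ∈ P → x ∉ J

theorem State.exists_jax (h : State B lab₀ T D n Fr P lab S) {j : μ} (hj : j ∈ S.edges)
    (hs : (lab j).sign = 1) : ∃ O, jax j O ∈ P := by
  rw [h.eq, Net.edges_add, Multiset.mem_add] at hj
  rcases hj with hj | hj
  · rw [h.sign_edges j hj] at hs
    exact absurd hs (by decide)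
  · obtain ⟨l, hl, hjl⟩ := Net.mem_edges.1 hj
    have ht := h.tagged l hl
    cases l with
    | jax j' O =>
      rcases Multiset.mem_cons.1 hjl with rfl | ho
      · exact ⟨O, hl⟩
      · rw [(ht.2.2 j ho).1] at hs
        exact absurd hs (by decide)
    | jctr I c =>
      obtain rfl := Multiset.mem_singleton.1 hjl
      rw [ht.1] at hs
      exact absurd hs (by decide)
    | cut e => exact absurd hjl (Multiset.notMem_zero _)
    | _ => exact ht.elim

theorem State.exists_jax_or_jctr (h : State B lab₀ T D n Fr P lab S) {c : μ} (hc : c ∈ S.edges)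
    (hs : (lab c).sign = -1) : (∃ j O, jax j O ∈ P ∧ c ∈ O) ∨ ∃ I, jctr I c ∈ P := by
  rw [h.eq, Net.edges_add, Multiset.mem_add] at hc
  rcases hc with hc | hc
  · rw [h.sign_edges c hc] at hs
    exact absurd hs (by decide)
  · obtain ⟨l, hl, hcl⟩ := Net.mem_edges.1 hc
    have ht := h.tagged l hl
    cases l with
    | jax j O =>
      rcases Multiset.mem_cons.1 hcl with rfl | ho
      · rw [ht.1] at hs
        exact absurd hs (by decide)
      · exact Or.inl ⟨j, O, hl, ho⟩
    | jctr I c' =>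
      obtain rfl := Multiset.mem_singleton.1 hcl
      exact Or.inr ⟨I, hl⟩
    | cut e => exact absurd hcl (Multiset.notMem_zero _)
    | _ => exact ht.elim

/-- When no step is possible, all logical steps have been made, and the part with tags is flat.
Ranks exclude the loops, which could not be reduced. -/
theorem State.flat_of_normal [Infinite μ]
    (hB : ∀ e, B e → e.IsDiag ∨ ∃ a ∈ e, a ∈ T.edges)
    (h : State B lab₀ T D n Fr P lab S) (hS : ∀ S', ¬ AllowedStep B S S') :
    State B lab₀ T D 0 T P lab S ∧ IsFlat P := by
  have hch := h.chain
  cases hch with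
  | @tensor_par n' _ Fr' C Q x y z x' y' z' h' hFr hQ hC hB' hBQ =>
    refine (hS (cut s(x, x') ::ₘ cut s(y, y') ::ₘ (Q + P))
      ⟨some s(z, z'), ?_, fun e he => ?_⟩).elim
    · rw [h.eq, hFr, Multiset.cons_add, Multiset.cons_add, Multiset.cons_add]
      exact .tensor_par _ _ _ _ _ _ _
    · rwa [← Option.some.inj he]
  | @axiom_cut n' _ Fr' Q A p m p' m' h' hFr hQ hB' hBQ =>
    refine (hS (ax A p m' ::ₘ (Q + P)) ⟨some s(m, p'), ?_, fun e he => ?_⟩).elim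
    · rw [h.eq, hFr, Multiset.cons_add, Multiset.cons_add, Multiset.cons_add]
      exact .axiom_cut _ _ _ _ _ _
    · rwa [← Option.some.inj he]
  | nil =>
    have hP : ∀ l ∈ P, l ∈ S := fun l hl => by rw [h.eq]; simp [hl]
    have hedge : ∀ x, (lab x).sign ≠ 0 → x ∉ T.edges := fun x hx hx' => hx (h.sign_edges x hx')
    refine ⟨h, ?_, ?_⟩
    · intro e he
      obtain ⟨j, c, rfl, hj, hc, -, hr⟩ := h.tagged _ he
      have hBe : ¬ B s(j, c) := by
        intro hBe
        rcases hB _ hBe with hd | ⟨a, ha, ha'⟩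
        · rw [Sym2.mk_isDiag_iff] at hd
          rw [hd, hc] at hj
          exact absurd hj (by decide)
        · exact hedge a ((h.tagged _ he).sign_ne_zero_of_mem_cut ha) ha'
      have hprem : ∀ x ∈ s(j, c), x ∈ S.edges := fun x hx =>
        h.mem_edges_of_premises (Net.mem_premises.2 ⟨_, hP _ he, Sym2.mem_toMultiset.2 hx⟩)
      obtain ⟨O, hO⟩ := h.exists_jax (hprem j (Sym2.mem_mk_left _ _)) hj
      obtain ⟨Q, hQ⟩ := Multiset.exists_cons_of_mem (hP _ hO)
      rcases h.exists_jax_or_jctr (hprem c (Sym2.mem_mk_right _ _)) hc with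
        ⟨j', O', hO', hcO⟩ | ⟨I, hI⟩
      · have hr' := ((h.tagged _ hO').2.2 c hcO).2
        have hne : jax j' O' ≠ (jax j O : Link α μ) := by
          intro heq
          have : j' = j := (jax.inj heq).1
          rw [this] at hr'
          omega
        have m1 : jax j' O' ∈ Q := by
          have := hP _ hO'
          rw [hQ, Multiset.mem_cons] at this
          exact this.resolve_left hne
        obtain ⟨Q', rfl⟩ := Multiset.exists_cons_of_mem m1
        have m2 : cut s(j, c) ∈ Q' := by
          have := hP _ he
          rw [hQ] at this
          simpa using this
        obtain ⟨Q'', rfl⟩ := Multiset.exists_cons_of_mem m2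
        obtain ⟨O'', rfl⟩ := Multiset.exists_cons_of_mem hcO
        refine hS (jax j' (O'' + O) ::ₘ Q'') ⟨some s(c, j), ?_, fun e' he' => ?_⟩
        · rw [hQ, Multiset.cons_swap, Sym2.eq_swap (a := j)]
          exact .fuse_axioms _ _ _ _ _ _
        · rw [← Option.some.inj he', Sym2.eq_swap]
          exact hBe
      · have m1 : jctr I c ∈ Q := by
          have := hP _ hI
          rw [hQ] at this
          simpa using this
        obtain ⟨Q', rfl⟩ := Multiset.exists_cons_of_mem m1
        have m2 : cut s(j, c) ∈ Q' := by
          have := hP _ he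
          rw [hQ] at this
          simpa using this
        obtain ⟨Q'', rfl⟩ := Multiset.exists_cons_of_mem m2
        have n1 : O.Nodup := by
          have := h.nodup
          rw [hQ, Net.edges_cons] at this
          exact (Multiset.nodup_cons.1 (Multiset.nodup_add.1 this).1).2
        have n2 : I.Nodup := by
          have := h.nodup_premises
          rw [hQ, Net.premises_cons, Net.premises_cons] at this
          exact (Multiset.nodup_add.1 (Multiset.nodup_add.1 this).2.1).1
        obtain ⟨f, g, hd, hf⟩ := exists_fresh I O n2 n1 S.edges
        rw [hQ] at hf
        have hstep := Step.commute j c O I f g Q'' hd hf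
        rw [← hQ] at hstep
        refine hS _ ⟨some s(j, c), hstep, fun e' he' => ?_⟩
        rw [← Option.some.inj he']
        exact hBe
    · intro I x J c hI hJ hx
      have hr := ((h.tagged _ hJ).2 x hx).2.2
      have hne : jctr J c ≠ (jctr I x : Link α μ) := by
        intro heq
        have : c = x := (jctr.inj heq).2
        rw [this] at hr
        omega
      obtain ⟨Q, hQ⟩ := Multiset.exists_cons_of_mem (hP _ hI)
      have m1 : jctr J c ∈ Q := by
        have := hP _ hJ
        rw [hQ, Multiset.mem_cons] at this
        exact this.resolve_left hne
      obtain ⟨Q', rfl⟩ := Multiset.exists_cons_of_mem m1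
      obtain ⟨J', rfl⟩ := Multiset.exists_cons_of_mem hx
      refine hS (jctr (I + J') c ::ₘ Q') ⟨none, ?_, by simp⟩
      rw [hQ]
      exact .fuse_contractions _ _ _ _ _

end elimination

/-! ### Normal forms are determined by the tags -/

section normal_forms

variable {α : Type u} {μ : Type v} {B : Sym2 μ → Prop} {lab₀ : μ → Tag μ} {T : Net α μ}
  {D : Multiset μ} {n : ℕ} {Fr P S S' : Net α μ} {lab : μ → Tag μ}

theorem Link.rename_eq_self {σ : μ → μ} {l : Link α μ} (hc : ∀ x ∈ l.conclusions, σ x = x)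
    (hp : ∀ x ∈ l.premises, σ x = x) : l.rename σ = l := by
  cases l with
  | ax A p n =>
    simp only [rename]
    rw [hc p (by simp [conclusions]), hc n (by simp [conclusions])]
  | tensor x y z =>
    simp only [rename]
    rw [hp x (by simp [premises]), hp y (by simp [premises]), hc z (by simp [conclusions])]
  | par x y z =>
    simp only [rename]
    rw [hp x (by simp [premises]), hp y (by simp [premises]), hc z (by simp [conclusions])]
  | cut e =>
    induction e using Sym2.ind with
    | _ x y =>
      simp only [rename, Sym2.map_mk]
      rw [hp x (by simp [premises]), hp y (by simp [premises])]
  | jax j O =>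
    simp only [rename]
    rw [hc j (by simp [conclusions]),
      Multiset.map_congr rfl fun o ho => hc o (by simp [conclusions, ho]), Multiset.map_id']
  | jctr I c =>
    simp only [rename]
    rw [hc c (by simp [conclusions]),
      Multiset.map_congr rfl fun i hi => hp i (by simp [premises, hi]), Multiset.map_id']

/-- The `J⊥`-conclusions of the axioms `J(n)` of a net. -/
def jaxOuts (P : Net α μ) : Multiset μ :=
  P.bind fun l => match l with
    | jax _ O => O
    | _ => 0

theorem mem_jaxOuts {P : Net α μ} {o : μ} : o ∈ jaxOuts P ↔ ∃ j O, jax j O ∈ P ∧ o ∈ O := by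
  rw [jaxOuts, Multiset.mem_bind]
  constructor
  · rintro ⟨l, hl, ho⟩
    cases l with
    | jax j O => exact ⟨j, O, hl, ho⟩
    | _ => exact absurd ho (Multiset.notMem_zero _)
  · rintro ⟨j, O, hl, ho⟩
    exact ⟨_, hl, ho⟩

theorem jaxOuts_le_edges (P : Net α μ) : jaxOuts P ≤ P.edges := by
  induction P using Multiset.induction_on with
  | empty => exact le_rfl
  | cons l P ih =>
    rw [Net.edges_cons, jaxOuts, Multiset.cons_bind]
    refine add_le_add ?_ ih
    cases l with
    | jax j O => exact Multiset.le_cons_self _ _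
    | _ => exact Multiset.zero_le _

theorem IsFlat.nodup (hf : IsFlat P) (hP : P.edges.Nodup) (hJ : ∀ l ∈ P, Tagged lab l) :
    P.Nodup := by
  rw [Multiset.nodup_iff_le]
  intro l hl
  obtain ⟨Q, rfl⟩ := Multiset.le_iff_exists_add.1 hl
  have hl' := hJ l (by simp)
  have key : l.conclusions = 0 := by
    refine Multiset.eq_zero_of_forall_notMem fun x hx => ?_
    simp only [Multiset.cons_add, Net.edges_cons, Multiset.nodup_add] at hP
    exact Multiset.disjoint_left.1 hP.2.2 hx (by simp [hx])
  cases l with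
  | cut e => exact hf.no_cut e (by simp)
  | jax j O => simp [conclusions] at key
  | jctr I c => simp [conclusions] at key
  | _ => exact hl'

theorem State.premise_cases (h : State B lab₀ T D n Fr P lab S) (hD : ∀ x ∈ D, x ∈ Fr.edges)
    {x : μ} (hx : x ∈ S.edges) (hs : (lab x).sign ≠ 0) :
    x ∈ Fr.premises ∨ ∃ l ∈ P, x ∈ l.premises := by
  rw [h.flow, Multiset.mem_add] at hx
  rcases hx with hx | hx
  · rw [h.eq, Net.premises_add, Multiset.mem_add, Net.mem_premises (S := P)] at hx
    exact hx
  · exact (hs (h.sign_edges x (hD x hx))).elim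

open Classical in
/-- A finished net is determined, apart from the names of the `J⊥`-edges, by the weights of its
interface: its `J`-links are one axiom for each edge `J` and one contraction for each edge `J⊥` of
the interface, and the number of edges between `j` and `c` is the multiplicity of `c` in the weight
of `j`. -/
theorem State.flat_form (h : State B lab₀ T D 0 T P lab S) (hf : IsFlat P)
    (hD : ∀ x ∈ D, x ∈ T.edges)
    (hw : ∀ c ∈ T.premises, (lab₀ c).sign = -1 → (lab₀ c).wt = {c}) :
    ∃ (E : Multiset μ) (src tgt : μ → μ),
      P = (T.premises.filter fun x => (lab₀ x).sign = 1).map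
          (fun j => jax j (E.filter fun o => src o = j)) +
        (T.premises.filter fun x => (lab₀ x).sign = -1).map
          (fun c => jctr (E.filter fun o => tgt o = c) c) ∧
      E.map (fun o => (src o, tgt o)) = (T.premises.filter fun x => (lab₀ x).sign = 1).bind
        (fun j => (lab₀ j).wt.map fun c => (j, c)) ∧
      E.Nodup ∧ (∀ x ∈ E, x ∉ T.edges ∧ x ∉ T.premises) ∧
      ∀ x ∈ S.edges, x ∈ E ∨ x ∈ T.edges ∨ x ∈ T.premises := by
  have hPS : ∀ l ∈ P, l ∈ S := fun l hl => by rw [h.eq]; simp [hl]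
  have hedges : ∀ l ∈ P, ∀ x ∈ l.conclusions, x ∈ S.edges := fun l hl x hx =>
    Net.mem_edges.2 ⟨l, hPS l hl, hx⟩
  have hpremises : ∀ l ∈ P, ∀ x ∈ l.premises, x ∈ S.edges := fun l hl x hx =>
    h.mem_edges_of_premises (Net.mem_premises.2 ⟨l, hPS l hl, hx⟩)
  have hPn : P.edges.Nodup := by
    have := h.nodup
    rw [h.eq, Net.edges_add] at this
    exact (Multiset.nodup_add.1 this).2.1
  have hTn : T.premises.Nodup := by
    have := h.nodup_premises
    rw [h.eq, Net.premises_add] at this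
    exact (Multiset.nodup_add.1 this).1
  -- an edge `J⊥` is not both a conclusion of an axiom and a premise of a logical link
  have hout : ∀ j O, jax j O ∈ P → ∀ o ∈ O, ∃ I c, jctr I c ∈ P ∧ o ∈ I := by
    intro j O hj o ho
    have hs := ((h.tagged _ hj).2.2 o ho).1
    rcases h.premise_cases hD (hedges _ hj o (by simp [conclusions, ho]))
      (by rw [hs]; decide) with hx | ⟨l, hl, hx⟩
    · have h1 : (lab₀ o).sign = -1 := by rw [← h.lab_premises o hx]; exact hs
      obtain ⟨I, hI⟩ := h.ctr o hx h1
      have := eq_of_mem_conclusions h.nodup (hPS _ hj) (hPS _ hI) (x := o)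
        (by simp [conclusions, ho]) (by simp [conclusions])
      simp at this
    · cases l with
      | jctr I c => exact ⟨I, c, hl, hx⟩
      | cut e => exact (hf.no_cut e hl).elim
      | jax j' O' => exact absurd hx (Multiset.notMem_zero _)
      | _ => exact (h.tagged _ hl).elim
  obtain ⟨src, hsrc⟩ : ∃ src : μ → μ, ∀ j O, jax j O ∈ P → ∀ o ∈ O, src o = j := by
    refine ⟨fun o => if ho : ∃ j O, jax j O ∈ P ∧ o ∈ O then ho.choose else o, ?_⟩
    intro j O hj o ho
    have ho' : ∃ j O, jax j O ∈ P ∧ o ∈ O := ⟨j, O, hj, ho⟩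
    simp only [dif_pos ho']
    obtain ⟨O', hO', hoO'⟩ := ho'.choose_spec
    have := eq_of_mem_conclusions hPn hO' hj (x := o) (by simp [conclusions, hoO'])
      (by simp [conclusions, ho])
    exact (jax.inj this).1
  obtain ⟨tgt, htgt⟩ : ∃ tgt : μ → μ, ∀ I c, jctr I c ∈ P → ∀ i ∈ I, tgt i = c := by
    refine ⟨fun i => if hi : ∃ c I, jctr I c ∈ P ∧ i ∈ I then hi.choose else i, ?_⟩
    intro I c hc i hi
    have hi' : ∃ c I, jctr I c ∈ P ∧ i ∈ I := ⟨c, I, hc, hi⟩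
    simp only [dif_pos hi']
    obtain ⟨I', hI', hiI'⟩ := hi'.choose_spec
    have := eq_of_mem_premises h.nodup_premises (hPS _ hI') (hPS _ hc) (x := i) hiI' hi
    exact (jctr.inj this).2
  have hEn : (jaxOuts P).Nodup := Multiset.nodup_of_le (jaxOuts_le_edges P) hPn
  have hO : ∀ j O, jax j O ∈ P → (jaxOuts P).filter (fun o => src o = j) = O := by
    intro j O hj
    have hOn : O.Nodup := by
      obtain ⟨Q, rfl⟩ := Multiset.exists_cons_of_mem hj
      rw [Net.edges_cons] at hPn
      exact (Multiset.nodup_cons.1 (Multiset.nodup_add.1 hPn).1).2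
    refine (Multiset.Nodup.ext (hEn.filter _) hOn).2 fun o => ?_
    rw [Multiset.mem_filter, mem_jaxOuts]
    constructor
    · rintro ⟨⟨j', O', hj', ho⟩, hs⟩
      have hjj : j' = j := (hsrc j' O' hj' o ho).symm.trans hs
      have := eq_of_mem_conclusions hPn hj' hj (x := j) (by simp [conclusions, hjj])
        (by simp [conclusions])
      rwa [← (jax.inj this).2]
    · exact fun ho => ⟨⟨j, O, hj, ho⟩, hsrc j O hj o ho⟩
  have hI : ∀ I c, jctr I c ∈ P → (jaxOuts P).filter (fun o => tgt o = c) = I := by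
    intro I c hc
    have hIn : I.Nodup := by
      have := h.nodup_premises
      obtain ⟨Q, hQ⟩ := Multiset.exists_cons_of_mem (hPS _ hc)
      rw [hQ, Net.premises_cons] at this
      exact (Multiset.nodup_add.1 this).1
    refine (Multiset.Nodup.ext (hEn.filter _) hIn).2 fun o => ?_
    rw [Multiset.mem_filter, mem_jaxOuts]
    constructor
    · rintro ⟨⟨j, O, hj, ho⟩, hs⟩
      obtain ⟨I', c', hI', hoI'⟩ := hout j O hj o ho
      have hcc : c' = c := (htgt I' c' hI' o hoI').symm.trans hs
      have := eq_of_mem_conclusions hPn hI' hc (x := c) (by simp [conclusions, hcc])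
        (by simp [conclusions])
      rwa [← (jctr.inj this).1]
    · intro ho
      refine ⟨?_, htgt I c hc o ho⟩
      rcases h.exists_jax_or_jctr (hpremises _ hc o ho) ((h.tagged _ hc).2 o ho).1 with
        ⟨j, O, hj, hoO⟩ | ⟨K, hK⟩
      · exact ⟨j, O, hj, hoO⟩
      · exact (hf.no_ctr K o I c hK hc ho).elim
  have hJ : ∀ j, j ∈ (T.premises.filter fun x => (lab₀ x).sign = 1) ↔ ∃ O, jax j O ∈ P := by
    intro j
    rw [Multiset.mem_filter]
    constructor
    · rintro ⟨hj, hs⟩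
      rw [← h.lab_premises j hj] at hs
      exact h.exists_jax (h.mem_edges_of_premises (by rw [h.eq]; simp [hj])) hs
    · rintro ⟨O, hO⟩
      have hs := (h.tagged _ hO).1
      rcases h.premise_cases hD (hedges _ hO j (by simp [conclusions]))
        (by rw [hs]; decide) with hx | ⟨l, hl, hx⟩
      · exact ⟨hx, by rw [← h.lab_premises j hx]; exact hs⟩
      · cases l with
        | jctr I c =>
          have := ((h.tagged _ hl).2 j hx).1
          rw [hs] at this
          exact absurd this (by decide)
        | cut e => exact (hf.no_cut e hl).elim
        | jax j' O' => exact absurd hx (Multiset.notMem_zero _)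
        | _ => exact (h.tagged _ hl).elim
  have hC : ∀ c, c ∈ (T.premises.filter fun x => (lab₀ x).sign = -1) ↔ ∃ I, jctr I c ∈ P := by
    intro c
    rw [Multiset.mem_filter]
    constructor
    · rintro ⟨hc, hs⟩
      exact h.ctr c hc hs
    · rintro ⟨I, hI⟩
      have hs := (h.tagged _ hI).1
      rcases h.premise_cases hD (hedges _ hI c (by simp [conclusions]))
        (by rw [hs]; decide) with hx | ⟨l, hl, hx⟩
      · exact ⟨hx, by rw [← h.lab_premises c hx]; exact hs⟩
      · cases l with
        | jctr I' c' => exact (hf.no_ctr I c I' c' hI hl hx).elim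
        | cut e => exact (hf.no_cut e hl).elim
        | jax j' O' => exact absurd hx (Multiset.notMem_zero _)
        | _ => exact (h.tagged _ hl).elim
  have hP : P = (T.premises.filter fun x => (lab₀ x).sign = 1).map
      (fun j => jax j ((jaxOuts P).filter fun o => src o = j)) +
      (T.premises.filter fun x => (lab₀ x).sign = -1).map
      (fun c => jctr ((jaxOuts P).filter fun o => tgt o = c) c) := by
    refine (Multiset.Nodup.ext (hf.nodup hPn h.tagged) ?_).2 fun l => ?_
    · rw [Multiset.nodup_add]
      refine ⟨(hTn.filter _).map fun a b hab => (jax.inj hab).1,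
        (hTn.filter _).map fun a b hab => (jctr.inj hab).2, ?_⟩
      rw [Multiset.disjoint_left]
      intro l hl hl'
      obtain ⟨j, -, rfl⟩ := Multiset.mem_map.1 hl
      obtain ⟨c, -, hc⟩ := Multiset.mem_map.1 hl'
      simp at hc
    · rw [Multiset.mem_add, Multiset.mem_map, Multiset.mem_map]
      constructor
      · intro hl
        cases l with
        | jax j O => exact Or.inl ⟨j, (hJ j).2 ⟨O, hl⟩, by rw [hO j O hl]⟩
        | jctr I c => exact Or.inr ⟨c, (hC c).2 ⟨I, hl⟩, by rw [hI I c hl]⟩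
        | cut e => exact (hf.no_cut e hl).elim
        | _ => exact (h.tagged _ hl).elim
      · rintro (⟨j, hj, rfl⟩ | ⟨c, hc, rfl⟩)
        · obtain ⟨O, hj⟩ := (hJ j).1 hj
          rwa [hO j O hj]
        · obtain ⟨I, hc⟩ := (hC c).1 hc
          rwa [hI I c hc]
  refine ⟨jaxOuts P, src, tgt, hP, ?_, hEn, ?_, ?_⟩
  · have hE : jaxOuts P = (T.premises.filter fun x => (lab₀ x).sign = 1).bind
        fun j => (jaxOuts P).filter fun o => src o = j := by
      conv_lhs => rw [hP]
      simp only [jaxOuts, Multiset.add_bind, Multiset.bind_map, Multiset.bind_zero, add_zero]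
    conv_lhs => rw [hE]
    rw [Multiset.map_bind]
    refine Multiset.bind_congr fun j hj => ?_
    obtain ⟨O, hjO⟩ := (hJ j).1 hj
    have h1 := h.lab_premises j (Multiset.mem_filter.1 hj).1
    have h2 : (lab₀ j).wt = O.map tgt := by
      rw [← h1, (h.tagged _ hjO).2.1, ← Multiset.bind_singleton]
      refine Multiset.bind_congr fun o ho => ?_
      obtain ⟨I, c, hIc, hoI⟩ := hout j O hjO o ho
      have hc := Multiset.mem_filter.1 ((hC c).2 ⟨I, hIc⟩)
      rw [((h.tagged _ hIc).2 o hoI).2.1, h.lab_premises c hc.1, hw c hc.1 hc.2,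
        htgt I c hIc o hoI]
    rw [hO j O hjO, h2, Multiset.map_map]
    exact Multiset.map_congr rfl fun o ho => by simp [hsrc j O hjO o ho]
  · intro o ho
    obtain ⟨j, O, hj, ho⟩ := mem_jaxOuts.1 ho
    constructor
    · intro ho'
      have := h.sign_edges o ho'
      rw [((h.tagged _ hj).2.2 o ho).1] at this
      exact absurd this (by decide)
    · obtain ⟨I, c, hIc, hoI⟩ := hout j O hj o ho
      exact h.not_mem_premises hIc hoI
  · intro x hx
    rw [h.eq, Net.edges_add, Multiset.mem_add] at hx
    rcases hx with hx | hx
    · exact Or.inr (Or.inl hx)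
    · obtain ⟨l, hl, hxl⟩ := Net.mem_edges.1 hx
      cases l with
      | jax j O =>
        rcases Multiset.mem_cons.1 hxl with rfl | ho
        · exact Or.inr (Or.inr (Multiset.mem_filter.1 ((hJ x).2 ⟨O, hl⟩)).1)
        · exact Or.inl (mem_jaxOuts.2 ⟨j, O, hl, ho⟩)
      | jctr I c =>
        obtain rfl := Multiset.mem_singleton.1 hxl
        exact Or.inr (Or.inr (Multiset.mem_filter.1 ((hC x).2 ⟨I, hl⟩)).1)
      | cut e => exact (hf.no_cut e hl).elim
      | _ => exact (h.tagged _ hl).elim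

/-- Multisets with the same image are related by a map compatible with the images. -/
theorem exists_map_eq_of_map_eq {β γ : Type*} {A A' : Multiset β} {φ φ' : β → γ} (hA : A.Nodup)
    (h : A.map φ = A'.map φ') : ∃ σ : β → β, A.map σ = A' ∧ ∀ a ∈ A, φ' (σ a) = φ a := by
  classical
  induction A using Multiset.induction_on generalizing A' with
  | empty =>
    refine ⟨id, ?_, by simp⟩
    rw [Multiset.map_zero, eq_comm, Multiset.map_eq_zero] at h
    simp [h]
  | cons a A ih =>
    have ha : φ a ∈ A'.map φ' := by rw [← h]; simp
    obtain ⟨b, hb, hab⟩ := Multiset.mem_map.1 ha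
    obtain ⟨A'', rfl⟩ := Multiset.exists_cons_of_mem hb
    rw [Multiset.map_cons, Multiset.map_cons, hab, Multiset.cons_inj_right] at h
    obtain ⟨haA, hA⟩ := Multiset.nodup_cons.1 hA
    obtain ⟨σ, h1, h2⟩ := ih hA h
    have hne : ∀ x ∈ A, x ≠ a := fun x hx hxa => haA (hxa ▸ hx)
    refine ⟨Function.update σ a b, ?_, ?_⟩
    · rw [Multiset.map_cons, Function.update_self, ← h1]
      congr 1
      exact Multiset.map_congr rfl fun x hx => Function.update_of_ne (hne x hx) _ _
    · intro x hx
      rcases Multiset.mem_cons.1 hx with rfl | hx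
      · rw [Function.update_self, hab]
      · rw [Function.update_of_ne (hne x hx), h2 x hx]

/-- Two finished nets with the same logical part and the same initial tags are equal up to the names
of their edges. -/
theorem State.sameUpTo {P' : Net α μ} {lab' : μ → Tag μ} (h : State B lab₀ T D 0 T P lab S)
    (hf : IsFlat P) (h' : State B lab₀ T D 0 T P' lab' S') (hf' : IsFlat P')
    (hD : ∀ x ∈ D, x ∈ T.edges)
    (hw : ∀ c ∈ T.premises, (lab₀ c).sign = -1 → (lab₀ c).wt = {c}) :
    Net.SameUpTo {x | x ∈ T.edges} S S' := by
  classical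
  obtain ⟨E, src, tgt, hP, hK, hE, hdis, hcov⟩ := h.flat_form hf hD hw
  obtain ⟨E', src', tgt', hP', hK', hE', hdis', -⟩ := h'.flat_form hf' hD hw
  obtain ⟨σ, hσ, hσ'⟩ := exists_map_eq_of_map_eq hE (hK.trans hK'.symm)
  have hσE : ∀ x ∈ E, σ x ∈ E' := fun x hx => hσ ▸ Multiset.mem_map_of_mem σ hx
  let τ : μ → μ := fun x => if x ∈ E then σ x else x
  have hτE : ∀ x ∈ E, τ x = σ x := fun x hx => if_pos hx
  have hτ : ∀ x, x ∉ E → τ x = x := fun x hx => if_neg hx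
  have hτ1 : ∀ x ∈ T.edges, τ x = x := fun x hx => hτ x fun hx' => (hdis x hx').1 hx
  have hτ2 : ∀ x ∈ T.premises, τ x = x := fun x hx => hτ x fun hx' => (hdis x hx').2 hx
  have hmap : ∀ (u u' : μ → μ) (j : μ), (∀ x ∈ E, u' (σ x) = u x) →
      (E.filter fun o => u o = j).map τ = E'.filter fun o => u' o = j := by
    intro u u' j hu
    rw [← hσ, Multiset.filter_map, Multiset.map_congr rfl fun x hx =>
      hτE x (Multiset.mem_of_mem_filter hx)]
    congr 1
    exact Multiset.filter_congr fun x hx => by simp [hu x hx]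
  refine ⟨τ, ?_, hτ1, ?_⟩
  · have hmix : ∀ x ∈ E, ∀ y ∈ S.edges, y ∉ E → τ x ≠ τ y := by
      intro x hx y hy hyE hxy
      rw [hτE x hx, hτ y hyE] at hxy
      have := hdis' _ (hσE x hx)
      rw [hxy] at this
      rcases hcov y hy with hy | hy | hy
      · exact hyE hy
      · exact this.1 hy
      · exact this.2 hy
    intro x hx y hy hxy
    by_cases hxE : x ∈ E
    · by_cases hyE : y ∈ E
      · rw [hτE x hxE, hτE y hyE] at hxy
        exact Multiset.inj_on_of_nodup_map (hσ ▸ hE') x hxE y hyE hxy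
      · exact (hmix x hxE y hy hyE hxy).elim
    · by_cases hyE : y ∈ E
      · exact (hmix y hyE x hx hxE hxy.symm).elim
      · rwa [hτ x hxE, hτ y hyE] at hxy
  · rw [h.eq, h'.eq, Multiset.map_add]
    congr 1
    · conv_rhs => rw [← Multiset.map_id' T]
      refine Multiset.map_congr rfl fun l hl => Link.rename_eq_self (fun x hx => hτ1 x ?_)
        fun x hx => hτ2 x ?_
      · exact Net.mem_edges.2 ⟨l, hl, hx⟩
      · exact Net.mem_premises.2 ⟨l, hl, hx⟩
    · rw [hP, hP', Multiset.map_add, Multiset.map_map, Multiset.map_map]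
      congr 1
      · refine Multiset.map_congr rfl fun j hj => ?_
        simp only [Function.comp_apply, Link.rename]
        rw [hτ2 j (Multiset.mem_of_mem_filter hj), hmap src src' j fun x hx =>
          (Prod.ext_iff.1 (hσ' x hx)).1]
      · refine Multiset.map_congr rfl fun c hc => ?_
        simp only [Function.comp_apply, Link.rename]
        rw [hτ2 c (Multiset.mem_of_mem_filter hc), hmap tgt tgt' c fun x hx =>
          (Prod.ext_iff.1 (hσ' x hx)).2]

end normal_forms

/-! ### The two parts of the encoding -/

section encoding

open JName Port

variable {α : Type u} {ν : Type v}

/-- The logical links of the lower part of the gadget of a positive edge. -/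
def posFrame (e : ν) (b : JName ν) : Net α (JName ν) :=
  {tensor b (port e outJ) (port e out), par (port e out) (port e inCtr) (port e sync),
   tensor (port e sync) (port e redJ) (port e root)}

/-- The logical links of the lower part of the gadget of a negative edge. -/
def negFrame (e : ν) (b : JName ν) : Net α (JName ν) :=
  {par (port e greenCtr) b (port e green), tensor (port e redJ) (port e green) (port e red),
   par (port e inCtr) (port e red) (port e root)}

/-- The `MLL`-links among the links that replace a link of `R`. They do not depend on the jumps. -/
def frameLink : Link α ν → Net α (JName ν)
  | ax A p n => {ax A (port p raw) (port n raw)} + posFrame p (port p raw) + negFrame n (port n raw)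
  | tensor x y e =>
      {tensor (port x root) (port y root) (port e raw),
       tensor (port e raw) (port e greenJ) (port e green),
       par (port e green) (port e blueCtr) (port e blue)} + posFrame e (port e blue)
  | par x y e =>
      {par (port x root) (port y root) (port e raw),
       par (port e blueCtr) (port e raw) (port e blue),
       tensor (port e outJ) (port e blue) (port e out)} + negFrame e (port e out)
  | cut c => {cut (c.map (fun e => port e root))}
  | jax _ _ => 0
  | jctr _ _ => 0

variable [DecidableEq ν]

/-- The axioms `J(n)` and contractions of the lower part of the gadget of a positive edge. -/
def posPart (L : Multiset (ν × ν)) (e : ν) : Net α (JName ν) :=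
  {jctr (syncEdges L e) (port e inCtr), jax (port e redJ) 0}

/-- The axioms `J(n)` and contractions of the lower part of the gadget of a negative edge. -/
def negPart (L : Multiset (ν × ν)) (e : ν) : Net α (JName ν) :=
  {jctr {port e greenEdge} (port e greenCtr), jax (port e redJ) 0,
   jctr (syncEdges L e) (port e inCtr)}

/-- The axioms `J(n)` and the contractions among the links that replace a link of `R`. -/
def partLink (R : Net α ν) (L : Multiset (ν × ν)) : Link α ν → Net α (JName ν)
  | ax _ p n =>
      {jax (port p outJ)
        ({port p inEdge, port n inEdge, port n greenEdge} + outEdges R L p + outEdges R L n)} +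
      posPart L p + negPart L n
  | tensor x y e =>
      {jax (port e greenJ) {port e greenEdge},
       jctr (port e greenEdge ::ₘ blueEdges L x y) (port e blueCtr),
       jax (port e outJ) (port e inEdge ::ₘ outEdges R L e)} + posPart L e
  | par x y e =>
      {jctr (blueEdges L x y) (port e blueCtr),
       jax (port e outJ) (port e greenEdge ::ₘ port e inEdge ::ₘ outEdges R L e)} + negPart L e
  | _ => 0

theorem encodeLink_eq (R : Net α ν) (L : Multiset (ν × ν)) (l : Link α ν) :
    encodeLink R L l = frameLink l + partLink R L l := by
  cases l with
  | ax A p n =>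
    simp only [encodeLink, frameLink, partLink, posShell, negShell, posFrame, negFrame, posPart,
      negPart, Multiset.insert_eq_cons, ← Multiset.singleton_add (_ : Link α (JName ν))]
    abel
  | tensor x y e =>
    simp only [encodeLink, frameLink, partLink, posShell, posFrame, posPart,
      Multiset.insert_eq_cons, ← Multiset.singleton_add (_ : Link α (JName ν))]
    abel
  | par x y e =>
    simp only [encodeLink, frameLink, partLink, negShell, negFrame,
      negPart, Multiset.insert_eq_cons, ← Multiset.singleton_add (_ : Link α (JName ν))]
    abel
  | cut e => rfl
  | jax j O => rfl
  | jctr I c => rfl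

theorem encode_eq (R : Net α ν) (L : Multiset (ν × ν)) :
    encode R L = R.bind frameLink + R.bind (partLink R L) := by
  rw [encode, ← Multiset.bind_add]
  exact Multiset.bind_congr fun l _ => encodeLink_eq R L l

/-! ### Edges of the encoding -/

/-- The edge of `R` in whose gadget an edge of the encoding starts. -/
def owner : JName ν → ν
  | port e _ => e
  | jumpSync q => q.1.1
  | jumpBlue q => q.1.1

theorem owner_outEdges {R : Net α ν} {L : Multiset (ν × ν)} {s : ν} {x : JName ν}
    (hx : x ∈ outEdges R L s) : owner x = s := by
  simp only [outEdges, Multiset.mem_add, Multiset.mem_map, Multiset.mem_filter] at hx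
  rcases hx with (hx | ⟨q, ⟨-, hq⟩, rfl⟩) | ⟨q, ⟨-, hq, -⟩, rfl⟩
  · split_ifs at hx
    · rw [Multiset.mem_singleton.1 hx]; rfl
    · exact absurd hx (Multiset.notMem_zero _)
  · exact hq
  · exact hq

theorem not_port_of_mem_outEdges {R : Net α ν} {L : Multiset (ν × ν)} {s e : ν} {p : Port}
    (hp : p ≠ toBlue) : port e p ∉ outEdges R L s := by
  intro hx
  simp only [outEdges, Multiset.mem_add, Multiset.mem_map, reduceCtorEq, and_false,
    exists_false, or_false] at hx
  split_ifs at hx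
  · simp [hp] at hx
  · exact absurd hx (Multiset.notMem_zero _)

theorem nodup_outEdges (R : Net α ν) (L : Multiset (ν × ν)) (s : ν) :
    (outEdges R L s).Nodup := by
  have h1 : (Multiset.map jumpSync (L.toEnumFinset.val.filter (fun q => q.1.1 = s))).Nodup :=
    (L.toEnumFinset.nodup.filter _).map fun a b h => jumpSync.inj h
  have h2 : (Multiset.map jumpBlue (L.toEnumFinset.val.filter
      (fun q => q.1.1 = s ∧ q.1.2 ∈ R.logicalPremises))).Nodup :=
    (L.toEnumFinset.nodup.filter _).map fun a b h => jumpBlue.inj h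
  have h3 : (if s ∈ R.logicalPremises then {port s toBlue} else
      (0 : Multiset (JName ν))).Nodup := by
    split_ifs <;> simp
  rw [outEdges, Multiset.nodup_add, Multiset.nodup_add]
  refine ⟨⟨h3, h1, ?_⟩, h2, ?_⟩
  · rw [Multiset.disjoint_left]
    intro x hx hx'
    obtain ⟨q, -, rfl⟩ := Multiset.mem_map.1 hx'
    split_ifs at hx <;> simp at hx
  · rw [Multiset.disjoint_left]
    intro x hx hx'
    obtain ⟨q, -, rfl⟩ := Multiset.mem_map.1 hx'
    rcases Multiset.mem_add.1 hx with hx | hx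
    · split_ifs at hx <;> simp at hx
    · simp at hx

theorem edges_encodeLink_ax (R : Net α ν) (L : Multiset (ν × ν)) (A : α) (p n : ν) :
    (encodeLink R L (ax A p n)).edges =
      ({raw, outJ, inEdge, out, inCtr, sync, redJ, root} : Multiset Port).map (port p) +
      ({raw, inEdge, greenEdge, greenCtr, green, redJ, red, inCtr, root} : Multiset Port).map
        (port n) + (outEdges R L p + outEdges R L n) := by
  simp only [encodeLink, posShell, negShell, Net.edges_add, Net.edges_cons, Net.edges_singleton,
    Multiset.insert_eq_cons, conclusions, Multiset.map_cons, Multiset.map_singleton,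
    Multiset.cons_zero]
  simp only [← Multiset.singleton_add]
  abel

theorem edges_encodeLink_tensor (R : Net α ν) (L : Multiset (ν × ν)) (x y e : ν) :
    (encodeLink R L (tensor x y e)).edges =
      ({raw, greenJ, greenEdge, green, blueCtr, blue, outJ, inEdge, out, inCtr, sync, redJ, root} :
        Multiset Port).map (port e) + outEdges R L e := by
  simp only [encodeLink, posShell, Net.edges_add, Net.edges_cons, Net.edges_singleton,
    Multiset.insert_eq_cons, conclusions, Multiset.map_cons, Multiset.map_singleton,
    Multiset.cons_zero]
  simp only [← Multiset.singleton_add]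
  abel

theorem edges_encodeLink_par (R : Net α ν) (L : Multiset (ν × ν)) (x y e : ν) :
    (encodeLink R L (par x y e)).edges =
      ({raw, blueCtr, blue, outJ, greenEdge, inEdge, out, greenCtr, green, redJ, red, inCtr, root} :
        Multiset Port).map (port e) + outEdges R L e := by
  simp only [encodeLink, negShell, Net.edges_add, Net.edges_cons, Net.edges_singleton,
    Multiset.insert_eq_cons, conclusions, Multiset.map_cons, Multiset.map_singleton,
    Multiset.cons_zero]
  simp only [← Multiset.singleton_add]
  abel

theorem nodup_ports_add {R : Net α ν} {L : Multiset (ν × ν)} {e : ν} {M : Multiset Port}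
    (hM : M.Nodup) (hb : toBlue ∉ M) : (M.map (port e) + outEdges R L e).Nodup := by
  rw [Multiset.nodup_add]
  refine ⟨hM.map fun a b h => (port.inj h).2, nodup_outEdges R L e, ?_⟩
  rw [Multiset.disjoint_left]
  intro x hx
  obtain ⟨q, hq, rfl⟩ := Multiset.mem_map.1 hx
  exact not_port_of_mem_outEdges fun h => hb (h ▸ hq)

theorem owner_ports_add {R : Net α ν} {L : Multiset (ν × ν)} {e : ν} {M : Multiset Port}
    {x : JName ν} (hx : x ∈ M.map (port e) + outEdges R L e) : owner x = e := by
  rcases Multiset.mem_add.1 hx with hx | hx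
  · obtain ⟨q, hq, rfl⟩ := Multiset.mem_map.1 hx
    rfl
  · exact owner_outEdges hx

theorem nodup_edges_encodeLink (R : Net α ν) (L : Multiset (ν × ν)) (l : Link α ν)
    (hl : l.conclusions.Nodup) : (encodeLink R L l).edges.Nodup := by
  cases l with
  | ax A p n =>
    have hpn : p ≠ n := by simpa [conclusions] using hl
    rw [edges_encodeLink_ax, add_add_add_comm, Multiset.nodup_add]
    refine ⟨nodup_ports_add (by simp) (by simp), nodup_ports_add (by simp) (by simp), ?_⟩
    rw [Multiset.disjoint_left]
    intro x hx hx'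
    exact hpn ((owner_ports_add hx).symm.trans (owner_ports_add hx'))
  | tensor x y e =>
    rw [edges_encodeLink_tensor]
    exact nodup_ports_add (by simp) (by simp)
  | par x y e =>
    rw [edges_encodeLink_par]
    exact nodup_ports_add (by simp) (by simp)
  | cut e => simp [encodeLink, conclusions]
  | jax j O => simp [encodeLink]
  | jctr I c => simp [encodeLink]

theorem owner_mem_conclusions {R : Net α ν} {L : Multiset (ν × ν)} {l : Link α ν} {x : JName ν}
    (hl : l.IsMLL) (hx : x ∈ (encodeLink R L l).edges) : owner x ∈ l.conclusions := by
  cases l with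
  | ax A p n =>
    rw [edges_encodeLink_ax, add_add_add_comm, Multiset.mem_add] at hx
    rcases hx with hx | hx
    · simp [conclusions, owner_ports_add hx]
    · simp [conclusions, owner_ports_add hx]
  | tensor y z e =>
    rw [edges_encodeLink_tensor] at hx
    simp [conclusions, owner_ports_add hx]
  | par y z e =>
    rw [edges_encodeLink_par] at hx
    simp [conclusions, owner_ports_add hx]
  | cut e => simp [encodeLink, conclusions] at hx
  | jax j O => exact hl.elim
  | jctr I c => exact hl.elim

theorem nodup_edges_encode {R : Net α ν} (L : Multiset (ν × ν)) (hR : R.edges.Nodup)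
    (hM : ∀ l ∈ R, l.IsMLL) : (encode R L).edges.Nodup := by
  have key : ∀ Q : Net α ν, Q.edges.Nodup → (∀ l ∈ Q, l.IsMLL) →
      (Q.bind fun l => (encodeLink R L l).edges).Nodup := by
    intro Q
    induction Q using Multiset.induction_on with
    | empty => intros; simp
    | cons l Q ih =>
      intro hQ hQM
      rw [Net.edges_cons, Multiset.nodup_add] at hQ
      rw [Multiset.cons_bind, Multiset.nodup_add]
      refine ⟨nodup_edges_encodeLink R L l hQ.1, ih hQ.2.1 fun k hk => hQM k (by simp [hk]), ?_⟩
      rw [Multiset.disjoint_left]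
      intro x hx hx'
      obtain ⟨k, hk, hxk⟩ := Multiset.mem_bind.1 hx'
      refine Multiset.disjoint_left.1 hQ.2.2 (owner_mem_conclusions (hQM l (by simp)) hx) ?_
      exact Net.mem_edges.2 ⟨k, hk, owner_mem_conclusions (hQM k (by simp [hk])) hxk⟩
  rw [encode, Net.edges_bind]
  exact key R hR hM

/-- The edges of the jumps to `t` that arrive at its in-synchronisation point. -/
def syncIn (L : Multiset (ν × ν)) (t : ν) : Multiset (JName ν) :=
  (L.toEnumFinset.val.filter (fun q => q.1.2 = t)).map jumpSync

theorem syncEdges_eq (L : Multiset (ν × ν)) (t : ν) :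
    syncEdges L t = {port t inEdge} + syncIn L t := rfl

/-- The edges that arrive at the blue point of the link below `x`, on account of `x`. -/
def blueIn (L : Multiset (ν × ν)) (x : ν) : Multiset (JName ν) :=
  port x toBlue ::ₘ (L.toEnumFinset.val.filter (fun q => q.1.2 = x)).map jumpBlue

theorem blueEdges_eq (L : Multiset (ν × ν)) {x y : ν} (hxy : x ≠ y) :
    blueEdges L x y = blueIn L x + blueIn L y := by
  have h : L.toEnumFinset.val.filter (fun q => q.1.2 = x ∨ q.1.2 = y) =
      L.toEnumFinset.val.filter (fun q => q.1.2 = x) +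
        L.toEnumFinset.val.filter (fun q => q.1.2 = y) := by
    rw [Multiset.filter_add_filter]
    have : L.toEnumFinset.val.filter (fun q => q.1.2 = x ∧ q.1.2 = y) = 0 := by
      rw [Multiset.filter_eq_nil]
      rintro q - ⟨h1, h2⟩
      exact hxy (h1.symm.trans h2)
    rw [this, add_zero]
  simp only [blueEdges, blueIn, h, Multiset.map_add, ← Multiset.singleton_add]
  abel

/-- Balance of edges and premises in the gadgets that replace one link. -/
theorem balance_encodeLink (R : Net α ν) (L : Multiset (ν × ν)) (l : Link α ν) (hM : l.IsMLL)
    (hl : l.premises.Nodup) :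
    (encodeLink R L l).edges + l.premises.map (fun e => port e root) +
        l.conclusions.bind (syncIn L) + l.logicalPremises.bind (blueIn L) =
      (encodeLink R L l).premises + l.conclusions.map (fun e => port e root) +
        l.conclusions.bind (outEdges R L) := by
  cases l with
  | ax A p n =>
    rw [edges_encodeLink_ax]
    simp only [encodeLink, posShell, negShell, Net.premises_add, Net.premises_cons,
      Net.premises_singleton, Multiset.insert_eq_cons, conclusions, premises, syncEdges_eq,
      Link.logicalPremises, Multiset.map_cons, Multiset.map_singleton, Multiset.map_zero,
      Multiset.cons_bind, Multiset.singleton_bind, Multiset.zero_bind]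
    simp only [← Multiset.singleton_add]
    abel
  | tensor x y e =>
    have hxy : x ≠ y := by simpa [premises] using hl
    rw [edges_encodeLink_tensor]
    simp only [encodeLink, posShell, Net.premises_add, Net.premises_cons,
      Net.premises_singleton, Multiset.insert_eq_cons, conclusions, premises, syncEdges_eq,
      Link.logicalPremises, Multiset.map_cons, Multiset.map_singleton,
      Multiset.cons_bind, Multiset.singleton_bind, blueEdges_eq L hxy]
    simp only [← Multiset.singleton_add]
    abel
  | par x y e =>
    have hxy : x ≠ y := by simpa [premises] using hl
    rw [edges_encodeLink_par]
    simp only [encodeLink, negShell, Net.premises_add, Net.premises_cons,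
      Net.premises_singleton, Multiset.insert_eq_cons, conclusions, premises, syncEdges_eq,
      Link.logicalPremises, Multiset.map_cons, Multiset.map_singleton,
      Multiset.cons_bind, Multiset.singleton_bind, blueEdges_eq L hxy]
    simp only [← Multiset.singleton_add]
    abel
  | cut e =>
    induction e using Sym2.ind with
    | _ x y =>
      simp [encodeLink, conclusions, premises, Link.logicalPremises, Sym2.toMultiset_mk']
  | jax j O => exact hM.elim
  | jctr I c => exact hM.elim

theorem _root_.Multiset.bind_filter_eq {β γ : Type*} [DecidableEq γ] {A : Multiset γ}
    (hA : A.Nodup) (M : Multiset β) (φ : β → γ) :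
    (A.bind fun a => M.filter fun q => φ q = a) = M.filter fun q => φ q ∈ A := by
  induction A using Multiset.induction_on with
  | empty => simp
  | cons a A ih =>
    obtain ⟨ha, hA⟩ := Multiset.nodup_cons.1 hA
    rw [Multiset.cons_bind, ih hA, Multiset.filter_add_filter]
    have h0 : M.filter (fun q => φ q = a ∧ φ q ∈ A) = 0 := by
      rw [Multiset.filter_eq_nil]
      rintro q - ⟨h1, h2⟩
      exact ha (h1 ▸ h2)
    rw [h0, add_zero]
    simp only [Multiset.mem_cons]

omit [DecidableEq ν] in
theorem Net.logicalPremises_le (R : Net α ν) : R.logicalPremises ≤ R.premises := by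
  induction R using Multiset.induction_on with
  | empty => exact le_rfl
  | cons l Q ih =>
    rw [Net.premises_cons, Net.logicalPremises, Multiset.cons_bind]
    refine add_le_add ?_ ih
    cases l with
    | tensor x y e => exact le_rfl
    | par x y e => exact le_rfl
    | _ => exact Multiset.zero_le _

/-- Each edge between synchronisation and propagation points leaves one gadget and arrives at one
gadget. -/
theorem bind_outEdges {R : Net α ν} {L : Multiset (ν × ν)} {D : Multiset ν} (hR : R.edges.Nodup)
    (hflow : R.edges = R.premises + D) (hL : ∀ q ∈ L, q.1 ∈ R.edges ∧ q.2 ∈ R.edges) :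
    R.edges.bind (outEdges R L) =
      R.edges.bind (syncIn L) + R.logicalPremises.bind (blueIn L) := by
  have hlp : R.logicalPremises ≤ R.edges := by
    rw [hflow]
    exact R.logicalPremises_le.trans (Multiset.le_add_right _ _)
  have hlpn : R.logicalPremises.Nodup := Multiset.nodup_of_le hlp hR
  have hL' : ∀ q ∈ L.toEnumFinset.val, q.1.1 ∈ R.edges ∧ q.1.2 ∈ R.edges := fun q hq =>
    hL q.1 (Multiset.mem_of_mem_toEnumFinset hq)
  have h1 : (R.edges.bind fun s => L.toEnumFinset.val.filter fun q => q.1.1 = s) =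
      L.toEnumFinset.val := by
    rw [Multiset.bind_filter_eq hR, Multiset.filter_eq_self]
    exact fun q hq => (hL' q hq).1
  have h2 : (R.edges.bind fun s => L.toEnumFinset.val.filter fun q => q.1.2 = s) =
      L.toEnumFinset.val := by
    rw [Multiset.bind_filter_eq hR, Multiset.filter_eq_self]
    exact fun q hq => (hL' q hq).2
  have h3 : (R.edges.bind fun s => L.toEnumFinset.val.filter
      fun q => q.1.1 = s ∧ q.1.2 ∈ R.logicalPremises) =
      R.logicalPremises.bind fun x => L.toEnumFinset.val.filter fun q => q.1.2 = x := by
    rw [Multiset.bind_filter_eq hlpn]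
    simp only [← Multiset.filter_filter]
    rw [Multiset.bind_filter_eq hR, Multiset.filter_eq_self]
    exact fun q hq => (hL' q (Multiset.mem_of_mem_filter hq)).1
  have h4 : (R.edges.bind fun s =>
      if s ∈ R.logicalPremises then {port s toBlue} else (0 : Multiset (JName ν))) =
      R.logicalPremises.map fun x => port x toBlue := by
    have h5 : R.logicalPremises = R.edges.filter fun s => s ∈ R.logicalPremises := by
      refine (Multiset.Nodup.ext hlpn (hR.filter _)).2 fun x => ?_
      rw [Multiset.mem_filter]
      exact ⟨fun hx => ⟨Multiset.mem_of_le hlp hx, hx⟩, fun hx => hx.2⟩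
    conv_rhs => rw [h5, Multiset.filter_eq_bind, Multiset.map_bind]
    refine Multiset.bind_congr fun s _ => ?_
    split_ifs <;> simp
  have e1 : R.edges.bind (outEdges R L) = (R.logicalPremises.map fun x => port x toBlue) +
      L.toEnumFinset.val.map jumpSync +
      (R.logicalPremises.bind fun x =>
        L.toEnumFinset.val.filter fun q => q.1.2 = x).map jumpBlue := by
    rw [← h4, ← h3, ← h1]
    conv_rhs => rw [h1]
    conv_rhs => arg 1; arg 2; rw [← h1]
    rw [Multiset.map_bind, Multiset.map_bind, ← Multiset.bind_add, ← Multiset.bind_add]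
    rfl
  have e2 : R.edges.bind (syncIn L) = L.toEnumFinset.val.map jumpSync := by
    conv_rhs => rw [← h2]
    rw [Multiset.map_bind]
    rfl
  have e3 : R.logicalPremises.bind (blueIn L) =
      (R.logicalPremises.map fun x => port x toBlue) +
      (R.logicalPremises.bind fun x =>
        L.toEnumFinset.val.filter fun q => q.1.2 = x).map jumpBlue := by
    rw [Multiset.map_bind, ← Multiset.bind_singleton, ← Multiset.bind_add]
    refine Multiset.bind_congr fun x _ => ?_
    rw [blueIn, Multiset.singleton_add]
  rw [e1, e2, e3]
  abel

theorem edges_encode_eq {R : Net α ν} {L : Multiset (ν × ν)} {D : Multiset ν} (hR : R.edges.Nodup)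
    (hflow : R.edges = R.premises + D) (hM : ∀ l ∈ R, l.IsMLL)
    (hL : ∀ q ∈ L, q.1 ∈ R.edges ∧ q.2 ∈ R.edges) :
    (encode R L).edges = (encode R L).premises + D.map fun e => port e root := by
  have hp : R.premises.Nodup := by
    rw [hflow] at hR
    exact (Multiset.nodup_add.1 hR).1
  have key : ∀ Q : Net α ν, (∀ l ∈ Q, l ∈ R) →
      Net.edges (Q.bind (encodeLink R L)) + Q.premises.map (fun e => port e root) +
        Q.edges.bind (syncIn L) + Q.logicalPremises.bind (blueIn L) =
      Net.premises (Q.bind (encodeLink R L)) + Q.edges.map (fun e => port e root) +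
        Q.edges.bind (outEdges R L) := by
    intro Q
    induction Q using Multiset.induction_on with
    | empty => intro _; simp [Net.logicalPremises]
    | cons l Q ih =>
      intro hQ
      have hl : l.premises.Nodup := by
        obtain ⟨K, hK⟩ := Multiset.exists_cons_of_mem (hQ l (by simp))
        rw [hK, Net.premises_cons] at hp
        exact (Multiset.nodup_add.1 hp).1
      have h1 := balance_encodeLink R L l (hM l (hQ l (by simp))) hl
      have h2 := ih fun k hk => hQ k (by simp [hk])
      have h3 := congrArg₂ (· + ·) h1 h2
      have h4 : Net.logicalPremises (l ::ₘ Q) = l.logicalPremises + Net.logicalPremises Q :=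
        Multiset.cons_bind _ _ _
      simp only [Multiset.cons_bind, Net.edges_add, Net.premises_add, Net.edges_cons,
        Net.premises_cons, Multiset.map_add, Multiset.add_bind, h4]
      calc _ = _ := by abel
        _ = _ := h3
        _ = _ := by abel
  have h := key R fun l hl => hl
  rw [bind_outEdges hR hflow hL] at h
  conv at h => rhs; rw [hflow]
  have h' : (encode R L).edges + (R.premises.map (fun e => port e root) +
      (R.edges.bind (syncIn L) + R.logicalPremises.bind (blueIn L))) =
      (encode R L).premises + D.map (fun e => port e root) +
      (R.premises.map (fun e => port e root) +
      (R.edges.bind (syncIn L) + R.logicalPremises.bind (blueIn L))) := by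
    rw [Multiset.map_add] at h
    rw [← hflow] at h
    calc _ = _ := by rw [encode]; abel
      _ = _ := h
      _ = _ := by rw [encode]; abel
  exact add_right_cancel h'

end encoding

/-! ### Tags of the encoding -/

section tags

open JName Port

variable {α : Type u} {ν : Type v} [DecidableEq ν]

/-- The data that determine the weights of the edges of an encoding: `below x` is the conclusion of
the link with premise `x`, and the other fields are the weights of the contractions of the
in-synchronisation, blue and green points, of the `J⊥`-edges into green points, and of the axioms of
the out-synchronisation points. -/
structure Weights (ν : Type v) where
  below : ν → ν
  inW : ν → Multiset (JName ν)
  blueW : ν → Multiset (JName ν)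
  greenW : ν → Multiset (JName ν)
  greenEdgeW : ν → Multiset (JName ν)
  outW : ν → Multiset (JName ν)

/-- The tags of the edges of an encoding. The ranks follow the directed paths through the cut
between the gadgets of the positive edge `F` and the negative edge `G`, once the logical steps have
been made: from the blue point of `G` through the green axiom of `F`, the blue point of `F`, the
out-synchronisation point of `G` and the green point of `G` to the out-synchronisation point of `F`.
-/
def tagOf (W : Weights ν) (F G : ν) : JName ν → Tag (JName ν)
  | port e outJ => ⟨1, W.outW e, if e = F then 9 else if e = G then 6 else 0⟩
  | port e greenJ => ⟨1, W.greenEdgeW e, if e = F then 3 else 0⟩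
  | port _ redJ => ⟨1, 0, 12⟩
  | port e greenEdge => ⟨-1, W.greenEdgeW e, if e = F then 4 else if e = G then 7 else 10⟩
  | port e greenCtr => ⟨-1, W.greenW e, if e = G then 8 else 11⟩
  | port e blueCtr => ⟨-1, W.blueW e, if e = F then 5 else if e = G then 2 else 11⟩
  | port e toBlue => ⟨-1, W.blueW (W.below e), if W.below e = F ∨ W.below e = G then 1 else 10⟩
  | port e inEdge => ⟨-1, W.inW e, 10⟩
  | port e inCtr => ⟨-1, W.inW e, 11⟩
  | jumpSync q => ⟨-1, W.inW q.1.2, 10⟩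
  | jumpBlue q => ⟨-1, W.blueW (W.below q.1.2),
      if W.below q.1.2 = F ∨ W.below q.1.2 = G then 1 else 10⟩
  | _ => ⟨0, 0, 0⟩

/-- The total weight of the edges that leave the out-synchronisation point of `s`, except those that
stay in its gadget. -/
def Weights.leave (W : Weights ν) (R : Net α ν) (L : Multiset (ν × ν)) (s : ν) :
    Multiset (JName ν) :=
  (if s ∈ R.logicalPremises then W.blueW (W.below s) else 0) +
    (L.filter fun q => q.1 = s).bind fun q =>
      W.inW q.2 + if q.2 ∈ R.logicalPremises then W.blueW (W.below q.2) else 0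

theorem bind_toEnumFinset_filter {β γ : Type*} [DecidableEq β] (L : Multiset β) (p : β → Prop)
    [DecidablePred p] (φ : β → Multiset γ) :
    ((L.toEnumFinset.val.filter fun q => p q.1).bind fun q => φ q.1) = (L.filter p).bind φ := by
  conv_rhs => rw [← Multiset.map_toEnumFinset_fst L]
  rw [Multiset.filter_map, Multiset.bind_map]
  rfl

theorem bind_ite {β γ : Type*} (L : Multiset β) (p : β → Prop) [DecidablePred p]
    (φ : β → Multiset γ) :
    (L.bind fun q => if p q then φ q else 0) = (L.filter p).bind φ := by
  induction L using Multiset.induction_on with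
  | empty => simp
  | cons a L ih =>
    rw [Multiset.cons_bind, ih]
    by_cases h : p a
    · simp [h]
    · simp [h]

theorem bind_outEdges_wt (W : Weights ν) (F G : ν) (R : Net α ν) (L : Multiset (ν × ν)) (s : ν) :
    ((outEdges R L s).bind fun x => (tagOf W F G x).wt) = W.leave R L s := by
  have h1 : ((if s ∈ R.logicalPremises then {port s toBlue} else
      (0 : Multiset (JName ν))).bind fun x => (tagOf W F G x).wt) =
      if s ∈ R.logicalPremises then W.blueW (W.below s) else 0 := by
    split_ifs <;> simp [tagOf]
  rw [outEdges, Multiset.add_bind, Multiset.add_bind, h1, Multiset.bind_map, Multiset.bind_map,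
    Weights.leave, Multiset.bind_add, bind_ite, Multiset.filter_filter]
  have h2 := bind_toEnumFinset_filter L (fun q => q.1 = s) fun q => W.inW q.2
  have h3 := bind_toEnumFinset_filter L (fun q => q.1 = s ∧ q.2 ∈ R.logicalPremises)
    fun q => W.blueW (W.below q.2)
  simp only [tagOf]
  rw [h2, h3, add_assoc]
  congr 4
  ext q
  exact and_comm

/-- If the axiom `j`, from which the edges of the out-synchronisation point of `s` start, belongs to
the gadget of `F` or `G`, none of these edges arrives at the blue point of `F` or `G`. (The axiom
of a negative literal `s` is that of the dual literal, so `j` may differ from `s`.) -/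
def Acyclic (W : Weights ν) (F G : ν) (R : Net α ν) (L : Multiset (ν × ν)) (s j : ν) : Prop :=
  j = F ∨ j = G →
    (s ∈ R.logicalPremises → ¬ (W.below s = F ∨ W.below s = G)) ∧
      ∀ q ∈ L, q.1 = s → q.2 ∈ R.logicalPremises → ¬ (W.below q.2 = F ∨ W.below q.2 = G)

/-- The equations between weights, and the conditions on ranks, for the links that replace one link
of `R`. -/
def Fits (W : Weights ν) (F G : ν) (R : Net α ν) (L : Multiset (ν × ν)) : Link α ν → Prop
  | ax _ p n =>
      W.outW p = W.inW p + W.inW n + W.greenEdgeW n + W.leave R L p + W.leave R L n ∧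
      W.greenEdgeW n = W.greenW n ∧ p ≠ G ∧ n ≠ F ∧ (p = F → n ≠ G) ∧
      Acyclic W F G R L p p ∧ Acyclic W F G R L n p
  | tensor x y e =>
      W.outW e = W.inW e + W.leave R L e ∧ W.greenEdgeW e = W.blueW e ∧ W.below x = e ∧
      W.below y = e ∧ e ≠ G ∧ Acyclic W F G R L e e
  | par x y e =>
      W.outW e = W.greenEdgeW e + W.inW e + W.leave R L e ∧ W.greenEdgeW e = W.greenW e ∧
      W.below x = e ∧ W.below y = e ∧ e ≠ F ∧ Acyclic W F G R L e e
  | _ => True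

variable {W : Weights ν} {F G : ν} {R : Net α ν} {L : Multiset (ν × ν)}

theorem mem_outEdges {s : ν} {x : JName ν} : x ∈ outEdges R L s ↔
    (s ∈ R.logicalPremises ∧ x = port s toBlue) ∨
    (∃ q ∈ L.toEnumFinset, q.1.1 = s ∧ x = jumpSync q) ∨
    ∃ q ∈ L.toEnumFinset, q.1.1 = s ∧ q.1.2 ∈ R.logicalPremises ∧ x = jumpBlue q := by
  simp only [outEdges, Multiset.mem_add, Multiset.mem_map, Multiset.mem_filter, Finset.mem_val]
  rw [or_assoc]
  refine or_congr ?_ (or_congr ?_ ?_)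
  · split_ifs with h <;> simp [h]
  · exact exists_congr fun q => ⟨fun h => ⟨h.1.1, h.1.2, h.2.symm⟩,
      fun h => ⟨⟨h.1, h.2.1⟩, h.2.2.symm⟩⟩
  · exact exists_congr fun q => ⟨fun h => ⟨h.1.1, h.1.2.1, h.1.2.2, h.2.symm⟩,
      fun h => ⟨⟨h.1, h.2.1, h.2.2.1⟩, h.2.2.2.symm⟩⟩

theorem Acyclic.rk_lt {s j : ν} (h : Acyclic W F G R L s j) {x : JName ν}
    (hx : x ∈ outEdges R L s) :
    (tagOf W F G x).sign = -1 ∧ (tagOf W F G (port j outJ)).rk < (tagOf W F G x).rk := by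
  rcases mem_outEdges.1 hx with ⟨hs, rfl⟩ | ⟨q, hq, rfl, rfl⟩ | ⟨q, hq, hs, hq', rfl⟩
  · refine ⟨rfl, ?_⟩
    simp only [tagOf]
    by_cases hj : j = F ∨ j = G
    · rw [if_neg ((h hj).1 hs)]
      split_ifs <;> omega
    · push Not at hj
      rw [if_neg hj.1, if_neg hj.2]
      split_ifs <;> omega
  · refine ⟨rfl, ?_⟩
    simp only [tagOf]
    split_ifs <;> omega
  · refine ⟨rfl, ?_⟩
    simp only [tagOf]
    by_cases hj : j = F ∨ j = G
    · rw [if_neg ((h hj).2 q.1 (Multiset.mem_of_mem_toEnumFinset hq) hs hq')]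
      split_ifs <;> omega
    · push Not at hj
      rw [if_neg hj.1, if_neg hj.2]
      split_ifs <;> omega

theorem tagged_sync (e : ν) :
    Tagged (tagOf W F G) (jctr (syncEdges L e) (port e inCtr) : Link α (JName ν)) := by
  refine ⟨rfl, fun i hi => ?_⟩
  simp only [syncEdges, Multiset.mem_cons, Multiset.mem_map, Multiset.mem_filter] at hi
  rcases hi with rfl | ⟨q, ⟨-, rfl⟩, rfl⟩
  · exact ⟨rfl, rfl, by simp [tagOf]⟩
  · exact ⟨rfl, rfl, by simp [tagOf]⟩

theorem tagged_red (e : ν) :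
    Tagged (tagOf W F G) (jax (port e redJ) 0 : Link α (JName ν)) :=
  ⟨rfl, rfl, by simp⟩

theorem tagged_green {e : ν} (h : W.greenEdgeW e = W.greenW e) :
    Tagged (tagOf W F G) (jctr {port e greenEdge} (port e greenCtr) : Link α (JName ν)) := by
  refine ⟨rfl, fun i hi => ?_⟩
  rw [Multiset.mem_singleton.1 hi]
  refine ⟨rfl, h, ?_⟩
  simp only [tagOf]
  split_ifs <;> omega

theorem blueEdges_tag {x y e : ν} (hx : W.below x = e) (hy : W.below y = e) :
    ∀ i ∈ blueEdges L x y, (tagOf W F G i).sign = -1 ∧ (tagOf W F G i).wt = W.blueW e ∧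
      (tagOf W F G i).rk < (tagOf W F G (port e blueCtr)).rk := by
  intro i hi
  simp only [blueEdges, Multiset.mem_cons, Multiset.mem_map, Multiset.mem_filter] at hi
  rcases hi with rfl | rfl | ⟨q, ⟨-, hq⟩, rfl⟩
  · refine ⟨rfl, by simp [tagOf, hx], ?_⟩
    simp only [tagOf, hx]
    split_ifs with h1 h2 <;> first | omega | (exfalso; tauto)
  · refine ⟨rfl, by simp [tagOf, hy], ?_⟩
    simp only [tagOf, hy]
    split_ifs with h1 h2 <;> first | omega | (exfalso; tauto)
  · have hq' : W.below q.1.2 = e := by rcases hq with h | h <;> rw [h] <;> assumption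
    refine ⟨rfl, by simp [tagOf, hq'], ?_⟩
    simp only [tagOf, hq']
    split_ifs with h1 h2 <;> first | omega | (exfalso; tauto)

theorem tagged_partLink {l : Link α ν} (h : Fits W F G R L l) :
    ∀ k ∈ partLink R L l, Tagged (tagOf W F G) k := by
  intro k hk
  cases l with
  | ax A p n =>
    obtain ⟨h1, h2, h3, h4, h5, h6, h7⟩ := h
    simp only [partLink, posPart, negPart, Multiset.mem_add, Multiset.insert_eq_cons,
      Multiset.mem_cons, Multiset.mem_singleton] at hk
    rcases hk with (rfl | rfl | rfl) | rfl | rfl | rfl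
    · refine ⟨rfl, ?_, ?_⟩
      · rw [Multiset.add_bind, Multiset.add_bind, bind_outEdges_wt, bind_outEdges_wt]
        simp only [Multiset.cons_bind, Multiset.singleton_bind, tagOf, h1]
        abel
      · intro o ho
        simp only [Multiset.mem_add, Multiset.mem_cons, Multiset.mem_singleton] at ho
        rcases ho with ((rfl | rfl | rfl) | ho) | ho
        · refine ⟨rfl, ?_⟩
          simp only [tagOf]
          split_ifs <;> omega
        · refine ⟨rfl, ?_⟩
          simp only [tagOf]
          split_ifs <;> omega
        · refine ⟨rfl, ?_⟩
          simp only [tagOf, if_neg h4, if_neg h3]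
          split_ifs with a b <;> first | omega | exact absurd b (h5 a)
        · exact h6.rk_lt ho
        · exact h7.rk_lt ho
    · exact tagged_sync p
    · exact tagged_red p
    · exact tagged_green h2
    · exact tagged_red n
    · exact tagged_sync n
  | tensor x y e =>
    obtain ⟨h1, h2, h3, h4, h5, h6⟩ := h
    simp only [partLink, posPart, Multiset.mem_add, Multiset.insert_eq_cons,
      Multiset.mem_cons, Multiset.mem_singleton] at hk
    rcases hk with (rfl | rfl | rfl) | rfl | rfl
    · refine ⟨rfl, by simp [tagOf], ?_⟩
      intro o ho
      rw [Multiset.mem_singleton.1 ho]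
      refine ⟨rfl, ?_⟩
      simp only [tagOf]
      split_ifs <;> omega
    · refine ⟨rfl, ?_⟩
      intro i hi
      rcases Multiset.mem_cons.1 hi with rfl | hi
      · refine ⟨rfl, h2, ?_⟩
        simp only [tagOf, if_neg h5]
        split_ifs <;> omega
      · exact blueEdges_tag h3 h4 i hi
    · refine ⟨rfl, ?_, ?_⟩
      · rw [Multiset.cons_bind, bind_outEdges_wt]
        exact h1
      · intro o ho
        rcases Multiset.mem_cons.1 ho with rfl | ho
        · refine ⟨rfl, ?_⟩
          simp only [tagOf]
          split_ifs <;> omega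
        · exact h6.rk_lt ho
    · exact tagged_sync e
    · exact tagged_red e
  | par x y e =>
    obtain ⟨h1, h2, h3, h4, h5, h6⟩ := h
    simp only [partLink, negPart, Multiset.mem_add, Multiset.insert_eq_cons,
      Multiset.mem_cons, Multiset.mem_singleton] at hk
    rcases hk with (rfl | rfl) | rfl | rfl | rfl
    · exact ⟨rfl, blueEdges_tag h3 h4⟩
    · refine ⟨rfl, ?_, ?_⟩
      · rw [Multiset.cons_bind, Multiset.cons_bind, bind_outEdges_wt, ← add_assoc]
        exact h1
      · intro o ho
        rcases Multiset.mem_cons.1 ho with rfl | ho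
        · refine ⟨rfl, ?_⟩
          simp only [tagOf, if_neg h5]
          split_ifs <;> omega
        rcases Multiset.mem_cons.1 ho with rfl | ho
        · refine ⟨rfl, ?_⟩
          simp only [tagOf]
          split_ifs <;> omega
        · exact h6.rk_lt ho
    · exact tagged_green h2
    · exact tagged_red e
    · exact tagged_sync e
  | cut e => exact absurd hk (Multiset.notMem_zero _)
  | jax j O => exact absurd hk (Multiset.notMem_zero _)
  | jctr I c => exact absurd hk (Multiset.notMem_zero _)

theorem sign_frameLink_edges {l : Link α ν} {x : JName ν} (hx : x ∈ (frameLink l).edges) :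
    (tagOf W F G x).sign = 0 := by
  cases l with
  | ax A p n =>
    simp only [frameLink, posFrame, negFrame, Net.edges_add, Net.edges_cons, Net.edges_singleton,
      conclusions, Multiset.insert_eq_cons, Multiset.mem_add, Multiset.mem_cons,
      Multiset.mem_singleton] at hx
    rcases hx with ((rfl | rfl) | rfl | rfl | rfl) | rfl | rfl | rfl <;> rfl
  | tensor x y e =>
    simp only [frameLink, posFrame, Net.edges_add, Net.edges_cons, Net.edges_singleton,
      conclusions, Multiset.insert_eq_cons, Multiset.mem_add, Multiset.mem_singleton] at hx
    rcases hx with (rfl | rfl | rfl) | rfl | rfl | rfl <;> rfl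
  | par x y e =>
    simp only [frameLink, negFrame, Net.edges_add, Net.edges_cons, Net.edges_singleton,
      conclusions, Multiset.insert_eq_cons, Multiset.mem_add, Multiset.mem_singleton] at hx
    rcases hx with (rfl | rfl | rfl) | rfl | rfl | rfl <;> rfl
  | cut e => simp [frameLink, conclusions] at hx
  | jax j O => simp [frameLink] at hx
  | jctr I c => simp [frameLink] at hx

/-- The edges `J⊥` at the interface between the two parts of an encoding. -/
theorem frameLink_premises {l : Link α ν} {x : JName ν} (hx : x ∈ (frameLink l).premises)
    (hs : (tagOf W F G x).sign = -1) :
    (∃ I, jctr I x ∈ partLink R L l) ∧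
      ∃ e ∈ l.conclusions, x = port e inCtr ∨ x = port e greenCtr ∨ x = port e blueCtr := by
  cases l with
  | ax A p n =>
    simp only [frameLink, posFrame, negFrame, Net.premises_add, Net.premises_cons,
      Net.premises_singleton, premises, Multiset.insert_eq_cons, Multiset.mem_add,
      Multiset.mem_cons, Multiset.mem_singleton, Multiset.notMem_zero, false_or] at hx
    rcases hx with ((rfl | rfl) | (rfl | rfl) | rfl | rfl) | (rfl | rfl) | (rfl | rfl) | rfl | rfl
    all_goals try exact absurd (show (0 : SignType) = -1 from hs) (by decide)
    all_goals try exact absurd (show (1 : SignType) = -1 from hs) (by decide)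
    · exact ⟨⟨syncEdges L p, by simp [partLink, posPart]⟩, p, by simp [conclusions], by simp⟩
    · exact ⟨⟨{port n greenEdge}, by simp [partLink, negPart]⟩, n, by simp [conclusions], by simp⟩
    · exact ⟨⟨syncEdges L n, by simp [partLink, negPart]⟩, n, by simp [conclusions], by simp⟩
  | tensor x y e =>
    simp only [frameLink, posFrame, Net.premises_add, Net.premises_cons,
      Net.premises_singleton, premises, Multiset.insert_eq_cons, Multiset.mem_add,
      Multiset.mem_cons, Multiset.mem_singleton] at hx
    rcases hx with ((rfl | rfl) | (rfl | rfl) | rfl | rfl) | (rfl | rfl) | (rfl | rfl) | rfl | rfl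
    all_goals try exact absurd (show (0 : SignType) = -1 from hs) (by decide)
    all_goals try exact absurd (show (1 : SignType) = -1 from hs) (by decide)
    · exact ⟨⟨port e greenEdge ::ₘ blueEdges L x y, by simp [partLink, posPart]⟩, e,
        by simp [conclusions], by simp⟩
    · exact ⟨⟨syncEdges L e, by simp [partLink, posPart]⟩, e, by simp [conclusions], by simp⟩
  | par x y e =>
    simp only [frameLink, negFrame, Net.premises_add, Net.premises_cons,
      Net.premises_singleton, premises, Multiset.insert_eq_cons, Multiset.mem_add,
      Multiset.mem_cons, Multiset.mem_singleton] at hx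
    rcases hx with ((rfl | rfl) | (rfl | rfl) | rfl | rfl) | (rfl | rfl) | (rfl | rfl) | rfl | rfl
    all_goals try exact absurd (show (0 : SignType) = -1 from hs) (by decide)
    all_goals try exact absurd (show (1 : SignType) = -1 from hs) (by decide)
    · exact ⟨⟨blueEdges L x y, by simp [partLink, negPart]⟩, e, by simp [conclusions], by simp⟩
    · exact ⟨⟨{port e greenEdge}, by simp [partLink, negPart]⟩, e, by simp [conclusions], by simp⟩
    · exact ⟨⟨syncEdges L e, by simp [partLink, negPart]⟩, e, by simp [conclusions], by simp⟩
  | cut c =>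
    induction c using Sym2.ind with
    | _ a b =>
      simp only [frameLink, Net.premises_singleton, premises, Sym2.map_mk, Sym2.toMultiset_mk',
        Multiset.insert_eq_cons, Multiset.mem_cons, Multiset.mem_singleton] at hx
      rcases hx with rfl | rfl <;>
        exact absurd (show (0 : SignType) = -1 from hs) (by decide)
  | jax j O => simp [frameLink] at hx
  | jctr I c => simp [frameLink] at hx

omit [DecidableEq ν] in
theorem root_mem_frameLink {l : Link α ν} (hl : l.IsMLL) {e : ν} (he : e ∈ l.conclusions) :
    port e root ∈ (frameLink l).edges := by
  cases l with
  | ax A p n =>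
    simp only [conclusions, Multiset.insert_eq_cons, Multiset.mem_cons,
      Multiset.mem_singleton] at he
    rcases he with rfl | rfl <;>
    simp [frameLink, posFrame, negFrame, conclusions]
  | tensor x y z =>
    rw [Multiset.mem_singleton.1 he]
    simp [frameLink, posFrame, conclusions]
  | par x y z =>
    rw [Multiset.mem_singleton.1 he]
    simp [frameLink, negFrame, conclusions]
  | cut c => exact absurd he (Multiset.notMem_zero _)
  | jax j O => exact hl.elim
  | jctr I c => exact hl.elim

/-- The ports of the conclusions of contractions. -/
def IsCtrPort : JName ν → Prop
  | port _ inCtr => True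
  | port _ greenCtr => True
  | port _ blueCtr => True
  | _ => False

theorem partLink_flat {l : Link α ν} {k : Link α (JName ν)} (hk : k ∈ partLink R L l) :
    (∀ e, k ≠ cut e) ∧ ∀ I c, k = jctr I c → IsCtrPort c ∧ ∀ i ∈ I, ¬ IsCtrPort i := by
  have hsync : ∀ e, ∀ i ∈ syncEdges L e, ¬ IsCtrPort i := by
    intro e i hi
    simp only [syncEdges, Multiset.mem_cons, Multiset.mem_map] at hi
    rcases hi with rfl | ⟨q, -, rfl⟩ <;> exact id
  have hblue : ∀ x y, ∀ i ∈ blueEdges L x y, ¬ IsCtrPort i := by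
    intro x y i hi
    simp only [blueEdges, Multiset.mem_cons, Multiset.mem_map] at hi
    rcases hi with rfl | rfl | ⟨q, -, rfl⟩ <;> exact id
  cases l with
  | ax A p n =>
    simp only [partLink, posPart, negPart, Multiset.mem_add, Multiset.insert_eq_cons,
      Multiset.mem_cons, Multiset.mem_singleton] at hk
    rcases hk with (rfl | rfl | rfl) | rfl | rfl | rfl <;> refine ⟨by simp, fun I c h => ?_⟩ <;>
      cases h <;> refine ⟨trivial, ?_⟩
    · exact hsync _
    · intro i hi
      rw [Multiset.mem_singleton.1 hi]
      exact id
    · exact hsync _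
  | tensor x y e =>
    simp only [partLink, posPart, Multiset.mem_add, Multiset.insert_eq_cons,
      Multiset.mem_cons, Multiset.mem_singleton] at hk
    rcases hk with (rfl | rfl | rfl) | rfl | rfl <;> refine ⟨by simp, fun I c h => ?_⟩ <;>
      cases h <;> refine ⟨trivial, ?_⟩
    · intro i hi
      rcases Multiset.mem_cons.1 hi with rfl | hi
      · exact id
      · exact hblue x y i hi
    · exact hsync _
  | par x y e =>
    simp only [partLink, negPart, Multiset.mem_add, Multiset.insert_eq_cons,
      Multiset.mem_cons, Multiset.mem_singleton] at hk
    rcases hk with (rfl | rfl) | rfl | rfl | rfl <;> refine ⟨by simp, fun I c h => ?_⟩ <;>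
      cases h <;> refine ⟨trivial, ?_⟩
    · exact hblue x y
    · intro i hi
      rw [Multiset.mem_singleton.1 hi]
      exact id
    · exact hsync _
  | cut e => exact absurd hk (Multiset.notMem_zero _)
  | jax j O => exact absurd hk (Multiset.notMem_zero _)
  | jctr I c => exact absurd hk (Multiset.notMem_zero _)

theorem isFlat_partLink : IsFlat (R.bind (partLink R L)) := by
  refine ⟨?_, ?_⟩
  · intro e he
    obtain ⟨l, -, hk⟩ := Multiset.mem_bind.1 he
    exact (partLink_flat hk).1 e rfl
  · intro I x J c hI hJ hx
    obtain ⟨l, -, hk⟩ := Multiset.mem_bind.1 hI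
    obtain ⟨l', -, hk'⟩ := Multiset.mem_bind.1 hJ
    exact ((partLink_flat hk').2 J c rfl).2 x hx ((partLink_flat hk).2 I x rfl).1

/-- An encoding is a state of the elimination. -/
theorem state_encode {B : Sym2 (JName ν) → Prop} {T : Net α (JName ν)} {D : Multiset ν} {n : ℕ}
    (hR : R.edges.Nodup) (hflow : R.edges = R.premises + D) (hM : ∀ l ∈ R, l.IsMLL)
    (hL : ∀ q ∈ L, q.1 ∈ R.edges ∧ q.2 ∈ R.edges) (hfit : ∀ l ∈ R, Fits W F G R L l)
    (hch : Chain B (tagOf W F G) T n (R.bind frameLink)) :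
    State B (tagOf W F G) T (D.map fun e => port e root) n (R.bind frameLink)
      (R.bind (partLink R L)) (tagOf W F G) (encode R L) where
  eq := encode_eq R L
  nodup := nodup_edges_encode L hR hM
  flow := edges_encode_eq hR hflow hM hL
  chain := hch
  sign_edges x hx := by
    rw [Net.edges_bind] at hx
    obtain ⟨l, -, hx⟩ := Multiset.mem_bind.1 hx
    exact sign_frameLink_edges hx
  lab_premises x _ := rfl
  tagged k hk := by
    obtain ⟨l, hl, hk⟩ := Multiset.mem_bind.1 hk
    exact tagged_partLink (hfit l hl) k hk
  ctr x hx hs := by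
    rw [Net.premises_bind] at hx
    obtain ⟨l, hl, hx⟩ := Multiset.mem_bind.1 hx
    obtain ⟨I, hI⟩ := (frameLink_premises (R := R) (L := L) hx hs).1
    exact ⟨I, Multiset.mem_bind.2 ⟨l, hl, hI⟩⟩

/-- The cuts that the elimination of the cuts between the gadgets of `F` and `G` does not reduce. -/
def Blocked (R : Net α ν) (F G : ν) (e : Sym2 (JName ν)) : Prop :=
  ∃ x ∈ R.edges, ∃ y ∈ R.edges, e = s(port x root, port y root) ∧ s(x, y) ≠ s(F, G)

theorem gadgetStep_iff {S S' : Net α (JName ν)} :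
    GadgetStep R F G S S' ↔ AllowedStep (Blocked R F G) S S' := by
  refine exists_congr fun l => and_congr_right fun _ => ?_
  constructor
  · rintro h e rfl ⟨x, hx, y, hy, rfl, hne⟩
    exact hne (h x hx y hy rfl)
  · intro h x hx y hy hl
    by_contra hne
    exact h _ hl ⟨x, hx, y, hy, rfl, hne⟩

omit [DecidableEq ν] in
theorem frameLink_isMLL {l : Link α ν} {k : Link α (JName ν)} (hk : k ∈ frameLink l) :
    k.IsMLL ∧ ∀ e, k = cut e → ∃ c, l = cut c ∧ e = c.map fun a => port a root := by
  cases l with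
  | ax A p n =>
    simp only [frameLink, posFrame, negFrame, Multiset.mem_add, Multiset.insert_eq_cons,
      Multiset.mem_cons, Multiset.mem_singleton] at hk
    rcases hk with (rfl | rfl | rfl | rfl) | rfl | rfl | rfl <;> exact ⟨trivial, by simp⟩
  | tensor x y e =>
    simp only [frameLink, posFrame, Multiset.mem_add, Multiset.insert_eq_cons,
      Multiset.mem_cons, Multiset.mem_singleton] at hk
    rcases hk with (rfl | rfl | rfl) | rfl | rfl | rfl <;> exact ⟨trivial, by simp⟩
  | par x y e =>
    simp only [frameLink, negFrame, Multiset.mem_add, Multiset.insert_eq_cons,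
      Multiset.mem_cons, Multiset.mem_singleton] at hk
    rcases hk with (rfl | rfl | rfl) | rfl | rfl | rfl <;> exact ⟨trivial, by simp⟩
  | cut c =>
    rw [frameLink, Multiset.mem_singleton] at hk
    subst hk
    exact ⟨trivial, fun e h => ⟨c, rfl, (cut.inj h).symm⟩⟩
  | jax j O => exact absurd hk (Multiset.notMem_zero _)
  | jctr I c => exact absurd hk (Multiset.notMem_zero _)

omit [DecidableEq ν] in
/-- Cuts between edges other than `F` and `G` are blocked in the encoding. -/
theorem blocked_frame {Q : Net α ν} (hQ : ∀ x ∈ Q.premises, x ∈ R.edges ∧ x ≠ F ∧ x ≠ G) :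
    ∀ k ∈ Q.bind frameLink, k.IsMLL ∧ ∀ e, k = cut e → Blocked R F G e := by
  intro k hk
  obtain ⟨l, hl, hk⟩ := Multiset.mem_bind.1 hk
  obtain ⟨h1, h2⟩ := frameLink_isMLL hk
  refine ⟨h1, fun e he => ?_⟩
  obtain ⟨c, rfl, rfl⟩ := h2 e he
  induction c using Sym2.ind with
  | _ a b =>
    have ha := hQ a (Net.mem_premises.2 ⟨_, hl, by simp [premises]⟩)
    have hb := hQ b (Net.mem_premises.2 ⟨_, hl, by simp [premises]⟩)
    refine ⟨a, ha.1, b, hb.1, rfl, fun h => ?_⟩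
    rcases Sym2.eq_iff.1 h with ⟨h, -⟩ | ⟨h, -⟩
    · exact ha.2.1 h
    · exact ha.2.2 h

/-- If the same weights fit the encodings of `R` and of `R'`, the elimination of the cuts between
the gadgets of `F` and `G` leads from the first encoding to the second one. -/
theorem gadget_elimination {R' : Net α ν} {L' : Multiset (ν × ν)} {D : Multiset ν} {n : ℕ}
    (hR : R.edges.Nodup) (hflow : R.edges = R.premises + D) (hM : ∀ l ∈ R, l.IsMLL)
    (hL : ∀ q ∈ L, q.1 ∈ R.edges ∧ q.2 ∈ R.edges) (hfit : ∀ l ∈ R, Fits W F G R L l)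
    (hR' : R'.edges.Nodup) (hflow' : R'.edges = R'.premises + D) (hM' : ∀ l ∈ R', l.IsMLL)
    (hL' : ∀ q ∈ L', q.1 ∈ R'.edges ∧ q.2 ∈ R'.edges) (hfit' : ∀ l ∈ R', Fits W F G R' L' l)
    (hch : Chain (Blocked R F G) (tagOf W F G) (R'.bind frameLink) n (R.bind frameLink))
    (hedges : ∀ e, e ∈ R'.edges ↔ e ∈ R.edges ∧ e ≠ F ∧ e ≠ G)
    (hin : ∀ e ∈ R'.edges, W.inW e = {port e inCtr})
    (hblue : ∀ e ∈ R'.edges, W.blueW e = {port e blueCtr})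
    (hgreen : ∀ e ∈ R'.edges, W.greenW e = {port e greenCtr}) :
    (∃ S, IsGadgetElimination R F G (encode R L) S) ∧
      ∀ S, IsGadgetElimination R F G (encode R L) S →
        Net.SameUpTo {x | ∃ e ∈ R'.edges, x = port e root} S (encode R' L') := by
  have : Infinite (JName ν) := Infinite.of_injective (fun k : ℕ => jumpSync ((F, F), k))
    fun a b h => by simpa using h
  have hstep : GadgetStep R F G = AllowedStep (α := α) (Blocked R F G) := by
    funext S S'
    exact propext gadgetStep_iff
  have hroot : ∀ e ∈ R'.edges, port e root ∈ Net.edges (R'.bind frameLink) := by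
    intro e he
    obtain ⟨l, hl, he⟩ := Net.mem_edges.1 he
    rw [Net.edges_bind]
    exact Multiset.mem_bind.2 ⟨l, hl, root_mem_frameLink (hM' l hl) he⟩
  have hT : ∀ k ∈ R'.bind frameLink, k.IsMLL ∧ ∀ e, k = cut e → Blocked R F G e := by
    refine blocked_frame fun x hx => (hedges x).1 ?_
    rw [hflow']
    exact Multiset.mem_add.2 (Or.inl hx)
  have hB : ∀ e, Blocked R F G e →
      e.IsDiag ∨ ∃ a ∈ e, a ∈ Net.edges (R'.bind (frameLink (α := α))) := by
    rintro e ⟨x, hx, y, hy, rfl, hne⟩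
    by_cases hx' : x ∈ R'.edges
    · exact Or.inr ⟨_, Sym2.mem_mk_left _ _, hroot x hx'⟩
    by_cases hy' : y ∈ R'.edges
    · exact Or.inr ⟨_, Sym2.mem_mk_right _ _, hroot y hy'⟩
    left
    have h1 : x = F ∨ x = G := by
      by_contra h
      push Not at h
      exact hx' ((hedges x).2 ⟨hx, h⟩)
    have h2 : y = F ∨ y = G := by
      by_contra h
      push Not at h
      exact hy' ((hedges y).2 ⟨hy, h⟩)
    rw [Sym2.mk_isDiag_iff]
    rcases h1 with rfl | rfl <;> rcases h2 with rfl | rfl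
    · rfl
    · exact (hne rfl).elim
    · exact (hne Sym2.eq_swap).elim
    · rfl
  have hD : ∀ x ∈ D.map (fun e => port e root), x ∈ Net.edges (R'.bind (frameLink (α := α))) := by
    intro x hx
    obtain ⟨e, he, rfl⟩ := Multiset.mem_map.1 hx
    refine hroot e ?_
    rw [hflow']
    exact Multiset.mem_add.2 (Or.inr he)
  have hw : ∀ c ∈ Net.premises (R'.bind (frameLink (α := α))), (tagOf W F G c).sign = -1 →
      (tagOf W F G c).wt = {c} := by
    intro c hc hs
    rw [Net.premises_bind] at hc
    obtain ⟨l, hl, hc⟩ := Multiset.mem_bind.1 hc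
    obtain ⟨e, he, h⟩ := (frameLink_premises (R := R) (L := L) hc hs).2
    have he' : e ∈ R'.edges := Net.mem_edges.2 ⟨l, hl, he⟩
    rcases h with rfl | rfl | rfl
    · exact hin e he'
    · exact hgreen e he'
    · exact hblue e he'
  have hS := state_encode hR hflow hM hL hfit hch
  have hS' := state_encode (B := Blocked R F G) hR' hflow' hM' hL' hfit' .nil
  simp only [IsGadgetElimination, hstep]
  refine ⟨hS.exists_normal hT, ?_⟩
  rintro S ⟨hred, hnormal⟩
  obtain ⟨n', Fr', P', lab', h'⟩ := hS.reachable hT hred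
  obtain ⟨h1, h2⟩ := h'.flat_of_normal hB hnormal
  obtain ⟨σ, s1, s2, s3⟩ := h1.sameUpTo h2 hS' isFlat_partLink hD hw
  refine ⟨σ, s1, ?_, s3⟩
  rintro x ⟨e, he, rfl⟩
  exact s2 _ (hroot e he)

end tags

/-! ### The logical steps between two gadgets -/

section chains

open JName Port

variable {α : Type u} {ν : Type v} [DecidableEq ν] {W : Weights ν} {F G : ν} {R : Net α ν}

omit [DecidableEq ν] in
theorem not_blocked_of_mem {e : Sym2 (JName ν)} {x : JName ν} (hx : x ∈ e)
    (h : ∀ a, x ≠ port a root) : ¬ Blocked R F G e := by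
  rintro ⟨a, -, b, -, rfl, -⟩
  rcases Sym2.mem_iff.1 hx with rfl | rfl
  · exact h a rfl
  · exact h b rfl

omit [DecidableEq ν] in
theorem not_blocked_roots : ¬ Blocked R F G s(port F root, port G root) := by
  rintro ⟨a, -, b, -, h, hne⟩
  refine hne ?_
  rcases Sym2.eq_iff.1 h with ⟨h1, h2⟩ | ⟨h1, h2⟩
  · rw [(port.inj h1).1, (port.inj h2).1]
  · rw [(port.inj h1).1, (port.inj h2).1, Sym2.eq_swap]

/-- The links of `Q` belong to `MLL` and its cuts are blocked. -/
def Inert (R : Net α ν) (F G : ν) (Q : Net α (JName ν)) : Prop :=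
  ∀ l ∈ Q, l.IsMLL ∧ ∀ e, l = cut e → Blocked R F G e

omit [DecidableEq ν] in
theorem Inert.cons {Q : Net α (JName ν)} (h : Inert R F G Q) {l : Link α (JName ν)}
    (hl : l.IsMLL) (hc : ∀ e, l ≠ cut e) : Inert R F G (l ::ₘ Q) := by
  intro k hk
  rcases Multiset.mem_cons.1 hk with rfl | hk
  · exact ⟨hl, fun e he => (hc e he).elim⟩
  · exact h k hk

theorem tagged_cut {j c : JName ν} (hj : (tagOf W F G j).sign = 1)
    (hc : (tagOf W F G c).sign = -1) (hw : (tagOf W F G c).wt = (tagOf W F G j).wt)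
    (hr : (tagOf W F G c).rk < (tagOf W F G j).rk) :
    ∀ l ∈ ({cut s(j, c)} : Net α (JName ν)), ∃ e, l = cut e ∧ Tagged (tagOf W F G) l := by
  intro l hl
  rw [Multiset.mem_singleton.1 hl]
  exact ⟨_, rfl, j, c, rfl, hj, hc, hw, hr⟩

variable {T Q : Net α (JName ν)} {n : ℕ} {b b' : JName ν}

/-- The three logical steps that eliminate the cut between the lower parts of the gadgets of the
positive edge `F` and of the negative edge `G`. -/
theorem chain_shells (hQ : Inert R F G Q)
    (hinF : W.inW F = 0) (hinG : W.inW G = 0) (hout : W.outW F = W.greenW G)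
    (h : Chain (Blocked R F G) (tagOf W F G) T n (cut s(b, b') ::ₘ Q)) :
    Chain (Blocked R F G) (tagOf W F G) T (n + 1 + 1 + 1)
      (cut s(port F root, port G root) ::ₘ (posFrame F b + negFrame G b' + Q)) := by
  have h1 : Chain (Blocked R F G) (tagOf W F G) T (n + 1)
      (tensor b (port F outJ) (port F out) ::ₘ par (port G greenCtr) b' (port G green) ::ₘ
        cut s(port F out, port G green) ::ₘ Q) := by
    refine .tensor_par _ _ _ _ _ _ h rfl (C := {cut s(port F outJ, port G greenCtr)}) ?_
      (tagged_cut rfl rfl hout.symm ?_) ?_ hQ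
    · simp only [← Multiset.singleton_add]
      abel
    · simp [tagOf]
    · exact not_blocked_of_mem (Sym2.mem_mk_left _ _) (by simp)
  have h2 : Chain (Blocked R F G) (tagOf W F G) T (n + 1 + 1)
      (tensor (port G redJ) (port G green) (port G red) ::ₘ
        par (port F out) (port F inCtr) (port F sync) ::ₘ
        cut s(port G red, port F sync) ::ₘ
        tensor b (port F outJ) (port F out) ::ₘ par (port G greenCtr) b' (port G green) ::ₘ Q) := by
    refine .tensor_par _ _ _ _ _ _ h1 rfl (C := {cut s(port G redJ, port F inCtr)}) ?_
      (tagged_cut rfl rfl hinF ?_) ?_ ((hQ.cons ?_ ?_).cons ?_ ?_)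
    · rw [Sym2.eq_swap (a := port G green)]
      simp only [← Multiset.singleton_add]
      abel
    · simp [tagOf]
    · exact not_blocked_of_mem (Sym2.mem_mk_left _ _) (by simp)
    · trivial
    · simp
    · trivial
    · simp
  refine .tensor_par (port F sync) (port F redJ) (port F root) (port G red) (port G inCtr)
    (port G root) h2 (Q := tensor (port G redJ) (port G green) (port G red) ::ₘ
        par (port F out) (port F inCtr) (port F sync) ::ₘ
        tensor b (port F outJ) (port F out) ::ₘ par (port G greenCtr) b' (port G green) ::ₘ Q)
    ?_ (C := {cut s(port F redJ, port G inCtr)}) ?_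
      (tagged_cut rfl rfl hinG ?_) not_blocked_roots
      ((((hQ.cons ?_ ?_).cons ?_ ?_).cons ?_ ?_).cons ?_ ?_)
  · simp only [posFrame, negFrame, Multiset.insert_eq_cons, ← Multiset.singleton_add]
    abel
  · rw [Sym2.eq_swap (a := port F sync)]
    simp only [← Multiset.singleton_add]
    abel
  · simp [tagOf]
  all_goals first | trivial | simp

/-- The logical steps that eliminate the cut between the gadget of a conclusion of a tensor and that
of a conclusion of a par. -/
theorem chain_tensor_par {x y x' y' : ν} {K : Net α ν} (hFG : F ≠ G)
    (hK : Inert R F G (K.bind frameLink))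
    (hinF : W.inW F = 0) (hinG : W.inW G = 0) (hout : W.outW F = W.greenW G)
    (hblue : W.blueW F = W.outW G) (hgreen : W.blueW G = W.greenEdgeW F) :
    Chain (Blocked R F G) (tagOf W F G)
      (Multiset.bind (cut s(x, x') ::ₘ cut s(y, y') ::ₘ K) frameLink)
      (0 + 1 + 1 + 1 + 1 + 1 + 1)
      (Multiset.bind (tensor x y F ::ₘ par y' x' G ::ₘ cut s(F, G) ::ₘ K) frameLink) := by
  have h1 : Chain (Blocked R F G) (tagOf W F G)
      (Multiset.bind (cut s(x, x') ::ₘ cut s(y, y') ::ₘ K) frameLink) (0 + 1)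
      (tensor (port x root) (port y root) (port F raw) ::ₘ
        par (port y' root) (port x' root) (port G raw) ::ₘ
        cut s(port F raw, port G raw) ::ₘ K.bind frameLink) := by
    refine .tensor_par _ _ _ _ _ _ .nil rfl (C := 0) ?_ (by simp)
      (not_blocked_of_mem (Sym2.mem_mk_left _ _) (by simp)) hK
    simp [frameLink]
    exact Multiset.cons_swap _ _ _
  have h2 : Chain (Blocked R F G) (tagOf W F G)
      (Multiset.bind (cut s(x, x') ::ₘ cut s(y, y') ::ₘ K) frameLink) (0 + 1 + 1)
      (tensor (port F raw) (port F greenJ) (port F green) ::ₘ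
        par (port G blueCtr) (port G raw) (port G blue) ::ₘ
        cut s(port F green, port G blue) ::ₘ
        tensor (port x root) (port y root) (port F raw) ::ₘ
        par (port y' root) (port x' root) (port G raw) ::ₘ K.bind frameLink) := by
    refine .tensor_par _ _ _ _ _ _ h1 rfl (C := {cut s(port F greenJ, port G blueCtr)}) ?_
      (tagged_cut rfl rfl hgreen ?_) ?_ ((hK.cons ?_ ?_).cons ?_ ?_)
    · simp only [← Multiset.singleton_add]
      abel
    · simp [tagOf, hFG.symm]
    · exact not_blocked_of_mem (Sym2.mem_mk_left _ _) (by simp)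
    all_goals first | trivial | simp
  have h3 : Chain (Blocked R F G) (tagOf W F G)
      (Multiset.bind (cut s(x, x') ::ₘ cut s(y, y') ::ₘ K) frameLink) (0 + 1 + 1 + 1)
      (tensor (port G outJ) (port G blue) (port G out) ::ₘ
        par (port F green) (port F blueCtr) (port F blue) ::ₘ
        cut s(port G out, port F blue) ::ₘ
        tensor (port F raw) (port F greenJ) (port F green) ::ₘ
        par (port G blueCtr) (port G raw) (port G blue) ::ₘ
        tensor (port x root) (port y root) (port F raw) ::ₘ
        par (port y' root) (port x' root) (port G raw) ::ₘ K.bind frameLink) := by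
    refine .tensor_par _ _ _ _ _ _ h2 rfl (C := {cut s(port G outJ, port F blueCtr)}) ?_
      (tagged_cut rfl rfl hblue ?_) ?_
      ((((hK.cons ?_ ?_).cons ?_ ?_).cons ?_ ?_).cons ?_ ?_)
    · rw [Sym2.eq_swap (a := port G blue)]
      simp only [← Multiset.singleton_add]
      abel
    · simp [tagOf, hFG.symm]
    · exact not_blocked_of_mem (Sym2.mem_mk_left _ _) (by simp)
    all_goals first | trivial | simp
  have hQ : Inert R F G (tensor (port G outJ) (port G blue) (port G out) ::ₘ
        par (port F green) (port F blueCtr) (port F blue) ::ₘ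
        tensor (port F raw) (port F greenJ) (port F green) ::ₘ
        par (port G blueCtr) (port G raw) (port G blue) ::ₘ
        tensor (port x root) (port y root) (port F raw) ::ₘ
        par (port y' root) (port x' root) (port G raw) ::ₘ K.bind frameLink) := by
    refine (((((hK.cons ?_ ?_).cons ?_ ?_).cons ?_ ?_).cons ?_ ?_).cons ?_ ?_).cons ?_ ?_
    all_goals first | trivial | simp
  have h4 := chain_shells (T := Multiset.bind (cut s(x, x') ::ₘ cut s(y, y') ::ₘ K) frameLink)
    (n := 0 + 1 + 1 + 1) (b := port F blue) (b' := port G out) hQ hinF hinG hout (by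
      convert h3 using 1
      rw [Sym2.eq_swap (a := port F blue)]
      simp only [← Multiset.singleton_add]
      abel)
  convert h4 using 1
  simp only [Multiset.cons_bind, frameLink, Sym2.map_mk, Multiset.insert_eq_cons]
  simp only [← Multiset.singleton_add]
  abel

/-- The logical steps that eliminate the cut between the gadgets of two dual literals. -/
theorem chain_axiom_cut {A : α} {p m : ν} {K : Net α ν}
    (hK : Inert R F G (K.bind frameLink))
    (hinF : W.inW F = 0) (hinG : W.inW G = 0) (hout : W.outW F = W.greenW G) :
    Chain (Blocked R F G) (tagOf W F G) (Multiset.bind (ax A p m ::ₘ K) frameLink)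
      (0 + 1 + 1 + 1 + 1)
      (Multiset.bind (ax A p G ::ₘ ax A F m ::ₘ cut s(G, F) ::ₘ K) frameLink) := by
  have hQ : Inert R F G (posFrame p (port p raw) + negFrame m (port m raw) +
      K.bind frameLink) := by
    have : posFrame p (port p raw) + negFrame m (port m raw) + K.bind (frameLink (α := α)) =
      tensor (port p raw) (port p outJ) (port p out) ::ₘ
        par (port p out) (port p inCtr) (port p sync) ::ₘ
        tensor (port p sync) (port p redJ) (port p root) ::ₘ
        par (port m greenCtr) (port m raw) (port m green) ::ₘ
        tensor (port m redJ) (port m green) (port m red) ::ₘ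
        par (port m inCtr) (port m red) (port m root) ::ₘ K.bind frameLink := by
      simp only [posFrame, negFrame, Multiset.insert_eq_cons, ← Multiset.singleton_add]
      abel
    rw [this]
    refine (((((hK.cons ?_ ?_).cons ?_ ?_).cons ?_ ?_).cons ?_ ?_).cons ?_ ?_).cons ?_ ?_
    all_goals first | trivial | simp
  have h1 : Chain (Blocked R F G) (tagOf W F G) (Multiset.bind (ax A p m ::ₘ K) frameLink) (0 + 1)
      (ax A (port p raw) (port G raw) ::ₘ ax A (port F raw) (port m raw) ::ₘ
        cut s(port G raw, port F raw) ::ₘ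
        (posFrame p (port p raw) + negFrame m (port m raw) + K.bind frameLink)) := by
    refine .axiom_cut _ _ _ _ _ .nil rfl ?_
      (not_blocked_of_mem (Sym2.mem_mk_left _ _) (by simp)) hQ
    simp only [Multiset.cons_bind, frameLink, Multiset.insert_eq_cons]
    simp only [← Multiset.singleton_add]
    abel
  have hQ' : Inert R F G (ax A (port p raw) (port G raw) ::ₘ ax A (port F raw) (port m raw) ::ₘ
      (posFrame p (port p raw) + negFrame m (port m raw) + K.bind frameLink)) := by
    refine (hQ.cons ?_ ?_).cons ?_ ?_
    all_goals first | trivial | simp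
  have h4 := chain_shells (T := Multiset.bind (ax A p m ::ₘ K) frameLink)
    (n := 0 + 1) (b := port F raw) (b' := port G raw) hQ' hinF hinG hout (by
      convert h1 using 1
      rw [Sym2.eq_swap (a := port F raw)]
      simp only [← Multiset.singleton_add]
      abel)
  convert h4 using 1
  rw [Sym2.eq_swap (a := G)]
  simp only [Multiset.cons_bind, frameLink, Sym2.map_mk, Multiset.insert_eq_cons]
  simp only [← Multiset.singleton_add]
  abel

end chains

/-! ### The weights of the encoding and the jumps after a step -/

section weights

open JName Port

variable {α : Type u} {ν : Type v} [DecidableEq ν]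

omit [DecidableEq ν] in
theorem exists_intro {R : Net α ν} [Nonempty (Link α ν)] (hR : R.edges.Nodup) :
    ∃ intro : ν → Link α ν, ∀ l ∈ R, ∀ x ∈ l.conclusions, intro x = l := by
  classical
  refine ⟨fun x => if h : ∃ l ∈ R, x ∈ l.conclusions then h.choose else Classical.arbitrary _, ?_⟩
  intro l hl x hx
  have h : ∃ l ∈ R, x ∈ l.conclusions := ⟨l, hl, hx⟩
  simp only [dif_pos h]
  exact eq_of_mem_conclusions hR h.choose_spec.1 hl h.choose_spec.2 hx

omit [DecidableEq ν] in
theorem exists_below {R : Net α ν} (hR : R.premises.Nodup) :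
    ∃ below : ν → ν, ∀ l ∈ R, ∀ x ∈ l.logicalPremises, ∀ z ∈ l.conclusions, below x = z := by
  classical
  refine ⟨fun x => if h : ∃ z, ∃ l ∈ R, x ∈ l.logicalPremises ∧ z ∈ l.conclusions then h.choose
    else x, ?_⟩
  intro l hl x hx z hz
  have h : ∃ z, ∃ l ∈ R, x ∈ l.logicalPremises ∧ z ∈ l.conclusions := ⟨z, l, hl, hx, hz⟩
  simp only [dif_pos h]
  obtain ⟨l', hl', hx', hz'⟩ := h.choose_spec
  have hsub : ∀ k : Link α ν, x ∈ k.logicalPremises → x ∈ k.premises := by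
    intro k hk
    cases k with
    | tensor a b c => exact hk
    | par a b c => exact hk
    | _ => exact absurd hk (Multiset.notMem_zero _)
  have := eq_of_mem_premises hR hl' hl (hsub l' hx') (hsub l hx)
  rw [this] at hz'
  cases l with
  | tensor a b c => exact (Multiset.mem_singleton.1 hz').trans (Multiset.mem_singleton.1 hz).symm
  | par a b c => exact (Multiset.mem_singleton.1 hz').trans (Multiset.mem_singleton.1 hz).symm
  | _ => exact absurd hx (Multiset.notMem_zero _)

/-- Edges into the in-synchronisation points of `F` and `G` are absorbed. -/
def syncWeight (F G e : ν) : Multiset (JName ν) :=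
  if e = F ∨ e = G then 0 else {port e inCtr}

/-- Edges into the blue points of `F` and `G` reach everything in `V`. -/
def blueWeight (F G : ν) (V : Multiset (JName ν)) (e : ν) : Multiset (JName ν) :=
  if e = F ∨ e = G then V else {port e blueCtr}

/-- Edges into the green point of `G` reach everything in `U`. -/
def greenWeight (G : ν) (U : Multiset (JName ν)) (e : ν) : Multiset (JName ν) :=
  if e = G then U else {port e greenCtr}

/-- The weights in the encoding of `R` with the jumps `L`, where `intro e` is the link with
conclusion `e`. The weights of the axioms of the out-synchronisation points are computed from the
other ones, which form the structure `W`. -/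
def cutWeights (R : Net α ν) (L : Multiset (ν × ν)) (intro : ν → Link α ν) (below : ν → ν) (F G : ν)
    (V U : Multiset (JName ν)) : Weights ν :=
  let W : Weights ν := ⟨below, syncWeight F G, blueWeight F G V, greenWeight G U, fun e =>
    match intro e with
    | tensor _ _ _ => blueWeight F G V e
    | _ => greenWeight G U e, 0⟩
  { W with
    outW := fun e => match intro e with
      | ax _ p n => W.inW p + W.inW n + W.greenEdgeW n + W.leave R L p + W.leave R L n
      | tensor _ _ _ => W.inW e + W.leave R L e
      | par _ _ _ => W.greenEdgeW e + W.inW e + W.leave R L e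
      | _ => 0 }

/-- The contractions reached by a jump to `t` in the encoding of a net with logical premises `M`. -/
def targetWeight (F G : ν) (below : ν → ν) (M : Multiset ν) (t : ν) : Multiset (JName ν) :=
  syncWeight F G t + if t ∈ M then {port (below t) blueCtr} else 0

/-- The contractions reached by the jumps from `F` and `G`. -/
def jumpWeight (L : Multiset (ν × ν)) (F G : ν) (below : ν → ν) (M : Multiset ν) :
    Multiset (JName ν) :=
  (L.filter fun q => q.1 = F ∨ q.1 = G).bind fun q => targetWeight F G below M q.2

theorem bind_excludeJumps {F G s : ν} (hF : s ≠ F) (hG : s ≠ G) (M : Multiset (ν × ν))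
    {K : ν → Multiset (JName ν)} (hK : ∀ t, t = F ∨ t = G → K t = 0) :
    ((excludeJumps M F G).filter fun q => q.1 = s).bind (fun q => K q.2) =
      (M.filter fun q => q.1 = s).bind fun q => K q.2 := by
  rw [excludeJumps, Multiset.filter_filter, ← bind_ite, ← bind_ite]
  refine Multiset.bind_congr fun q _ => ?_
  by_cases hq : q.1 = s
  · by_cases ht : q.2 = F ∨ q.2 = G
    · simp [hK q.2 ht]
    · push Not at ht
      simp [hq, hF, hG, ht]
  · simp [hq]

theorem bind_product {s : ν} (A M : Multiset ν) (K : ν → Multiset (JName ν)) :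
    ((A ×ˢ M).filter fun q => q.1 = s).bind (fun q => K q.2) =
      (A.filter fun a => a = s).bind fun _ => M.bind K := by
  rw [← bind_ite, ← bind_ite]
  change (A.bind fun a => M.map (Prod.mk a)).bind _ = _
  rw [Multiset.bind_assoc]
  refine Multiset.bind_congr fun a _ => ?_
  rw [Multiset.bind_map]
  by_cases h : a = s
  · simp [h]
  · simp [h]

theorem map_fst_compJumps (L : Multiset (ν × ν)) (M : Multiset ν) (F : ν) :
    (compJumps L (M.map fun m => (m, F))).map Prod.fst =
      M.bind fun m => (L.filter fun q => q.2 = m).map Prod.fst := by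
  induction M using Multiset.induction_on with
  | empty => simp [compJumps]
  | cons m M ih =>
    rw [Multiset.cons_bind, ← ih]
    simp only [compJumps, Multiset.map_cons, Multiset.product_cons, Multiset.filter_add,
      Multiset.map_add, Multiset.filter_map, Multiset.map_map, Function.comp_def]

theorem bind_sources (L : Multiset (ν × ν)) {M : Multiset ν} (hM : M.Nodup) (s : ν)
    (V : Multiset (JName ν)) :
    ((M.bind fun m => (L.filter fun q => q.2 = m).map Prod.fst).filter fun a => a = s).bind
        (fun _ => V) =
      (L.filter fun q => q.1 = s).bind fun q => if q.2 ∈ M then V else 0 := by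
  rw [bind_ite, ← Multiset.bind_filter_eq hM, Multiset.filter_bind, Multiset.bind_assoc,
    Multiset.bind_assoc]
  refine Multiset.bind_congr fun m _ => ?_
  rw [Multiset.filter_map, Multiset.bind_map, Multiset.filter_filter, Multiset.filter_filter]
  congr 2
  ext q
  exact and_comm

section down

variable {W : Weights ν} {F G : ν} {R R' : Net α ν} {L : Multiset (ν × ν)} {V : Multiset (JName ν)}
  {M X : Multiset ν}

theorem filter_or_of_ne (hFG : F ≠ G) : L.filter (fun q => q.1 = F) + L.filter (fun q => q.1 = G) =
    L.filter fun q => q.1 = F ∨ q.1 = G := by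
  rw [Multiset.filter_add_filter]
  have : L.filter (fun q => q.1 = F ∧ q.1 = G) = 0 := by
    rw [Multiset.filter_eq_nil]
    rintro q - ⟨h1, h2⟩
    exact hFG (h1.symm.trans h2)
  rw [this, add_zero]

theorem ite_logicalPremises (hW : W.blueW = blueWeight F G V)
    (hlp : R.logicalPremises = M + R'.logicalPremises) (hnd : R.logicalPremises.Nodup)
    (hM : ∀ t ∈ M, W.below t = F ∨ W.below t = G) (t : ν) :
    (if t ∈ R.logicalPremises then W.blueW (W.below t) else 0) =
      (if t ∈ M then V else 0) +
        if t ∈ R'.logicalPremises then W.blueW (W.below t) else 0 := by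
  rw [hlp] at hnd ⊢
  by_cases h : t ∈ M
  · have h' : t ∉ R'.logicalPremises := Multiset.disjoint_left.1 (Multiset.nodup_add.1 hnd).2.2 h
    simp [h, h', hW, blueWeight, hM t h]
  · simp [h]

/-- The effect of the elimination on the paths from the out-synchronisation point of `s`. Here `M`
consists of the premises of the links introducing `F` and `G`; the jumps `(m, F)` and `(m, G)` with
`m ∈ M`, and the axiom jumps, start in `X`. -/
theorem leave_downJumps (hFG : F ≠ G) (hin : W.inW = syncWeight F G)
    (hblue : W.blueW = blueWeight F G V)
    (hlp : R.logicalPremises = M + R'.logicalPremises) (hnd : R.logicalPremises.Nodup)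
    (hM : ∀ t ∈ M, W.below t = F ∨ W.below t = G)
    (hM' : ∀ t ∈ R'.logicalPremises, ¬ (W.below t = F ∨ W.below t = G))
    (hF : F ∉ R'.logicalPremises) (hG : G ∉ R'.logicalPremises)
    (hV : V = jumpWeight L F G W.below R'.logicalPremises)
    (hX : (propJumps R L F + propJumps R L G).map Prod.fst =
      X + M.bind fun m => (L.filter fun q => q.2 = m).map Prod.fst)
    {s : ν} (hsF : s ≠ F) (hsG : s ≠ G) :
    W.leave R' (downJumps R L F G) s + (if s ∈ M then V else 0) =
      W.leave R L s + (X.filter fun a => a = s).bind fun _ => V := by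
  have hMn : M.Nodup := by
    rw [hlp] at hnd
    exact (Multiset.nodup_add.1 hnd).1
  obtain ⟨K, hK⟩ : ∃ K : ν → Multiset (JName ν), K = fun t =>
    W.inW t + if t ∈ R'.logicalPremises then W.blueW (W.below t) else 0 := ⟨_, rfl⟩
  have hK' : K = targetWeight F G W.below R'.logicalPremises := by
    funext t
    rw [hK, targetWeight, hin]
    by_cases h : t ∈ R'.logicalPremises
    · simp [h, hblue, blueWeight, hM' t h]
    · simp [h]
  have hK0 : ∀ t, t = F ∨ t = G → K t = 0 := by
    intro t ht
    have h : t ∉ R'.logicalPremises := by rcases ht with rfl | rfl <;> assumption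
    simp [hK', targetWeight, syncWeight, ht, h]
  have e1 : W.leave R' (downJumps R L F G) s =
      (if s ∈ R'.logicalPremises then W.blueW (W.below s) else 0) +
      ((L.filter fun q => q.1 = s).bind (fun q => K q.2) +
        ((X.filter fun a => a = s).bind (fun _ => V) +
          (L.filter fun q => q.1 = s).bind fun q => if q.2 ∈ M then V else 0)) := by
    have hV' : (Multiset.map Prod.snd (L.filter (fun q => q.1 = F) +
        L.filter (fun q => q.1 = G))).bind K = V := by
      rw [filter_or_of_ne hFG, Multiset.bind_map, hV, jumpWeight, hK']
    rw [Weights.leave, downJumps, Multiset.filter_add, Multiset.add_bind]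
    congr 1
    have a1 := bind_excludeJumps hsF hsG L hK0
    have a2 := bind_excludeJumps hsF hsG (createdJumps R L F G) hK0
    rw [hK] at a1 a2
    rw [a1, a2, hK]
    congr 1
    have a3 := bind_product (s := s) ((propJumps R L F + propJumps R L G).map Prod.fst)
      (Multiset.map Prod.snd (L.filter (fun q => q.1 = F) + L.filter (fun q => q.1 = G))) K
    rw [hV', hX, Multiset.filter_add, Multiset.add_bind, bind_sources L hMn, ← hX] at a3
    rw [← a3, hK]
    rfl
  have e2 : W.leave R L s = ((if s ∈ M then V else 0) +
      if s ∈ R'.logicalPremises then W.blueW (W.below s) else 0) +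
      ((L.filter fun q => q.1 = s).bind (fun q => K q.2) +
        (L.filter fun q => q.1 = s).bind fun q => if q.2 ∈ M then V else 0) := by
    rw [Weights.leave, ite_logicalPremises hblue hlp hnd hM, ← Multiset.bind_add]
    congr 1
    refine Multiset.bind_congr fun q _ => ?_
    rw [ite_logicalPremises hblue hlp hnd hM, hK]
    rw [add_left_comm]
    exact add_comm _ _
  rw [e1, e2]
  abel

/-- The contractions reached from `F` and `G` are those reached by the jumps from `F` and `G`. -/
theorem leave_add_leave (hFG : F ≠ G) (hin : W.inW = syncWeight F G)
    (hblue : W.blueW = blueWeight F G V)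
    (hlp : R.logicalPremises = M + R'.logicalPremises)
    (hM' : ∀ t ∈ R'.logicalPremises, ¬ (W.below t = F ∨ W.below t = G))
    (hF : F ∉ R.logicalPremises) (hG : G ∉ R.logicalPremises)
    (hprem : ∀ q ∈ L, q.1 = F ∨ q.1 = G → q.2 ∉ M) :
    W.leave R L F + W.leave R L G = jumpWeight L F G W.below R'.logicalPremises := by
  rw [Weights.leave, Weights.leave, if_neg hF, if_neg hG, zero_add, zero_add, jumpWeight,
    ← Multiset.add_bind, filter_or_of_ne hFG]
  refine Multiset.bind_congr fun q hq => ?_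
  have h1 := hprem q (Multiset.mem_filter.1 hq).1 (Multiset.mem_filter.1 hq).2
  rw [targetWeight, hin, hlp]
  by_cases h : q.2 ∈ R'.logicalPremises
  · simp [h, hblue, blueWeight, hM' q.2 h]
  · simp [h, h1]

end down

end weights

/-! ### Weights that fit the encodings before and after a step -/

section fits

open JName Port

variable {α : Type u} {ν : Type v} [DecidableEq ν]

/-- `F` is not a negative conclusion of the link, `G` is not a positive one, and the link is not an
axiom with conclusions `F` and `G`. -/
def Polarized (F G : ν) : Link α ν → Prop
  | ax _ p n => p ≠ G ∧ n ≠ F ∧ (p = F → n ≠ G)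
  | tensor _ _ z => z ≠ G
  | par _ _ z => z ≠ F
  | _ => True

variable {R S : Net α ν} {L L' : Multiset (ν × ν)} {intro : ν → Link α ν} {below : ν → ν} {F G : ν}
  {V U : Multiset (JName ν)}

omit [DecidableEq ν] in
theorem polarized_of_ne {l : Link α ν} (h : ∀ z ∈ l.conclusions, z ≠ F ∧ z ≠ G) :
    Polarized F G l := by
  cases l with
  | ax A p n =>
    exact ⟨(h p (by simp [conclusions])).2, (h n (by simp [conclusions])).1,
      fun hp => ((h p (by simp [conclusions])).1 hp).elim⟩
  | tensor x y z => exact (h z (by simp [conclusions])).2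
  | par x y z => exact (h z (by simp [conclusions])).1
  | _ => trivial

omit [DecidableEq ν] in
theorem acyclic_of_ne {W : Weights ν} {s j : ν} (h : j ≠ F ∧ j ≠ G) : Acyclic W F G S L' s j :=
  fun hj => (hj.elim h.1 h.2).elim

theorem cutWeights_ax {A : α} {p n : ν} (hp : intro p = ax A p n) (hn : intro n = ax A p n) :
    (cutWeights R L intro below F G V U).outW p = syncWeight F G p + syncWeight F G n +
      greenWeight G U n + (cutWeights R L intro below F G V U).leave R L p +
      (cutWeights R L intro below F G V U).leave R L n ∧
    (cutWeights R L intro below F G V U).greenEdgeW n = greenWeight G U n := by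
  refine ⟨?_, ?_⟩
  · simp only [cutWeights, hp, hn]
    rfl
  · simp only [cutWeights, hn]

theorem cutWeights_tensor {x y z : ν} (hz : intro z = tensor x y z) :
    (cutWeights R L intro below F G V U).outW z = syncWeight F G z +
      (cutWeights R L intro below F G V U).leave R L z ∧
    (cutWeights R L intro below F G V U).greenEdgeW z = blueWeight F G V z := by
  refine ⟨?_, ?_⟩
  · simp only [cutWeights, hz]
    rfl
  · simp only [cutWeights, hz]

theorem cutWeights_par {x y z : ν} (hz : intro z = par x y z) :
    (cutWeights R L intro below F G V U).outW z = greenWeight G U z + syncWeight F G z +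
      (cutWeights R L intro below F G V U).leave R L z ∧
    (cutWeights R L intro below F G V U).greenEdgeW z = greenWeight G U z := by
  refine ⟨?_, ?_⟩
  · simp only [cutWeights, hz]
    rfl
  · simp only [cutWeights, hz]

/-- The weights fit a link of `R`, also in the encoding of another net, if the paths from its
conclusions are the same. -/
theorem fits_cutWeights {l : Link α ν} (hintro : ∀ x ∈ l.conclusions, intro x = l)
    (hbelow : ∀ x ∈ l.logicalPremises, ∀ z ∈ l.conclusions, below x = z)
    (hleave : ∀ s ∈ l.conclusions, (cutWeights R L intro below F G V U).leave S L' s =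
      (cutWeights R L intro below F G V U).leave R L s)
    (hpol : Polarized F G l) (hac : ∀ s ∈ l.conclusions, ∀ j ∈ l.conclusions,
      Acyclic (cutWeights R L intro below F G V U) F G S L' s j) :
    Fits (cutWeights R L intro below F G V U) F G S L' l := by
  cases l with
  | ax A p n =>
    have hp : p ∈ conclusions (ax A p n) := by simp [conclusions]
    have hn : n ∈ conclusions (ax A p n) := by simp [conclusions]
    have h := cutWeights_ax (R := R) (L := L) (below := below) (F := F) (G := G) (V := V) (U := U)
      (hintro p hp) (hintro n hn)
    refine ⟨?_, h.2, hpol.1, hpol.2.1, hpol.2.2, hac p hp p hp, hac n hn p hp⟩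
    rw [hleave p hp, hleave n hn, h.2]
    exact h.1
  | tensor x y z =>
    have hz : z ∈ conclusions (tensor x y z : Link α ν) := by simp [conclusions]
    have h := cutWeights_tensor (R := R) (L := L) (below := below) (F := F) (G := G) (V := V)
      (U := U) (hintro z hz)
    refine ⟨?_, h.2, hbelow x (by simp [logicalPremises]) z hz,
      hbelow y (by simp [logicalPremises]) z hz, hpol, hac z hz z hz⟩
    rw [hleave z hz]
    exact h.1
  | par x y z =>
    have hz : z ∈ conclusions (par x y z : Link α ν) := by simp [conclusions]
    have h := cutWeights_par (R := R) (L := L) (below := below) (F := F) (G := G) (V := V)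
      (U := U) (hintro z hz)
    refine ⟨?_, h.2, hbelow x (by simp [logicalPremises]) z hz,
      hbelow y (by simp [logicalPremises]) z hz, hpol, hac z hz z hz⟩
    rw [hleave z hz, h.2]
    exact h.1
  | cut e => trivial
  | jax j O => trivial
  | jctr I c => trivial

omit [DecidableEq ν] in
/-- No path leads from the out-synchronisation point of an edge `s` to the blue points of `F`
and `G`. -/
theorem acyclic_cut {W : Weights ν} {R' : Net α ν} {M : Multiset ν}
    (hlp : R.logicalPremises = M + R'.logicalPremises)
    (hM' : ∀ t ∈ R'.logicalPremises, ¬ (W.below t = F ∨ W.below t = G)) {s j : ν}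
    (hs : s ∉ M) (hprem : ∀ q ∈ L, q.1 = s → q.2 ∉ M) :
    Acyclic W F G R L s j := by
  have key : ∀ t ∈ R.logicalPremises, t ∉ M → ¬ (W.below t = F ∨ W.below t = G) := by
    intro t ht htM
    rw [hlp] at ht
    exact hM' t ((Multiset.mem_add.1 ht).resolve_left htM)
  exact fun _ => ⟨fun h => key s h hs, fun q hq hqs h => key _ h (hprem q hq hqs)⟩

theorem premiseJumps_eq_zero {Q : Net α ν} (h : F ∉ Q.edges) : premiseJumps Q F = 0 := by
  rw [premiseJumps, Multiset.eq_zero_iff_forall_notMem]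
  intro q hq
  obtain ⟨l, hl, hq⟩ := Multiset.mem_bind.1 hq
  have h' : F ∉ l.conclusions := fun hF => h (Net.mem_edges.2 ⟨l, hl, hF⟩)
  cases l with
  | tensor x y z =>
    have : z ≠ F := fun e => h' (by simp [conclusions, e])
    simp [this] at hq
  | par x y z =>
    have : z ≠ F := fun e => h' (by simp [conclusions, e])
    simp [this] at hq
  | _ => exact absurd hq (Multiset.notMem_zero _)

theorem axiomJumps_eq_zero {Q : Net α ν} (h : F ∉ Q.edges) : axiomJumps Q F = 0 := by
  rw [axiomJumps, Multiset.eq_zero_iff_forall_notMem]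
  intro q hq
  obtain ⟨l, hl, hq⟩ := Multiset.mem_bind.1 hq
  have h' : F ∉ l.conclusions := fun hF => h (Net.mem_edges.2 ⟨l, hl, hF⟩)
  cases l with
  | ax A p n =>
    have h1 : F ≠ p := fun e => h' (by simp [conclusions, e])
    have h2 : F ≠ n := fun e => h' (by simp [conclusions, e])
    simp [h1, h2] at hq
  | _ => exact absurd hq (Multiset.notMem_zero _)

theorem premiseJumps_cons (l : Link α ν) (Q : Net α ν) :
    premiseJumps (l ::ₘ Q) F = premiseJumps {l} F + premiseJumps Q F := by
  rw [← Multiset.singleton_add, premiseJumps, Multiset.add_bind]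
  rfl

theorem axiomJumps_cons (l : Link α ν) (Q : Net α ν) :
    axiomJumps (l ::ₘ Q) F = axiomJumps {l} F + axiomJumps Q F := by
  rw [← Multiset.singleton_add, axiomJumps, Multiset.add_bind]
  rfl

theorem map_fst_propJumps {M : Multiset ν} (h : premiseJumps R F = M.map fun m => (m, F)) :
    (propJumps R L F).map Prod.fst = M + (axiomJumps R F).map Prod.fst +
      M.bind fun m => (L.filter fun q => q.2 = m).map Prod.fst := by
  rw [propJumps, ruleJumps, h, Multiset.map_add, Multiset.map_add, map_fst_compJumps,
    Multiset.map_map]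
  simp

theorem mem_downJumps {X M : Multiset ν} (hL : ∀ q ∈ L, q.1 ∈ R.edges ∧ q.2 ∈ R.edges)
    (hX : (propJumps R L F + propJumps R L G).map Prod.fst =
      X + M.bind fun m => (L.filter fun q => q.2 = m).map Prod.fst)
    (hXR : ∀ a ∈ X, a ∈ R.edges) {q : ν × ν} (hq : q ∈ downJumps R L F G) :
    (q.1 ∈ R.edges ∧ q.1 ≠ F ∧ q.1 ≠ G) ∧ q.2 ∈ R.edges ∧ q.2 ≠ F ∧ q.2 ≠ G := by
  have key : (q.1 ∈ R.edges ∧ q.2 ∈ R.edges) ∧ q.1 ≠ F ∧ q.1 ≠ G ∧ q.2 ≠ F ∧ q.2 ≠ G := by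
    rw [downJumps, excludeJumps, excludeJumps, Multiset.mem_add, Multiset.mem_filter,
      Multiset.mem_filter] at hq
    rcases hq with ⟨hq, h⟩ | ⟨hq, h⟩
    · exact ⟨hL q hq, h⟩
    · refine ⟨?_, h⟩
      rw [createdJumps, expJumps, Multiset.mem_product, hX] at hq
      obtain ⟨h1, h2⟩ := hq
      constructor
      · rcases Multiset.mem_add.1 h1 with h1 | h1
        · exact hXR _ h1
        · obtain ⟨m, -, h1⟩ := Multiset.mem_bind.1 h1
          obtain ⟨r, hr, hr'⟩ := Multiset.mem_map.1 h1
          rw [← hr']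
          exact (hL r (Multiset.mem_filter.1 hr).1).1
      · obtain ⟨r, hr, hr'⟩ := Multiset.mem_map.1 h2
        rw [← hr']
        rcases Multiset.mem_add.1 hr with hr | hr <;>
          exact (hL r (Multiset.mem_filter.1 hr).1).2
  exact ⟨⟨key.1.1, key.2.1, key.2.2.1⟩, key.1.2, key.2.2.2⟩

theorem bind_filter_eq_ite {M : Multiset ν} (hM : M.Nodup) (s : ν) (V : Multiset (JName ν)) :
    (M.filter fun a => a = s).bind (fun _ => V) = if s ∈ M then V else 0 := by
  rw [Multiset.filter_eq', Multiset.count_eq_of_nodup hM]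
  split_ifs <;> simp

theorem downJumps_comm : downJumps R L F G = downJumps R L G F := by
  have h : ∀ M : Multiset (ν × ν), excludeJumps M F G = excludeJumps M G F := by
    intro M
    refine Multiset.filter_congr fun q _ => ?_
    tauto
  rw [downJumps, downJumps, h, h, createdJumps, createdJumps, add_comm (propJumps R L F),
    add_comm (L.filter _)]

omit [DecidableEq ν] in
theorem isGadgetElimination_comm {S T : Net α (JName ν)} :
    IsGadgetElimination R F G S T ↔ IsGadgetElimination R G F S T := by
  have h : GadgetStep R F G = GadgetStep R G F := by
    funext S S'
    rw [GadgetStep, GadgetStep, Sym2.eq_swap (a := F)]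
  rw [IsGadgetElimination, IsGadgetElimination, h]

end fits

/-! ### The elimination of the cuts between two gadgets -/

section elimination

open JName Port

variable {α : Type u} {ν : Type v} [DecidableEq ν]

omit [DecidableEq ν] in
theorem Net.IsMLLProofStructure.exists_flow {R : Net α ν} (hR : R.IsMLLProofStructure) :
    ∃ D, R.edges = R.premises + D :=
  Multiset.le_iff_exists_add.1 ((Multiset.le_iff_subset hR.premises_nodup).2 hR.premises_mem)

omit [DecidableEq ν] in
theorem below_ne {R : Net α ν} {F G : ν} {below : ν → ν} (hF : F ∉ R.edges) (hG : G ∉ R.edges)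
    (hbelow : ∀ l ∈ R, ∀ x ∈ l.logicalPremises, ∀ z ∈ l.conclusions, below x = z) :
    ∀ t ∈ R.logicalPremises, ¬ (below t = F ∨ below t = G) := by
  intro t ht
  obtain ⟨l, hl, ht⟩ := Multiset.mem_bind.1 ht
  obtain ⟨z, hz⟩ : ∃ z, z ∈ l.conclusions := by
    cases l with
    | tensor x y z => exact ⟨z, by simp [conclusions]⟩
    | par x y z => exact ⟨z, by simp [conclusions]⟩
    | _ => exact absurd ht (Multiset.notMem_zero _)
  have hz' : z ∈ R.edges := Net.mem_edges.2 ⟨l, hl, hz⟩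
  rw [hbelow l hl t ht z hz]
  rintro (rfl | rfl)
  · exact hF hz'
  · exact hG hz'

/-- The elimination for a cut between the conclusions of a tensor and of a par. -/
theorem elimination_tensor_par {x y F x' y' G : ν} {Q : Net α ν} {L : Multiset (ν × ν)}
    (hR : Net.IsMLLProofStructure (tensor x y F ::ₘ par y' x' G ::ₘ cut s(F, G) ::ₘ Q))
    (hL : ∀ q ∈ L, q.1 ∈ Net.edges (tensor x y F ::ₘ par y' x' G ::ₘ cut s(F, G) ::ₘ Q) ∧
      q.2 ∈ Net.edges (tensor x y F ::ₘ par y' x' G ::ₘ cut s(F, G) ::ₘ Q))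
    (hprem : ∀ q ∈ L, q.1 = F ∨ q.1 = G →
      (q.2, F) ∉ premiseJumps (tensor x y F ::ₘ par y' x' G ::ₘ cut s(F, G) ::ₘ Q) F ∧
      (q.2, G) ∉ premiseJumps (tensor x y F ::ₘ par y' x' G ::ₘ cut s(F, G) ::ₘ Q) G) :
    (∃ S, IsGadgetElimination (tensor x y F ::ₘ par y' x' G ::ₘ cut s(F, G) ::ₘ Q) F G
      (encode (tensor x y F ::ₘ par y' x' G ::ₘ cut s(F, G) ::ₘ Q) L) S) ∧
    ∀ S, IsGadgetElimination (tensor x y F ::ₘ par y' x' G ::ₘ cut s(F, G) ::ₘ Q) F G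
        (encode (tensor x y F ::ₘ par y' x' G ::ₘ cut s(F, G) ::ₘ Q) L) S →
      Net.SameUpTo {e | ∃ a ∈ Net.edges (cut s(x, x') ::ₘ cut s(y, y') ::ₘ Q), e = port a root} S
        (encode (cut s(x, x') ::ₘ cut s(y, y') ::ₘ Q)
          (downJumps (tensor x y F ::ₘ par y' x' G ::ₘ cut s(F, G) ::ₘ Q) L F G)) := by
  obtain ⟨R, hRe⟩ : ∃ R : Net α ν, R = tensor x y F ::ₘ par y' x' G ::ₘ cut s(F, G) ::ₘ Q :=
    ⟨_, rfl⟩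
  obtain ⟨R', hRe'⟩ : ∃ R' : Net α ν, R' = cut s(x, x') ::ₘ cut s(y, y') ::ₘ Q := ⟨_, rfl⟩
  have hstep : Step (some s(F, G)) R R' := by
    rw [hRe, hRe']
    exact .tensor_par ..
  rw [← hRe] at hR hL hprem ⊢
  rw [← hRe']
  have hE : R.edges = F ::ₘ G ::ₘ Q.edges := by
    rw [hRe]
    simp only [Net.edges_cons, conclusions, Multiset.singleton_add, zero_add]
  have hE' : R'.edges = Q.edges := by
    rw [hRe']
    simp only [Net.edges_cons, conclusions, zero_add]
  obtain ⟨M, hMe⟩ : ∃ M : Multiset ν, M = {x, y} + {y', x'} := ⟨_, rfl⟩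
  have hP : R.premises = M + ({F, G} + Q.premises) := by
    rw [hRe, hMe]
    simp only [Net.premises_cons, premises, Sym2.toMultiset_mk', add_assoc]
  have hlpQ : R'.logicalPremises = Q.logicalPremises := by
    rw [hRe']
    simp [Net.logicalPremises, logicalPremises]
  have hlp : R.logicalPremises = M + R'.logicalPremises := by
    rw [hlpQ, hRe, hMe]
    simp only [Net.logicalPremises, Multiset.cons_bind, logicalPremises, zero_add, add_assoc]
  have hnE : (F ::ₘ G ::ₘ Q.edges).Nodup := hE ▸ hR.edges_nodup
  have hnP : (M + ({F, G} + Q.premises)).Nodup := hP ▸ hR.premises_nodup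
  obtain ⟨hF, hnE⟩ := Multiset.nodup_cons.1 hnE
  have hGQ : G ∉ Q.edges := (Multiset.nodup_cons.1 hnE).1
  have hFG : F ≠ G := fun h => hF (h ▸ Multiset.mem_cons_self _ _)
  have hFQ : F ∉ Q.edges := fun h => hF (Multiset.mem_cons_of_mem h)
  obtain ⟨hMn, hnP', hdis⟩ := Multiset.nodup_add.1 hnP
  have hdis' := (Multiset.nodup_add.1 hnP').2.2
  have hFM : F ∉ M := fun h => Multiset.disjoint_left.1 hdis h (by simp)
  have hGM : G ∉ M := fun h => Multiset.disjoint_left.1 hdis h (by simp)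
  have hFP : F ∉ Q.premises := fun h => Multiset.disjoint_left.1 hdis' (by simp) h
  have hGP : G ∉ Q.premises := fun h => Multiset.disjoint_left.1 hdis' (by simp) h
  have hlpP : ∀ t ∈ R'.logicalPremises, t ∈ Q.premises := fun t ht =>
    Multiset.mem_of_le Q.logicalPremises_le (hlpQ ▸ ht)
  have hFlp' : F ∉ R'.logicalPremises := fun h => hFP (hlpP F h)
  have hGlp' : G ∉ R'.logicalPremises := fun h => hGP (hlpP G h)
  have hFlp : F ∉ R.logicalPremises := by
    rw [hlp]
    exact fun h => (Multiset.mem_add.1 h).elim hFM hFlp'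
  have hGlp : G ∉ R.logicalPremises := by
    rw [hlp]
    exact fun h => (Multiset.mem_add.1 h).elim hGM hGlp'
  have hQR : ∀ l ∈ Q, l ∈ R := fun l hl => by simp [hRe, hl]
  have hJF : premiseJumps R F = ({x, y} : Multiset ν).map fun m => (m, F) := by
    rw [hRe, premiseJumps_cons, premiseJumps_cons, premiseJumps_cons, premiseJumps_eq_zero hFQ]
    simp [premiseJumps, hFG.symm]
  have hJG : premiseJumps R G = ({y', x'} : Multiset ν).map fun m => (m, G) := by
    rw [hRe, premiseJumps_cons, premiseJumps_cons, premiseJumps_cons, premiseJumps_eq_zero hGQ]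
    simp [premiseJumps, hFG]
  have hAF : axiomJumps R F = 0 := by
    rw [hRe, axiomJumps_cons, axiomJumps_cons, axiomJumps_cons, axiomJumps_eq_zero hFQ]
    rfl
  have hAG : axiomJumps R G = 0 := by
    rw [hRe, axiomJumps_cons, axiomJumps_cons, axiomJumps_cons, axiomJumps_eq_zero hGQ]
    rfl
  have hX : (propJumps R L F + propJumps R L G).map Prod.fst =
      M + M.bind fun m => (L.filter fun q => q.2 = m).map Prod.fst := by
    rw [Multiset.map_add, map_fst_propJumps hJF, map_fst_propJumps hJG, hAF, hAG, hMe,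
      Multiset.add_bind]
    simp only [Multiset.map_zero, add_zero]
    exact add_add_add_comm _ _ _ _
  have hpM : ∀ q ∈ L, q.1 = F ∨ q.1 = G → q.2 ∉ M := by
    intro q hq hq1 hM
    obtain ⟨h1, h2⟩ := hprem q hq hq1
    rw [hJF] at h1
    rw [hJG] at h2
    rw [hMe] at hM
    rcases Multiset.mem_add.1 hM with hM | hM
    · exact h1 (Multiset.mem_map_of_mem _ hM)
    · exact h2 (Multiset.mem_map_of_mem _ hM)
  have : Nonempty (Link α ν) := ⟨cut s(F, G)⟩
  obtain ⟨intro, hintro⟩ := exists_intro hR.edges_nodup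
  obtain ⟨below, hbelow⟩ := exists_below (R := R) hR.premises_nodup
  have hlt : tensor x y F ∈ R := by simp [hRe]
  have hlp' : par y' x' G ∈ R := by simp [hRe]
  have hiF : intro F = tensor x y F := hintro _ hlt F (by simp [conclusions])
  have hiG : intro G = par y' x' G := hintro _ hlp' G (by simp [conclusions])
  have hM : ∀ t ∈ M, below t = F ∨ below t = G := by
    intro t ht
    rw [hMe] at ht
    rcases Multiset.mem_add.1 ht with ht | ht
    · exact Or.inl (hbelow _ hlt t ht F (by simp [conclusions]))
    · exact Or.inr (hbelow _ hlp' t ht G (by simp [conclusions]))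
  have hM' : ∀ t ∈ R'.logicalPremises, ¬ (below t = F ∨ below t = G) := by
    rw [hlpQ]
    exact below_ne hFQ hGQ fun l hl => hbelow l (hQR l hl)
  -- `V` is what leaves the out-synchronisation points of `F` and `G` together, and `U` is the part
  -- of `F`; the green axiom of `F` transmits `V` and the green contraction of `G` receives `U`.
  obtain ⟨V, hV⟩ : ∃ V, V = jumpWeight L F G below R'.logicalPremises := ⟨_, rfl⟩
  obtain ⟨U, hU⟩ : ∃ U, U = (cutWeights R L intro below F G V 0).leave R L F := ⟨_, rfl⟩
  obtain ⟨W, hW⟩ : ∃ W, W = cutWeights R L intro below F G V U := ⟨_, rfl⟩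
  have hWin : W.inW = syncWeight F G := by rw [hW]; rfl
  have hWblue : W.blueW = blueWeight F G V := by rw [hW]; rfl
  have hWgreen : W.greenW = greenWeight G U := by rw [hW]; rfl
  have hWbelow : W.below = below := by rw [hW]; rfl
  have hleaveF : W.leave R L F = U := by rw [hW, hU]; rfl
  have hleave : W.leave R L F + W.leave R L G = V := by
    rw [hV, ← hWbelow]
    exact leave_add_leave hFG hWin hWblue hlp (hWbelow ▸ hM') hFlp hGlp hpM
  have hdown : ∀ s, s ≠ F → s ≠ G → W.leave R' (downJumps R L F G) s = W.leave R L s := by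
    intro s hsF hsG
    have h := leave_downJumps hFG hWin hWblue hlp
      (Multiset.nodup_of_le R.logicalPremises_le hR.premises_nodup) (hWbelow ▸ hM)
      (hWbelow ▸ hM') hFlp' hGlp' (hWbelow ▸ hV) hX hsF hsG
    rw [bind_filter_eq_ite hMn] at h
    exact add_right_cancel h
  have hne : ∀ l ∈ Q, ∀ z ∈ l.conclusions, z ≠ F ∧ z ≠ G := by
    intro l hl z hz
    have hz' : z ∈ Q.edges := Net.mem_edges.2 ⟨l, hl, hz⟩
    exact ⟨fun h => hFQ (h ▸ hz'), fun h => hGQ (h ▸ hz')⟩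
  have hedges : ∀ e, e ∈ R'.edges ↔ e ∈ R.edges ∧ e ≠ F ∧ e ≠ G := by
    intro e
    rw [hE, hE', Multiset.mem_cons, Multiset.mem_cons]
    constructor
    · exact fun h => ⟨Or.inr (Or.inr h), fun e => hFQ (e ▸ h), fun e => hGQ (e ▸ h)⟩
    · rintro ⟨h, h1, h2⟩
      exact (h.resolve_left h1).resolve_left h2
  obtain ⟨D, hD⟩ := hR.exists_flow
  have hMR : ∀ a ∈ M, a ∈ R.edges := fun a ha => by
    rw [hD, hP]
    exact Multiset.mem_add.2 (Or.inl (Multiset.mem_add.2 (Or.inl ha)))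
  have hfitQ : ∀ l ∈ Q, Fits W F G R L l := by
    intro l hl
    rw [hW]
    exact fits_cutWeights (hintro l (hQR l hl)) (hbelow l (hQR l hl)) (fun _ _ => rfl)
      (polarized_of_ne (hne l hl)) fun s _ j hj => acyclic_of_ne (hne l hl j hj)
  have hfitQ' : ∀ l ∈ Q, Fits W F G R' (downJumps R L F G) l := by
    intro l hl
    rw [hW]
    exact fits_cutWeights (hintro l (hQR l hl)) (hbelow l (hQR l hl))
      (fun s hs => hW ▸ hdown s (hne l hl s hs).1 (hne l hl s hs).2)
      (polarized_of_ne (hne l hl)) fun s _ j hj => acyclic_of_ne (hne l hl j hj)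
  have hfit : ∀ l ∈ R, Fits W F G R L l := by
    intro l hl
    rw [hRe, Multiset.mem_cons, Multiset.mem_cons, Multiset.mem_cons] at hl
    rcases hl with rfl | rfl | rfl | hl
    · rw [hW]
      refine fits_cutWeights (hintro _ hlt) (hbelow _ hlt) (fun _ _ => rfl) hFG ?_
      intro s hs j _
      rw [Multiset.mem_singleton.1 hs]
      exact acyclic_cut hlp hM' hFM fun q hq h => hpM q hq (Or.inl h)
    · rw [hW]
      refine fits_cutWeights (hintro _ hlp') (hbelow _ hlp') (fun _ _ => rfl) hFG.symm ?_
      intro s hs j _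
      rw [Multiset.mem_singleton.1 hs]
      exact acyclic_cut hlp hM' hGM fun q hq h => hpM q hq (Or.inr h)
    · trivial
    · exact hfitQ l hl
  have hfit' : ∀ l ∈ R', Fits W F G R' (downJumps R L F G) l := by
    intro l hl
    rw [hRe', Multiset.mem_cons, Multiset.mem_cons] at hl
    rcases hl with rfl | rfl | hl
    · trivial
    · trivial
    · exact hfitQ' l hl
  have hWF := cutWeights_tensor (R := R) (L := L) (below := below) (F := F) (G := G) (V := V)
    (U := U) hiF
  have hWG := cutWeights_par (R := R) (L := L) (below := below) (F := F) (G := G) (V := V)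
    (U := U) hiG
  rw [← hW] at hWF hWG
  have hsF : syncWeight F G F = 0 := if_pos (Or.inl rfl)
  have hsG : syncWeight F G G = 0 := if_pos (Or.inr rfl)
  have hbF : blueWeight F G V F = V := if_pos (Or.inl rfl)
  have hbG : blueWeight F G V G = V := if_pos (Or.inr rfl)
  have hgG : greenWeight G U G = U := if_pos rfl
  have hQ : ∀ a ∈ Q.premises, a ∈ R.edges ∧ a ≠ F ∧ a ≠ G := by
    intro a ha
    refine ⟨?_, fun h => hFP (h ▸ ha), fun h => hGP (h ▸ ha)⟩
    rw [hD, hP]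
    simp [ha]
  refine gadget_elimination hR.edges_nodup hD hR.isMLL hL hfit (hstep.nodup_edges hR.edges_nodup)
    (hstep.edges_eq hD) ?_ ?_ hfit' (n := 0 + 1 + 1 + 1 + 1 + 1 + 1) ?_ hedges ?_ ?_ ?_
  · intro l hl
    rw [hRe', Multiset.mem_cons, Multiset.mem_cons] at hl
    rcases hl with rfl | rfl | hl
    · trivial
    · trivial
    · exact hR.isMLL l (hQR l hl)
  · intro q hq
    obtain ⟨h1, h2⟩ := mem_downJumps hL hX hMR hq
    exact ⟨(hedges _).2 h1, (hedges _).2 h2⟩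
  · have h := chain_tensor_par (R := R) (W := W) (x := x) (y := y) (x' := x') (y' := y') hFG
      (blocked_frame hQ) (by rw [hWin, hsF]) (by rw [hWin, hsG])
      (by rw [hWF.1, hWgreen, hgG, hsF, zero_add, hleaveF])
      (by rw [hWblue, hbF, hWG.1, hgG, hsG, add_zero, ← hleaveF, hleave])
      (by rw [hWblue, hbG, hWF.2, hbF])
    rw [← hRe, ← hRe'] at h
    exact h
  · intro e he
    obtain ⟨-, h1, h2⟩ := (hedges e).1 he
    rw [hWin]
    exact if_neg (not_or.2 ⟨h1, h2⟩)
  · intro e he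
    obtain ⟨-, h1, h2⟩ := (hedges e).1 he
    rw [hWblue]
    exact if_neg (not_or.2 ⟨h1, h2⟩)
  · intro e he
    rw [hWgreen]
    exact if_neg ((hedges e).1 he).2.2

/-- The elimination for a cut between the conclusions of two axioms. -/
theorem elimination_axiom_cut {A : α} {p G F m : ν} {Q : Net α ν} {L : Multiset (ν × ν)}
    (hR : Net.IsMLLProofStructure (ax A p G ::ₘ ax A F m ::ₘ cut s(G, F) ::ₘ Q))
    (hL : ∀ q ∈ L, q.1 ∈ Net.edges (ax A p G ::ₘ ax A F m ::ₘ cut s(G, F) ::ₘ Q) ∧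
      q.2 ∈ Net.edges (ax A p G ::ₘ ax A F m ::ₘ cut s(G, F) ::ₘ Q)) :
    (∃ S, IsGadgetElimination (ax A p G ::ₘ ax A F m ::ₘ cut s(G, F) ::ₘ Q) F G
      (encode (ax A p G ::ₘ ax A F m ::ₘ cut s(G, F) ::ₘ Q) L) S) ∧
    ∀ S, IsGadgetElimination (ax A p G ::ₘ ax A F m ::ₘ cut s(G, F) ::ₘ Q) F G
        (encode (ax A p G ::ₘ ax A F m ::ₘ cut s(G, F) ::ₘ Q) L) S →
      Net.SameUpTo {e | ∃ a ∈ Net.edges (ax A p m ::ₘ Q), e = port a root} S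
        (encode (ax A p m ::ₘ Q)
          (downJumps (ax A p G ::ₘ ax A F m ::ₘ cut s(G, F) ::ₘ Q) L F G)) := by
  obtain ⟨R, hRe⟩ : ∃ R : Net α ν, R = ax A p G ::ₘ ax A F m ::ₘ cut s(G, F) ::ₘ Q := ⟨_, rfl⟩
  obtain ⟨R', hRe'⟩ : ∃ R' : Net α ν, R' = ax A p m ::ₘ Q := ⟨_, rfl⟩
  have hstep : Step (some s(G, F)) R R' := by
    rw [hRe, hRe']
    exact .axiom_cut ..
  rw [← hRe] at hR hL ⊢
  rw [← hRe']
  have hE : R.edges = p ::ₘ G ::ₘ F ::ₘ m ::ₘ Q.edges := by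
    rw [hRe]
    simp only [Net.edges_cons, conclusions, Multiset.insert_eq_cons, Multiset.cons_add,
      Multiset.singleton_add, zero_add]
  have hE' : R'.edges = p ::ₘ m ::ₘ Q.edges := by
    rw [hRe']
    simp [conclusions]
  have hP : R.premises = {G, F} + Q.premises := by
    rw [hRe]
    simp only [Net.premises_cons, premises, Sym2.toMultiset_mk', zero_add]
  have hlpQ : R'.logicalPremises = Q.logicalPremises := by
    rw [hRe']
    simp [Net.logicalPremises, logicalPremises]
  have hlp : R.logicalPremises = 0 + R'.logicalPremises := by
    rw [hlpQ, hRe]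
    simp [Net.logicalPremises, logicalPremises]
  have hnE : (p ::ₘ G ::ₘ F ::ₘ m ::ₘ Q.edges).Nodup := hE ▸ hR.edges_nodup
  have hnP : ({G, F} + Q.premises).Nodup := hP ▸ hR.premises_nodup
  simp only [Multiset.nodup_cons, Multiset.mem_cons, not_or] at hnE
  obtain ⟨⟨hpG, hpF, hpm, hpQ⟩, ⟨hGF, hGm, hGQ⟩, ⟨hFm, hFQ⟩, hmQ, -⟩ := hnE
  have hdis := (Multiset.nodup_add.1 hnP).2.2
  have hFP : F ∉ Q.premises := fun h => Multiset.disjoint_left.1 hdis (by simp) h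
  have hGP : G ∉ Q.premises := fun h => Multiset.disjoint_left.1 hdis (by simp) h
  have hlpP : ∀ t ∈ R'.logicalPremises, t ∈ Q.premises := fun t ht =>
    Multiset.mem_of_le Q.logicalPremises_le (hlpQ ▸ ht)
  have hFlp' : F ∉ R'.logicalPremises := fun h => hFP (hlpP F h)
  have hGlp' : G ∉ R'.logicalPremises := fun h => hGP (hlpP G h)
  have hFlp : F ∉ R.logicalPremises := by
    rw [hlp, zero_add]
    exact hFlp'
  have hGlp : G ∉ R.logicalPremises := by
    rw [hlp, zero_add]
    exact hGlp'
  have hQR : ∀ l ∈ Q, l ∈ R := fun l hl => by simp [hRe, hl]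
  have hJF : premiseJumps R F = (0 : Multiset ν).map fun m => (m, F) := by
    rw [hRe, premiseJumps_cons, premiseJumps_cons, premiseJumps_cons, premiseJumps_eq_zero hFQ]
    rfl
  have hJG : premiseJumps R G = (0 : Multiset ν).map fun m => (m, G) := by
    rw [hRe, premiseJumps_cons, premiseJumps_cons, premiseJumps_cons, premiseJumps_eq_zero hGQ]
    rfl
  have hAF : axiomJumps R F = {(F, m)} := by
    rw [hRe, axiomJumps_cons, axiomJumps_cons, axiomJumps_cons, axiomJumps_eq_zero hFQ]
    simp [axiomJumps, Ne.symm hpF, Ne.symm hGF]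
  have hAG : axiomJumps R G = {(p, G)} := by
    rw [hRe, axiomJumps_cons, axiomJumps_cons, axiomJumps_cons, axiomJumps_eq_zero hGQ]
    simp [axiomJumps, hGF, hGm]
  have hX : (propJumps R L F + propJumps R L G).map Prod.fst =
      {F, p} + (0 : Multiset ν).bind fun m => (L.filter fun q => q.2 = m).map Prod.fst := by
    rw [Multiset.map_add, map_fst_propJumps hJF, map_fst_propJumps hJG, hAF, hAG]
    simp
  have : Nonempty (Link α ν) := ⟨cut s(F, G)⟩
  obtain ⟨intro, hintro⟩ := exists_intro hR.edges_nodup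
  obtain ⟨below, hbelow⟩ := exists_below (R := R) hR.premises_nodup
  have hlG : ax A p G ∈ R := by simp [hRe]
  have hlF : ax A F m ∈ R := by simp [hRe]
  have hip : intro p = ax A p G := hintro _ hlG p (by simp [conclusions])
  have hiG : intro G = ax A p G := hintro _ hlG G (by simp [conclusions])
  have hiF : intro F = ax A F m := hintro _ hlF F (by simp [conclusions])
  have him : intro m = ax A F m := hintro _ hlF m (by simp [conclusions])
  have hM' : ∀ t ∈ R'.logicalPremises, ¬ (below t = F ∨ below t = G) := by
    rw [hlpQ]
    exact below_ne hFQ hGQ fun l hl => hbelow l (hQR l hl)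
  obtain ⟨V, hV⟩ : ∃ V, V = jumpWeight L F G below R'.logicalPremises := ⟨_, rfl⟩
  -- `U` is the weight of the axiom of the out-synchronisation point of `F`.
  obtain ⟨U, hU⟩ : ∃ U, U = syncWeight F G F + syncWeight F G m + greenWeight G 0 m +
    (cutWeights R L intro below F G V 0).leave R L F +
    (cutWeights R L intro below F G V 0).leave R L m := ⟨_, rfl⟩
  obtain ⟨W, hW⟩ : ∃ W, W = cutWeights R L intro below F G V U := ⟨_, rfl⟩
  have hWin : W.inW = syncWeight F G := by rw [hW]; rfl
  have hWblue : W.blueW = blueWeight F G V := by rw [hW]; rfl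
  have hWgreen : W.greenW = greenWeight G U := by rw [hW]; rfl
  have hWbelow : W.below = below := by rw [hW]; rfl
  have hsF : syncWeight F G F = 0 := if_pos (Or.inl rfl)
  have hsG : syncWeight F G G = 0 := if_pos (Or.inr rfl)
  have hgG : greenWeight G U G = U := if_pos rfl
  have hgm : greenWeight G U m = greenWeight G 0 m := by
    rw [greenWeight, greenWeight, if_neg (Ne.symm hGm), if_neg (Ne.symm hGm)]
  have hWF := cutWeights_ax (R := R) (L := L) (below := below) (F := F) (G := G) (V := V)
    (U := U) hiF him
  have hWp := cutWeights_ax (R := R) (L := L) (below := below) (F := F) (G := G) (V := V)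
    (U := U) hip hiG
  rw [← hW] at hWF hWp
  have hWU : U = W.outW F := by
    rw [hWF.1, hgm, hU, hW]
    rfl
  have hleave : W.leave R L F + W.leave R L G = V := by
    rw [hV, ← hWbelow]
    exact leave_add_leave (Ne.symm hGF) hWin hWblue hlp (hWbelow ▸ hM') hFlp hGlp
      fun _ _ _ => Multiset.notMem_zero _
  have hdown : ∀ s, s ≠ F → s ≠ G → W.leave R' (downJumps R L F G) s =
      W.leave R L s + if s = p then V else 0 := by
    intro s hsF hsG
    have h := leave_downJumps (Ne.symm hGF) hWin hWblue hlp
      (Multiset.nodup_of_le R.logicalPremises_le hR.premises_nodup)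
      (fun t ht => absurd ht (Multiset.notMem_zero _))
      (hWbelow ▸ hM') hFlp' hGlp' (hWbelow ▸ hV) hX hsF hsG
    rw [bind_filter_eq_ite (by simp [Ne.symm hpF])] at h
    simpa [hsF] using h
  have hne : ∀ l ∈ Q, ∀ z ∈ l.conclusions, z ≠ F ∧ z ≠ G ∧ z ≠ p := by
    intro l hl z hz
    have hz' : z ∈ Q.edges := Net.mem_edges.2 ⟨l, hl, hz⟩
    exact ⟨fun h => hFQ (h ▸ hz'), fun h => hGQ (h ▸ hz'), fun h => hpQ (h ▸ hz')⟩
  have hne' : ∀ l ∈ Q, ∀ z ∈ l.conclusions, z ≠ F ∧ z ≠ G := fun l hl z hz =>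
    ⟨(hne l hl z hz).1, (hne l hl z hz).2.1⟩
  have hedges : ∀ e, e ∈ R'.edges ↔ e ∈ R.edges ∧ e ≠ F ∧ e ≠ G := by
    intro e
    rw [hE, hE']
    simp only [Multiset.mem_cons]
    constructor
    · rintro (rfl | rfl | h)
      · exact ⟨Or.inl rfl, hpF, hpG⟩
      · exact ⟨by simp, Ne.symm hFm, Ne.symm hGm⟩
      · exact ⟨by simp [h], fun e => hFQ (e ▸ h), fun e => hGQ (e ▸ h)⟩
    · rintro ⟨h, h1, h2⟩
      exact h.imp_right fun h => (h.resolve_left h2).resolve_left h1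
  obtain ⟨D, hD⟩ := hR.exists_flow
  have hXR : ∀ a ∈ ({F, p} : Multiset ν), a ∈ R.edges := by
    intro a ha
    rw [hE]
    rcases Multiset.mem_cons.1 ha with rfl | ha
    · simp
    · simp [Multiset.mem_singleton.1 ha]
  have hfit : ∀ l ∈ R, Fits W F G R L l := by
    intro l hl
    have hl' := hl
    rw [hRe, Multiset.mem_cons, Multiset.mem_cons, Multiset.mem_cons] at hl
    rw [hW]
    refine fits_cutWeights (hintro l hl') (hbelow l hl') (fun _ _ => rfl) ?_ fun s _ j _ =>
      acyclic_cut hlp hM' (Multiset.notMem_zero _) fun _ _ _ => Multiset.notMem_zero _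
    rcases hl with rfl | rfl | rfl | hl
    · exact ⟨hpG, hGF, fun h => (hpF h).elim⟩
    · exact ⟨Ne.symm hGF, Ne.symm hFm, fun _ => Ne.symm hGm⟩
    · trivial
    · exact polarized_of_ne (hne' l hl)
  have hfit' : ∀ l ∈ R', Fits W F G R' (downJumps R L F G) l := by
    intro l hl
    rw [hRe', Multiset.mem_cons] at hl
    rcases hl with rfl | hl
    · have hF' : p ≠ F ∧ p ≠ G := ⟨hpF, hpG⟩
      refine ⟨?_, ?_, hpG, Ne.symm hFm, fun h => (hpF h).elim, acyclic_of_ne hF',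
        acyclic_of_ne hF'⟩
      · rw [hdown p hpF hpG, hdown m (Ne.symm hFm) (Ne.symm hGm), if_pos rfl,
          if_neg (Ne.symm hpm), hWp.1, hgG, hWU, hWF.1, hWF.2, ← hleave, hWin, hsF, hsG]
        abel
      · rw [hWF.2, hWgreen]
    · rw [hW]
      refine fits_cutWeights (hintro l (hQR l hl)) (hbelow l (hQR l hl)) ?_
        (polarized_of_ne (hne' l hl)) fun s _ j hj => acyclic_of_ne (hne' l hl j hj)
      intro s hs
      obtain ⟨h1, h2, h3⟩ := hne l hl s hs
      rw [← hW, hdown s h1 h2, if_neg h3, add_zero]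
  have hQ : ∀ a ∈ Q.premises, a ∈ R.edges ∧ a ≠ F ∧ a ≠ G := by
    intro a ha
    refine ⟨?_, fun h => hFP (h ▸ ha), fun h => hGP (h ▸ ha)⟩
    rw [hD, hP]
    simp [ha]
  refine gadget_elimination hR.edges_nodup hD hR.isMLL hL hfit (hstep.nodup_edges hR.edges_nodup)
    (hstep.edges_eq hD) ?_ ?_ hfit' (n := 0 + 1 + 1 + 1 + 1) ?_ hedges ?_ ?_ ?_
  · intro l hl
    rw [hRe', Multiset.mem_cons] at hl
    rcases hl with rfl | hl
    · trivial
    · exact hR.isMLL l (hQR l hl)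
  · intro q hq
    obtain ⟨h1, h2⟩ := mem_downJumps hL hX hXR hq
    exact ⟨(hedges _).2 h1, (hedges _).2 h2⟩
  · have h := chain_axiom_cut (R := R) (W := W) (A := A) (p := p) (m := m)
      (blocked_frame hQ) (by rw [hWin, hsF]) (by rw [hWin, hsG]) (by rw [hWgreen, hgG, hWU])
    rw [← hRe, ← hRe'] at h
    exact h
  · intro e he
    obtain ⟨-, h1, h2⟩ := (hedges e).1 he
    rw [hWin]
    exact if_neg (not_or.2 ⟨h1, h2⟩)
  · intro e he
    obtain ⟨-, h1, h2⟩ := (hedges e).1 he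
    rw [hWblue]
    exact if_neg (not_or.2 ⟨h1, h2⟩)
  · intro e he
    rw [hWgreen]
    exact if_neg ((hedges e).1 he).2.2

end elimination

end JumpNet

theorem mainTheorem2 {α : Type*} {ν : Type*} [DecidableEq ν]
    (R R' : JumpNet.Net α ν) (hR : R.IsMLLProofStructure)
    (L : Multiset (ν × ν)) (hL : ∀ q ∈ L, q.1 ∈ R.edges ∧ q.2 ∈ R.edges)
    (F G : ν) (hstep : JumpNet.Step (some s(F, G)) R R')
    (hprem : ∀ q ∈ L, q.1 = F ∨ q.1 = G →
      (q.2, F) ∉ JumpNet.premiseJumps R F ∧ (q.2, G) ∉ JumpNet.premiseJumps R G) :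
    (∃ S, JumpNet.IsGadgetElimination R F G (JumpNet.encode R L) S) ∧
      ∀ S, JumpNet.IsGadgetElimination R F G (JumpNet.encode R L) S →
        JumpNet.Net.SameUpTo {x | ∃ e ∈ R'.edges, x = JumpNet.JName.port e JumpNet.Port.root} S
          (JumpNet.encode R' (JumpNet.downJumps R L F G)) := by
  generalize hc : some s(F, G) = c at hstep
  cases hstep with
  | axiom_cut A p n p' n' Q =>
    rcases Sym2.eq_iff.1 (Option.some.inj hc) with ⟨rfl, rfl⟩ | ⟨rfl, rfl⟩
    · simp only [JumpNet.isGadgetElimination_comm (F := F), JumpNet.downJumps_comm (F := F)]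
      exact JumpNet.elimination_axiom_cut hR hL
    · exact JumpNet.elimination_axiom_cut hR hL
  | tensor_par x y z x' y' z' Q =>
    rcases Sym2.eq_iff.1 (Option.some.inj hc) with ⟨rfl, rfl⟩ | ⟨rfl, rfl⟩
    · exact JumpNet.elimination_tensor_par hR hL hprem
    · simp only [JumpNet.isGadgetElimination_comm (F := F), JumpNet.downJumps_comm (F := F)]
      exact JumpNet.elimination_tensor_par hR hL fun q hq h => (hprem q hq h.symm).symm
  | commute j c O I f g Q distinct fresh =>
    exact (hR.isMLL (.jax j O) (by simp)).elim
  | fuse_axioms j x j' O O' Q =>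
    exact (hR.isMLL (.jax j (x ::ₘ O)) (by simp)).elim
  | fuse_contractions x c I I' Q => simp at hc
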